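/- **Theorem (Reduction by Vertex Removal).** All graphs are finite, undirected and simple. For a graph $G$, a set $S\subseteq V(G)$ of sinks and a configuration $\sigma\in\mathbb N^{V(G)}$, a vertex $u\notin S$ is full if $\sigma_u\ge \deg(u)$; firing a full vertex $u\notin S$ removes $\deg(u)$ chips from $u$ and adds one chip to every neighbour of $u$ (chips sent to a sink stay there, and sinks never fire). The instance terminates if finitely many firings lead to a configuration without full vertices, called its terminal configuration. The sandpile prediction problem for $(G,\sigma)$ with set of sinks $S$ is to determine whether the instance terminates and, if so, to compute the terminal configuration (including the numbers of chips on the sinks). The machine model is the word RAM with words of $w$ bits and procedure calls. The time of an algorithm counts the reading of its input and the writing of its output, and its memory includes the cells that hold them. A graph is given by its numbers of vertices and edges, the chips of the vertices, the indicator of the given vertex set and the list of the edges, for an arbitrary numbering of the vertices and order of the edges. There are absolute constants $C$ and $\kappa$ such that for every algorithm $A$ there is an algorithm $B$ with the following property. Let $G$ be a graph with $n$ vertices, $\sigma\in\mathbb N^{V(G)}$ a configuration, $P\subsetneq V(G)$ a proper subset of the vertices, $\mathcal G$ the set of connected components of $G\setminus P$, and let the word length satisfy $2^w\ge (n+\|\sigma\|_1+1)^\kappa$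 (so words of $\Theta(\log n)$ bits suffice if $\|\sigma\|_1$ is polynomial in $n$). For $g\in\mathcal G$ let $T(g)$ and $M(g)$ be numbers such that, for every configuration $\tau$ on $G[V(g)\cup P]$ with at most $n^6+\|\sigma\|_1$ chips in total, $A$ solves the sandpile prediction problem for $(G[V(g)\cup P],\tau)$ with $P$ as the set of sinks in time at most $T(g)$ and memory at most $M(g)$. Then $B$, given $G$, $\sigma$ and $P$, determines whether the instance $(G,\sigma)$ without sinks terminates, and computes its terminal configuration if it does, in time at most $$C\,(C\log n)^{|P|}\sum_{g\in\mathcal G}T(g)$$ and memory at most $C\sum_{g\in\mathcal G}M(g)$. That is, for each fixed $|P|$ the time is $O\bigl(\log^{|P|}n\cdot\sum_{g}T(g)\bigr)$ and the memory is $O\bigl(\sum_g M(g)\bigr)$. -/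

import Mathlib

universe u

/-! ### Sandpiles on finite simple graphs -/

namespace Sandpile

variable {V : Type u}

/-- The degree of a vertex: its number of neighbours. -/
noncomputable def deg (G : SimpleGraph V) (v : V) : ℕ := (G.neighborSet v).ncard

/-- The number `‖σ‖₁` of chips of a configuration. -/
noncomputable def totalChips (σ : V → ℕ) : ℕ := ∑ᶠ v, σ v

open Classical in
/-- Firing `u`: it loses `deg u` chips and every neighbour of `u` (sink or not) gains one.
It is only ever applied to a full vertex, so the subtraction does not truncate. -/
noncomputable def fire (G : SimpleGraph V) (σ : V → ℕ) (u : V) : V → ℕ := fun v =>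
  if v = u then σ v - deg G u else if G.Adj u v then σ v + 1 else σ v

/-- `ρ` arises from `σ` by firing one full vertex outside the set `S` of sinks. -/
def Step (G : SimpleGraph V) (S : Set V) (σ ρ : V → ℕ) : Prop :=
  ∃ u, u ∉ S ∧ deg G u ≤ σ u ∧ ρ = fire G σ u

/-- No vertex outside the set `S` of sinks is full. -/
def IsStable (G : SimpleGraph V) (S : Set V) (σ : V → ℕ) : Prop :=
  ∀ u, u ∉ S → σ u < deg G u

/-- `ρ` is a terminal configuration of the instance `(G, σ)` with set of sinks `S`. -/
def IsTerminalOf (G : SimpleGraph V) (S : Set V) (σ ρ : V → ℕ) : Prop :=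
  Relation.ReflTransGen (Step G S) σ ρ ∧ IsStable G S ρ

/-- The instance `(G, σ)` with set of sinks `S` is terminal (otherwise it is recurrent). -/
def Terminates (G : SimpleGraph V) (S : Set V) (σ : V → ℕ) : Prop :=
  ∃ ρ, IsTerminalOf G S σ ρ

/-- The vertex set `V(g) ∪ P`, for a connected component `g` of `G ∖ P`. -/
def piece (G : SimpleGraph V) (P : Set V)
    (g : (G.induce (Pᶜ : Set V)).ConnectedComponent) : Set V :=
  ((fun v : (Pᶜ : Set V) => (v : V)) '' g.supp) ∪ P

end Sandpile

/-! ### The word RAM: structured programs over `w`-bit words, with procedure calls -/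

namespace WordRAM

/-- The binary operations on words. -/
inductive BinOp
  | add | sub | mul | div | mod | and | or | xor | shl | shr | lt | eq

/-- Value of an operation on `w`-bit words; arithmetic is modulo `2 ^ w`, and comparisons
return `1` or `0`. -/
def BinOp.eval (w : ℕ) : BinOp → ℕ → ℕ → ℕ
  | .add, a, b => (a + b) % 2 ^ w
  | .sub, a, b => (a + (2 ^ w - b)) % 2 ^ w
  | .mul, a, b => (a * b) % 2 ^ w
  | .div, a, b => (a / b) % 2 ^ w
  | .mod, a, b => (a % b) % 2 ^ w
  | .and, a, b => (a &&& b) % 2 ^ w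
  | .or, a, b => (a ||| b) % 2 ^ w
  | .xor, a, b => (a ^^^ b) % 2 ^ w
  | .shl, a, b => (a <<< b) % 2 ^ w
  | .shr, a, b => (a >>> b) % 2 ^ w
  | .lt, a, b => (if a < b then 1 else 0) % 2 ^ w
  | .eq, a, b => (if a = b then 1 else 0) % 2 ^ w

/-- Programs. Variables `x y z` name registers (a program mentions finitely many).
`call p src len dst` runs the program `p` as a procedure, in a fresh frame with registers and
memory of its own: its argument is the block of `len` words at address `src`, its result is
stored from address `dst` on, and the length of the result is put into `len`. -/
inductive Prog
  | skip : Prog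
  | const (x c : ℕ) : Prog
  | op (o : BinOp) (x y z : ℕ) : Prog
  | load (x y : ℕ) : Prog
  | store (x y : ℕ) : Prog
  | seq (p q : Prog) : Prog
  | ite (x : ℕ) (p q : Prog) : Prog
  | loop (x : ℕ) (p : Prog) : Prog
  | call (p : Prog) (src len dst : ℕ) : Prog

/-- A frame: registers and random access memory. -/
structure State where
  reg : ℕ → ℕ
  mem : ℕ → ℕ

namespace State

/-- Start of a procedure: the input `l` lies at the addresses `0, …, |l| - 1`, its length in
register `0`; everything else is zero. -/
def init (l : List ℕ) : State where
  reg := fun x => if x = 0 then l.length else 0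
  mem := fun a => l.getD a 0

def setReg (s : State) (x v : ℕ) : State :=
  { s with reg := Function.update s.reg x v }

def setMem (s : State) (a v : ℕ) : State :=
  { s with mem := Function.update s.mem a v }

/-- The block of `k` words at address `a`. -/
def block (s : State) (a k : ℕ) : List ℕ := (List.range k).map fun i => s.mem (a + i)

/-- Overwrite the block at address `a` by `l`. -/
def setBlock (s : State) (a : ℕ) (l : List ℕ) : State :=
  { s with mem := fun b => if a ≤ b ∧ b < a + l.length then l.getD (b - a) 0 else s.mem b }

/-- End of a procedure: the output lies at address `0`, its length in register `0`. -/
def output (s : State) : List ℕ := s.block 0 (s.reg 0)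

end State

/-- Resources of a run inside one frame: the number of steps (including those of the procedures
it calls), the number of memory words of its own frame that it uses (largest address plus one),
and the largest memory of a procedure that it calls. -/
structure Cost where
  time : ℕ
  own : ℕ
  sub : ℕ

/-- Cost of one run after the other. -/
def Cost.andThen (k l : Cost) : Cost :=
  ⟨k.time + l.time, max k.own l.own, max k.sub l.sub⟩

/-- Time of a procedure: one unit per input word, per step and per output word. -/
def procTime (inp out : List ℕ) (k : Cost) : ℕ := inp.length + k.time + out.length

/-- Memory of a procedure: the words of its own frame (among them input and output) and the
largest memory of a procedure that it calls. -/
def procMem (inp out : List ℕ) (k : Cost) : ℕ :=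
  max k.own (max inp.length out.length) + k.sub

/-- `Run w p s s' k`: on words of `w` bits the program `p`, started in `s`, halts in `s'` at
cost `k`. -/
inductive Run (w : ℕ) : Prog → State → State → Cost → Prop
  | skip (s : State) : Run w .skip s s ⟨1, 0, 0⟩
  | const (s : State) (x c : ℕ) :
      Run w (.const x c) s (s.setReg x (c % 2 ^ w)) ⟨1, 0, 0⟩
  | op (s : State) (o : BinOp) (x y z : ℕ) :
      Run w (.op o x y z) s (s.setReg x (o.eval w (s.reg y) (s.reg z))) ⟨1, 0, 0⟩
  | load (s : State) (x y : ℕ) :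
      Run w (.load x y) s (s.setReg x (s.mem (s.reg y))) ⟨1, s.reg y + 1, 0⟩
  | store (s : State) (x y : ℕ) :
      Run w (.store x y) s (s.setMem (s.reg x) (s.reg y)) ⟨1, s.reg x + 1, 0⟩
  | seq {p q : Prog} {s s' s'' : State} {k l : Cost} :
      Run w p s s' k → Run w q s' s'' l → Run w (.seq p q) s s'' (k.andThen l)
  | ite_true {x : ℕ} {p q : Prog} {s s' : State} {k : Cost} :
      s.reg x ≠ 0 → Run w p s s' k → Run w (.ite x p q) s s' (Cost.andThen ⟨1, 0, 0⟩ k)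
  | ite_false {x : ℕ} {p q : Prog} {s s' : State} {k : Cost} :
      s.reg x = 0 → Run w q s s' k → Run w (.ite x p q) s s' (Cost.andThen ⟨1, 0, 0⟩ k)
  | loop_exit {x : ℕ} {p : Prog} {s : State} :
      s.reg x = 0 → Run w (.loop x p) s s ⟨1, 0, 0⟩
  | loop_step {x : ℕ} {p : Prog} {s s' s'' : State} {k l : Cost} :
      s.reg x ≠ 0 → Run w p s s' k → Run w (.loop x p) s' s'' l →
      Run w (.loop x p) s s'' (Cost.andThen ⟨1, 0, 0⟩ (k.andThen l))
  | call {p : Prog} {src len dst : ℕ} {s s' : State} {inp out : List ℕ} {k : Cost} :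
      inp = s.block (s.reg src) (s.reg len) →
      Run w p (State.init inp) s' k →
      out = s'.output →
      s.reg src + inp.length ≤ 2 ^ w → s.reg dst + out.length ≤ 2 ^ w →
      out.length < 2 ^ w →
      Run w (.call p src len dst) s ((s.setBlock (s.reg dst) out).setReg len out.length)
        ⟨1 + procTime inp out k,
          max (s.reg src + inp.length) (s.reg dst + out.length),
          procMem inp out k⟩

/-- On words of `w` bits the program `p`, run on input `inp`, halts with output `out` in time
`t` and memory `m`. -/
def Returns (w : ℕ) (p : Prog) (inp out : List ℕ) (t m : ℕ) : Prop :=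
  ∃ (s : State) (k : Cost), Run w p (State.init inp) s k ∧ out = s.output ∧
    t = procTime inp out k ∧ m = procMem inp out k

end WordRAM

/-! ### Sandpile prediction as a problem for the word RAM -/

namespace Sandpile

variable {V : Type u}

/-- `es` lists every edge of `G` exactly once, in one of its two orientations. -/
def IsEdgeListing (G : SimpleGraph V) (es : List (V × V)) : Prop :=
  (es.map fun d => s(d.1, d.2)).Nodup ∧
    ∀ d : Sym2 V, d ∈ es.map (fun d => s(d.1, d.2)) ↔ d ∈ G.edgeSet

open Classical in
/-- Encoding by words of a graph on `n` vertices, numbered by `e`, with a configuration and a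
distinguished set of vertices: `n`, the number of edges, the chips of the vertices, the
indicator of the distinguished set, and the pairs of endpoints of the edges. -/
noncomputable def encode {n : ℕ} (e : Fin n ≃ V) (es : List (V × V)) (σ : V → ℕ)
    (P : Set V) : List ℕ :=
  [n, es.length] ++ List.ofFn (fun i => σ (e i)) ++
    List.ofFn (fun i => if e i ∈ P then 1 else 0) ++
    es.flatMap fun d => [((e.symm d.1 : Fin n) : ℕ), ((e.symm d.2 : Fin n) : ℕ)]

/-- `out` is the answer to the prediction problem for `(G, σ)` with set of sinks `S`:
`1` followed by the terminal configuration, or only `0` if the instance does not terminate. -/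
def IsAnswer {n : ℕ} (G : SimpleGraph V) (S : Set V) (σ : V → ℕ) (e : Fin n ≃ V)
    (out : List ℕ) : Prop :=
  (∃ ρ, IsTerminalOf G S σ ρ ∧ out = 1 :: List.ofFn fun i => ρ (e i)) ∨
    (¬ Terminates G S σ ∧ out = [0])

/-- On words of `w` bits, given `G`, `σ` and the vertex set `P` (in whatever numbering of the
vertices and order of the edges), the program `p` solves the prediction problem for `(G, σ)`
with set of sinks `S` in time at most `t` and memory at most `m`. -/
def SolvesWithin (w : ℕ) (p : WordRAM.Prog) (G : SimpleGraph V) (σ : V → ℕ) (P S : Set V)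
    (t m : ℝ) : Prop :=
  ∀ (n : ℕ) (e : Fin n ≃ V) (es : List (V × V)), IsEdgeListing G es →
    ∃ (out : List ℕ) (t' m' : ℕ),
      WordRAM.Returns w p (encode e es σ P) out t' m' ∧
      IsAnswer G S σ e out ∧ (t' : ℝ) ≤ t ∧ (m' : ℝ) ≤ m

end Sandpile

/-! ### Odometers and the least action principle -/

namespace Sandpile

section Odometer

open scoped Classical

variable {V : Type u} [Fintype V]

/-! Least action. Call a function `u` of firing numbers stabilizing on `D` if `IsSuper G D σ u`
holds. A vertex that is full must be fired by every stabilizing `u`, and what remains of `u`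
stabilizes the fired configuration (`IsSuper.fire`). Hence every legal firing sequence stays below
every stabilizing function: an instance terminates exactly when a stabilizing function exists, and
its firing numbers then form the least one (`exists_terminal_of_isSuper`,
`IsTerminalOf.exists_odometer`). Minima of stabilizing functions are stabilizing (`IsSuper.inf`), so
least ones exist. Without sinks the least one is below `n ^ 3` (`odometer_lt`).

Prescribed firing numbers on `P`. Let `p 1, …, p k` be the vertices of `P` and let them fire `x 1,
…, x k` times. The least function that then stabilizes the remaining vertices is found component by
component: each component receives the chips sent by `P` and is stabilized by `A` with `P` as
initially empty sinks, so that the output on the sinks is what `P` receives back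
(`exists_odometer_induce`, `isLeast_isSuper_union`, `Inst.Leaf`). If some piece does not terminate,
neither does the whole instance (`IsSuper.exists_shift`).

Search for the right numbers. At level `j` of `levelSet` the numbers of `p 1, …, p (j - 1)` are
prescribed and the later ones are free below a cap `X > n ^ 3`. Let `m` be the optimum of level `j`
and `u` the optimum of level `j + 1` for a guess `x j`. If the guess is below `m (p j)`, then level
`j + 1` has a solution, and `u` leaves `p j` full by minimality of `m`. If it is not, then adding
the constant `x j - m (p j)` to the free values of `m` gives a function that is stable at all free
vertices and dominates `u`, with equality at `p j`; so `u` does not leave `p j` full, unless the cap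
has made level `j + 1` unsolvable. This is `levelSet_lt_iff`, and it drives a binary search at every
level. Once the value at level `j` is correct, both levels have the same optimum
(`levelSet_descend`).

Cost. The nested searches run as a single loop. With `r j` halvings left at level `j`, every round
lowers the number with digits `r 1, …, r k` in base `b + 2` by one (`digits_pred`), where `2 ^ b ≤ n
^ 3`; so at most `(b + 2) ^ k` rounds occur. The firings of `P` add at most `n ^ 6` chips
(`Inst.sum_chips_le`). All overhead of a round is linear in the size of the graph, and this is at
most the total of the `T g`, because `A` has to read the pieces (`Inst.sum_pieces_bounds`); the same
holds for memory.

The remaining work shows that a word RAM program does this. A small language with exact step counts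
is compiled to the machine, and its verification conditions `vc` carry the elapsed time; they are
sound by `Cmd.vc.halts`. -/

/-- The number of chips that `v` receives if every vertex `w` fires `u w` times. -/
noncomputable def nbrSum (G : SimpleGraph V) (u : V → ℕ) (v : V) : ℕ :=
  ∑ w, if G.Adj v w then u w else 0

/-- Firing every vertex `w` exactly `u w` times leaves no vertex of `D` full. -/
def IsSuper (G : SimpleGraph V) (D : Set V) (σ u : V → ℕ) : Prop :=
  ∀ v ∈ D, σ v + nbrSum G u v < deg G v * (u v + 1)

theorem deg_eq_sum (G : SimpleGraph V) (v : V) : deg G v = ∑ w, if G.Adj v w then 1 else 0 := by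
  rw [deg, Set.ncard_eq_toFinset_card', Finset.sum_ite]
  simp

theorem nbrSum_mono (G : SimpleGraph V) {u u' : V → ℕ} (h : u ≤ u') (v : V) :
    nbrSum G u v ≤ nbrSum G u' v := by
  apply Finset.sum_le_sum
  intro w _
  split_ifs
  · exact h w
  · exact le_rfl

theorem nbrSum_add (G : SimpleGraph V) (u u' : V → ℕ) (v : V) :
    nbrSum G (u + u') v = nbrSum G u v + nbrSum G u' v := by
  unfold nbrSum
  rw [← Finset.sum_add_distrib]
  apply Finset.sum_congr rfl
  intro w _
  split_ifs <;> simp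

theorem nbrSum_single (G : SimpleGraph V) (w v : V) :
    nbrSum G (Pi.single w 1) v = if G.Adj v w then 1 else 0 := by
  unfold nbrSum
  rw [Finset.sum_eq_single w]
  · simp
  · intro b _ hb
    simp [hb]
  · simp

theorem nbrSum_const (G : SimpleGraph V) (t : ℕ) (v : V) :
    nbrSum G (fun _ => t) v = deg G v * t := by
  rw [deg_eq_sum, Finset.sum_mul]
  apply Finset.sum_congr rfl
  intro w _
  split_ifs <;> simp

theorem sum_nbrSum (G : SimpleGraph V) (u : V → ℕ) :
    ∑ v, nbrSum G u v = ∑ v, deg G v * u v := by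
  unfold nbrSum
  rw [Finset.sum_comm]
  apply Finset.sum_congr rfl
  intro w _
  rw [deg_eq_sum, Finset.sum_mul]
  apply Finset.sum_congr rfl
  intro v _
  simp [G.adj_comm]

theorem deg_lt_card (G : SimpleGraph V) (v : V) : deg G v < Fintype.card V := by
  rw [deg, Set.ncard_eq_toFinset_card']
  apply Finset.card_lt_card (t := Finset.univ)
  rw [Finset.ssubset_univ_iff]
  intro h
  have : v ∈ (G.neighborSet v).toFinset := by rw [h]; simp
  simp at this

theorem totalChips_eq_sum (σ : V → ℕ) : totalChips σ = ∑ v, σ v :=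
  finsum_eq_sum_of_fintype σ

/-- At `v` the function with the smaller value decides: the right side of its inequality is
unchanged, while passing to the minimum only lowers the chips received. -/
theorem IsSuper.inf {G : SimpleGraph V} {D : Set V} {σ u u' : V → ℕ}
    (h : IsSuper G D σ u) (h' : IsSuper G D σ u') : IsSuper G D σ (u ⊓ u') := by
  intro v hv
  rcases le_total (u v) (u' v) with hl | hl
  · have e : (u ⊓ u') v = u v := by simp [hl]
    rw [e]
    exact lt_of_le_of_lt (Nat.add_le_add_left (nbrSum_mono G inf_le_left v) _) (h v hv)
  · have e : (u ⊓ u') v = u' v := by simp [hl]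
    rw [e]
    exact lt_of_le_of_lt (Nat.add_le_add_left (nbrSum_mono G inf_le_right v) _) (h' v hv)

theorem IsSuper.mono {G : SimpleGraph V} {D D' : Set V} {σ u : V → ℕ}
    (h : IsSuper G D σ u) (hD : D' ⊆ D) : IsSuper G D' σ u := fun v hv => h v (hD hv)

/-- A nonempty set of functions to `ℕ` that is closed under minima has a least element. -/
theorem exists_isLeast_of_inf_mem {S : Set (V → ℕ)} (hS : S.Nonempty)
    (hinf : ∀ u ∈ S, ∀ u' ∈ S, u ⊓ u' ∈ S) : ∃ m, IsLeast S m := by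
  obtain ⟨m, hm, hmin⟩ := WellFounded.has_min
    (InvImage.wf (fun u : V → ℕ => ∑ v, u v) Nat.lt_wfRel.wf) S hS
  refine ⟨m, hm, fun u hu v => ?_⟩
  by_contra hlt
  push Not at hlt
  apply hmin (m ⊓ u) (hinf m hm u hu)
  show ∑ v, (m ⊓ u) v < ∑ v, m v
  apply Finset.sum_lt_sum
  · intro i _; exact inf_le_left
  · exact ⟨v, Finset.mem_univ v, by simp [hlt]⟩

/-- The chips lost stand on the left, so that no truncated subtraction occurs. -/
theorem fire_add (G : SimpleGraph V) (σ : V → ℕ) (v w : V) (hv : deg G v ≤ σ v) :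
    fire G σ v w + deg G w * (Pi.single v 1 : V → ℕ) w
      = σ w + nbrSum G (Pi.single v 1) w := by
  rw [nbrSum_single]
  unfold fire
  by_cases h : w = v
  · subst h
    simp
    omega
  · simp [h, G.adj_comm w v]
    split_ifs <;> rfl

/-- The core of least action: with `u v = 0` the inequality at a full vertex `v` would fail, so one
firing of `v` can be taken out of `u`. -/
theorem IsSuper.fire {G : SimpleGraph V} {S : Set V} {σ u : V → ℕ} (h : IsSuper G Sᶜ σ u)
    {v : V} (hvS : v ∉ S) (hv : deg G v ≤ σ v) :
    Pi.single v 1 ≤ u ∧ IsSuper G Sᶜ (fire G σ v) (u - Pi.single v 1) := by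
  have h1 : Pi.single v 1 ≤ u := by
    intro w
    by_cases hw : w = v
    · subst hw
      have := h w hvS
      by_contra hlt
      simp at hlt
      rw [hlt] at this
      omega
    · simp [hw]
  refine ⟨h1, fun w hw => ?_⟩
  have e : u = (u - Pi.single v 1) + Pi.single v 1 := (tsub_add_cancel_of_le h1).symm
  set u' := u - Pi.single v 1
  have := h w hw
  rw [e, nbrSum_add] at this
  have hf := fire_add G σ v w hv
  simp only [Pi.add_apply] at this
  have : σ w + (nbrSum G u' w + nbrSum G (Pi.single v 1) w)
    < deg G w * (u' w + 1) + deg G w * (Pi.single v 1 : V → ℕ) w := by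
    rw [← mul_add]; convert this using 2; ring
  omega

/-- Every firing of a full vertex uses up one unit of `∑ v, u v`, so firing in any order must stop.
-/
theorem exists_terminal_of_isSuper {G : SimpleGraph V} {S : Set V} {σ u : V → ℕ}
    (h : IsSuper G Sᶜ σ u) : Terminates G S σ := by
  induction hN : ∑ v, u v using Nat.strong_induction_on generalizing σ u with
  | _ N ih =>
    by_cases hs : IsStable G S σ
    · exact ⟨σ, Relation.ReflTransGen.refl, hs⟩
    · unfold IsStable at hs
      push Not at hs
      obtain ⟨v, hvS, hv⟩ := hs
      obtain ⟨h1, h2⟩ := h.fire hvS hv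
      obtain ⟨ρ, hρ, hst⟩ := ih (∑ w, (u - (Pi.single v 1 : V → ℕ)) w) (by
        rw [← hN]
        apply Finset.sum_lt_sum
        · intro i _; exact tsub_le_self
        · refine ⟨v, Finset.mem_univ v, ?_⟩
          have := h1 v
          simp at this ⊢
          omega) h2 rfl
      exact ⟨ρ, Relation.ReflTransGen.head ⟨v, hvS, hv, rfl⟩ hρ, hst⟩

/-- `c` counts the firings of the sequence. It lies below every stabilizing function by repeated use
of `IsSuper.fire`; the end of the sequence need not be stable for this. -/
theorem exists_odometer {G : SimpleGraph V} {S : Set V} {σ ρ : V → ℕ}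
    (h : Relation.ReflTransGen (Step G S) σ ρ) :
    ∃ c : V → ℕ, (∀ v ∈ S, c v = 0) ∧ (∀ v, ρ v + deg G v * c v = σ v + nbrSum G c v) ∧
      ∀ u, IsSuper G Sᶜ σ u → c ≤ u := by
  induction h using Relation.ReflTransGen.head_induction_on with
  | refl =>
    refine ⟨0, by simp, fun v => ?_, fun u _ v => Nat.zero_le _⟩
    simp [nbrSum]
  | head hstep _ ih =>
    obtain ⟨v, hvS, hv, rfl⟩ := hstep
    obtain ⟨c, hc0, hc1, hc2⟩ := ih
    refine ⟨c + Pi.single v 1, ?_, ?_, ?_⟩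
    · intro w hw
      have : w ≠ v := fun h => hvS (h ▸ hw)
      simp [hc0 w hw, this]
    · intro w
      have h1 := hc1 w
      have h2 := fire_add G _ v w hv
      rw [nbrSum_add, Pi.add_apply, mul_add]
      omega
    · intro u hu
      obtain ⟨h1, h2⟩ := hu.fire hvS hv
      have := hc2 _ h2
      rw [← tsub_add_cancel_of_le h1]
      exact add_le_add_left this _

/-- The odometer of the stabilization is the least function whose firing stabilizes. -/
theorem IsTerminalOf.exists_odometer {G : SimpleGraph V} {S : Set V} {σ ρ : V → ℕ}
    (h : IsTerminalOf G S σ ρ) :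
    ∃ c : V → ℕ, (∀ v ∈ S, c v = 0) ∧ (∀ v, ρ v + deg G v * c v = σ v + nbrSum G c v) ∧
      IsLeast {u | IsSuper G Sᶜ σ u} c := by
  obtain ⟨c, h0, h1, h2⟩ := Sandpile.exists_odometer h.1
  refine ⟨c, h0, h1, fun v hv => ?_, h2⟩
  have := h.2 v hv
  rw [← h1 v, mul_add]
  omega

theorem sum_eq_of_balance {G : SimpleGraph V} {σ ρ c : V → ℕ}
    (h : ∀ v, ρ v + deg G v * c v = σ v + nbrSum G c v) : ∑ v, ρ v = ∑ v, σ v := by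
  have := Finset.sum_congr rfl fun v (_ : v ∈ Finset.univ) => h v
  rw [Finset.sum_add_distrib, Finset.sum_add_distrib, sum_nbrSum] at this
  omega

/-- Across an edge the odometer changes by at most the number of chips. -/
theorem odometer_adj_le {G : SimpleGraph V} {σ ρ c : V → ℕ}
    (h : ∀ v, ρ v + deg G v * c v = σ v + nbrSum G c v) {v w : V} (hvw : G.Adj v w) :
    c v ≤ c w + ∑ z, σ z := by
  by_contra hlt
  push Not at hlt
  -- `f z y` is the net number of chips sent from `z` to `y`. Inside the superlevel set `U` these
  -- cancel, and each edge leaving `U` carries a nonnegative amount outwards. The edge from `v` to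
  -- `w` alone carries `c v - c w`, while `U` cannot lose more chips than it had.
  set U : Finset V := Finset.univ.filter fun z => c v ≤ c z with hU
  set f : V → V → ℤ := fun z y => if G.Adj z y then (c z : ℤ) - c y else 0 with hf
  have hz : ∀ z, (σ z : ℤ) = ρ z + ∑ y, f z y := by
    intro z
    have h1 : (ρ z : ℤ) + deg G z * c z = σ z + nbrSum G c z := by exact_mod_cast h z
    have h2 : ∑ y, f z y = deg G z * c z - nbrSum G c z := by
      rw [deg_eq_sum, nbrSum]
      push_cast
      rw [Finset.sum_mul, ← Finset.sum_sub_distrib]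
      apply Finset.sum_congr rfl
      intro y _
      simp only [hf]
      split_ifs <;> simp
    linarith
  have hanti : ∑ z ∈ U, ∑ y ∈ U, f z y = 0 := by
    have h1 : ∑ z ∈ U, ∑ y ∈ U, f z y = - ∑ z ∈ U, ∑ y ∈ U, f z y := by
      conv_lhs => rw [Finset.sum_comm]
      rw [← Finset.sum_neg_distrib]
      apply Finset.sum_congr rfl
      intro y _
      rw [← Finset.sum_neg_distrib]
      apply Finset.sum_congr rfl
      intro z _
      simp only [hf, G.adj_comm z y]
      split_ifs <;> simp
    linarith
  have hvU : v ∈ U := by simp [hU]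
  have hwU : w ∈ Uᶜ := by simp [hU]; omega
  have hpos : ∀ z ∈ U, ∀ y ∈ Uᶜ, 0 ≤ f z y := by
    intro z hz y hy
    simp [hU] at hz hy
    simp only [hf]
    split_ifs
    · omega
    · exact le_rfl
  have hcut : (c v : ℤ) - c w ≤ ∑ z ∈ U, ∑ y ∈ Uᶜ, f z y := by
    have h1 : f v w ≤ ∑ y ∈ Uᶜ, f v y :=
      Finset.single_le_sum (f := f v) (fun y hy => hpos v hvU y hy) hwU
    have h2 : ∑ y ∈ Uᶜ, f v y ≤ ∑ z ∈ U, ∑ y ∈ Uᶜ, f z y :=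
      Finset.single_le_sum (f := fun z => ∑ y ∈ Uᶜ, f z y)
        (fun z hz => Finset.sum_nonneg fun y hy => hpos z hz y hy) hvU
    have h3 : f v w = (c v : ℤ) - c w := by simp [hf, hvw]
    linarith
  have hsum : ∑ z ∈ U, (σ z : ℤ) = ∑ z ∈ U, (ρ z : ℤ) + ∑ z ∈ U, ∑ y ∈ Uᶜ, f z y := by
    rw [Finset.sum_congr rfl fun z _ => hz z, Finset.sum_add_distrib]
    congr 1
    rw [← zero_add (∑ z ∈ U, ∑ y ∈ Uᶜ, f z y), ← hanti, ← Finset.sum_add_distrib]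
    apply Finset.sum_congr rfl
    intro z _
    exact (Finset.sum_add_sum_compl U _).symm
  have h4 : ∑ z ∈ U, (σ z : ℤ) ≤ ∑ z, (σ z : ℤ) :=
    Finset.sum_le_sum_of_subset_of_nonneg (Finset.subset_univ _) fun _ _ _ => by positivity
  have h5 : 0 ≤ ∑ z ∈ U, (ρ z : ℤ) := Finset.sum_nonneg fun _ _ => by positivity
  have h6 : ((∑ z, σ z : ℕ) : ℤ) = ∑ z, (σ z : ℤ) := by push_cast; rfl
  omega

/-- Without sinks, every component contains a vertex that never fires. -/
theorem exists_reachable_odometer_eq_zero {G : SimpleGraph V} {σ c : V → ℕ}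
    (hc : IsLeast {u | IsSuper G Set.univ σ u} c) (v : V) :
    ∃ w, G.Reachable v w ∧ c w = 0 := by
  by_contra hcon
  push Not at hcon
  set Z : Set V := {w | G.Reachable v w} with hZ
  -- If `c` were positive on the whole component `Z`, one firing of each vertex of `Z` could be
  -- saved: every vertex then loses and gains `deg` chips less, so the result still stabilizes and
  -- contradicts minimality.
  set d : V → ℕ := fun w => if w ∈ Z then c w - 1 else c w with hd
  have hsup : IsSuper G Set.univ σ d := by
    intro w _
    have h0 := hc.1 w (Set.mem_univ w)
    by_cases hw : w ∈ Z
    · have h1 : nbrSum G c w = nbrSum G d w + deg G w := by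
        rw [deg_eq_sum, nbrSum, nbrSum, ← Finset.sum_add_distrib]
        apply Finset.sum_congr rfl
        intro y _
        split_ifs with hadj
        · have hy : y ∈ Z := SimpleGraph.Reachable.trans hw hadj.reachable
          have := Nat.pos_of_ne_zero (hcon y hy)
          simp [hd, hy]
          omega
        · rfl
      have h2 : c w = d w + 1 := by
        have := Nat.pos_of_ne_zero (hcon w hw)
        simp [hd, hw]
        omega
      rw [h1, h2, mul_add _ (d w + 1), mul_one] at h0
      omega
    · have h1 : nbrSum G c w = nbrSum G d w := by
        apply Finset.sum_congr rfl
        intro y _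
        split_ifs with hadj
        · have hy : y ∉ Z := fun hy => hw (SimpleGraph.Reachable.trans hy hadj.symm.reachable)
          simp [hd, hy]
        · rfl
      have h2 : c w = d w := by simp [hd, hw]
      rw [← h1, ← h2]
      exact h0
  have hvZ : v ∈ Z := SimpleGraph.Reachable.refl v
  have h1 := hc.2 hsup v
  have h2 := hcon v hvZ
  simp [hd, hvZ] at h1
  omega

/-- A terminal configuration without sinks has fewer than `n` chips on each vertex, so there are at
most `n * n` chips in total. A path of at most `n - 1` edges leads to a vertex that never fires, and
along each edge the odometer changes by at most the number of chips. -/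
theorem odometer_lt {G : SimpleGraph V} {σ c : V → ℕ}
    (hc : IsLeast {u | IsSuper G Set.univ σ u} c) (v : V) : c v < Fintype.card V ^ 3 := by
  obtain ⟨ρ, hρ⟩ := exists_terminal_of_isSuper (S := ∅) (by simpa using hc.1)
  obtain ⟨c', _, h1, h2⟩ := hρ.exists_odometer
  rw [Set.compl_empty] at h2
  obtain rfl : c' = c := h2.unique hc
  set n := Fintype.card V
  have hM : ∑ z, σ z ≤ n * n := by
    rw [← sum_eq_of_balance h1]
    calc ∑ z, ρ z ≤ ∑ _z : V, n :=
          Finset.sum_le_sum fun z _ => ((hρ.2 z (by simp)).trans (deg_lt_card G z)).le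
      _ = n * n := by simp [n]
  obtain ⟨w, ⟨p⟩, hw⟩ := exists_reachable_odometer_eq_zero hc v
  have hwalk : ∀ (a b : V) (q : G.Walk a b), c' a ≤ c' b + q.length * ∑ z, σ z := by
    intro a b q
    induction q with
    | nil => simp
    | cons hadj q ih =>
      have := odometer_adj_le h1 hadj
      rw [SimpleGraph.Walk.length_cons, add_mul]
      omega
  have h3 := hwalk _ _ p.toPath.1
  have h4 : p.toPath.1.length < n := p.toPath.2.length_lt
  rw [hw, zero_add] at h3
  have hn : 0 < n := by omega
  calc c' v ≤ p.toPath.1.length * (∑ z, σ z) := h3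
    _ ≤ (n - 1) * (n * n) := Nat.mul_le_mul (by omega) hM
    _ < n ^ 3 := by
      obtain ⟨k, hk⟩ : ∃ k, n = k + 1 := ⟨n - 1, by omega⟩
      rw [hk]
      simp
      ring_nf
      nlinarith [Nat.zero_le k]

/-! ### The nested search for the firing numbers of the removed vertices -/

/-- The candidates of the search at level `j`: the firing numbers of `p 1, …, p (j - 1)` are
prescribed by `x`, those of `p j, …, p k` are below `X`. -/
def levelSet (G : SimpleGraph V) (σ : V → ℕ) (p : ℕ → V) (k X j : ℕ) (x : ℕ → ℕ) :
    Set (V → ℕ) :=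
  {u | (∀ i, 1 ≤ i → i < j → u (p i) = x i) ∧
    IsSuper G {v | ∀ i, 1 ≤ i → i < j → v ≠ p i} σ u ∧
    ∀ i, j ≤ i → i ≤ k → u (p i) < X}

variable {G : SimpleGraph V} {σ : V → ℕ} {p : ℕ → V} {k X : ℕ}

theorem levelSet_congr {j : ℕ} {x y : ℕ → ℕ} (h : ∀ i, 1 ≤ i → i < j → x i = y i) :
    levelSet G σ p k X j x = levelSet G σ p k X j y := by
  ext u
  simp only [levelSet, Set.mem_ofPred_eq]
  refine and_congr_left fun _ => forall_congr' fun i => forall_congr' fun h1 =>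
    forall_congr' fun h2 => by rw [h i h1 h2]

theorem levelSet_exists_isLeast {j : ℕ} {x : ℕ → ℕ} (h : (levelSet G σ p k X j x).Nonempty) :
    ∃ m, IsLeast (levelSet G σ p k X j x) m := by
  refine exists_isLeast_of_inf_mem h ?_
  rintro u ⟨h1, h2, h3⟩ u' ⟨h1', h2', h3'⟩
  refine ⟨fun i hi hj => ?_, h2.inf h2', fun i hi hj => ?_⟩
  · simp [h1 i hi hj, h1' i hi hj]
  · exact lt_of_le_of_lt inf_le_left (h3 i hi hj)

/-- The vertex `v` is not full after firing `u`. -/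
def IsSat (G : SimpleGraph V) (σ u : V → ℕ) (v : V) : Prop :=
  σ v + nbrSum G u v < deg G v * (u v + 1)

theorem levelSet_of_succ {j : ℕ} {x : ℕ → ℕ} {u : V → ℕ} (hx : x j < X) (hj : 1 ≤ j)
    (hu : u ∈ levelSet G σ p k X (j + 1) x) (hs : IsSat G σ u (p j)) :
    u ∈ levelSet G σ p k X j x := by
  obtain ⟨h1, h2, h3⟩ := hu
  refine ⟨fun i hi hij => h1 i hi (by omega), fun v hv => ?_, fun i hi hik => ?_⟩
  · by_cases hvj : v = p j
    · rw [hvj]; exact hs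
    · refine h2 v fun i hi hij => ?_
      rcases Nat.lt_succ_iff_lt_or_eq.1 hij with h | rfl
      · exact hv i hi h
      · exact hvj
  · rcases Nat.eq_or_lt_of_le hi with rfl | h
    · rw [h1 j hj (by omega)]; exact hx
    · exact h3 i (by omega) hik

theorem levelSet_succ_of_eq {j : ℕ} {x : ℕ → ℕ} {u : V → ℕ}
    (hu : u ∈ levelSet G σ p k X j x) (hs : u (p j) = x j) :
    u ∈ levelSet G σ p k X (j + 1) x := by
  obtain ⟨h1, h2, h3⟩ := hu
  refine ⟨fun i hi hij => ?_, h2.mono fun v hv i hi hij => hv i hi (by omega),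
    fun i hi hik => h3 i (by omega) hik⟩
  rcases Nat.lt_succ_iff_lt_or_eq.1 hij with h | rfl
  · exact h1 i hi h
  · exact hs

/-- If the value at level `j` is the right one, then the optimum of level `j + 1` is the optimum
of level `j`. -/
theorem levelSet_descend {j : ℕ} {x : ℕ → ℕ} {u : V → ℕ} (hj : 1 ≤ j) (hjk : j ≤ k)
    (hp : ∀ i j, 1 ≤ i → i < j → j ≤ k → p i ≠ p j)
    (hu : (levelSet G σ p k X (j + 1) x).Nonempty → IsLeast (levelSet G σ p k X (j + 1) x) u)
    (hx : ∀ m, IsLeast (levelSet G σ p k X j x) m → m (p j) = x j)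
    (hne : (levelSet G σ p k X j x).Nonempty) : IsLeast (levelSet G σ p k X j x) u := by
  obtain ⟨m, hm⟩ := levelSet_exists_isLeast hne
  have hmj := hx m hm
  -- The optimum `m` is itself a candidate at level `j + 1`. Hence `u ≤ m` with equality at `p j`,
  -- and the inequality of `m` at `p j` passes to `u`.
  have hm' := levelSet_succ_of_eq hm.1 hmj
  have hu' := hu ⟨m, hm'⟩
  have hum : u ≤ m := hu'.2 hm'
  have huj : u (p j) = m (p j) := by rw [hmj, hu'.1.1 j hj (by omega)]
  have hmem : u ∈ levelSet G σ p k X j x := by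
    refine levelSet_of_succ (by rw [← hmj]; exact hm.1.2.2 j le_rfl hjk) hj hu'.1 ?_
    unfold IsSat
    rw [huj]
    refine lt_of_le_of_lt (Nat.add_le_add_left (nbrSum_mono G hum _) _) ?_
    exact hm.1.2.1 _ fun i hi hij => (hp i j hi hij hjk).symm
  exact ⟨hmem, fun u' hu' => hum.trans (hm.2 hu')⟩

/-- The comparison that drives the search: a value below the optimum is recognized by the
violation at `p j` of the optimum of level `j + 1`. -/
theorem levelSet_lt_iff {j : ℕ} {x : ℕ → ℕ} {u m : V → ℕ} (hj : 1 ≤ j) (hjk : j ≤ k)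
    (hp : ∀ i j, 1 ≤ i → i < j → j ≤ k → p i ≠ p j)
    (hu : (levelSet G σ p k X (j + 1) x).Nonempty → IsLeast (levelSet G σ p k X (j + 1) x) u)
    (hx : x j < X) (hm : IsLeast (levelSet G σ p k X j x) m) :
    x j < m (p j) ↔ u ∈ levelSet G σ p k X (j + 1) x ∧ ¬ IsSat G σ u (p j) := by
  constructor
  · intro hlt
    -- Lowering `m` at `p j` alone can violate stability only at `p j`, where level `j + 1` asks for
    -- nothing. So that level has a candidate.
    set m' : V → ℕ := Function.update m (p j) (x j) with hm'
    have hle : m' ≤ m := by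
      intro v
      by_cases hv : v = p j
      · subst hv; simp [hm', hlt.le]
      · simp [hm', hv]
    have hmem : m' ∈ levelSet G σ p k X (j + 1) x := by
      refine ⟨fun i hi hij => ?_, fun v hv => ?_, fun i hi hik => ?_⟩
      · rcases Nat.lt_succ_iff_lt_or_eq.1 hij with h | rfl
        · simp [hm', hp i j hi h hjk, hm.1.1 i hi h]
        · simp [hm']
      · have hvj : v ≠ p j := hv j hj (by omega)
        have : m' v = m v := by simp [hm', hvj]
        rw [this]
        exact lt_of_le_of_lt (Nat.add_le_add_left (nbrSum_mono G hle _) _)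
          (hm.1.2.1 v fun i hi hij => hv i hi (by omega))
      · exact (hle _).trans_lt (hm.1.2.2 i (by omega) hik)
    have hu' := hu ⟨m', hmem⟩
    refine ⟨hu'.1, fun hs => ?_⟩
    have h1 : m (p j) ≤ u (p j) := hm.2 (levelSet_of_succ hx hj hu'.1 hs) (p j)
    rw [hu'.1.1 j hj (by omega)] at h1
    omega
  · rintro ⟨hmem, hs⟩
    by_contra hlt
    push Not at hlt
    have hu' := hu ⟨u, hmem⟩
    set t := x j - m (p j) with ht
    -- Raising all free vertices by the same `t` gives each of them at most `deg * t` further chips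
    -- while it sends off exactly that many; stability at the free vertices survives. The cap may
    -- fail for `v`, but not for `u ⊓ v`.
    set v : V → ℕ := fun z => if ∃ i, 1 ≤ i ∧ i < j ∧ z = p i then m z else m z + t with hv
    have hvle : v ≤ m + fun _ => t := by
      intro z
      simp only [hv, Pi.add_apply]
      split_ifs <;> omega
    have hsup : IsSuper G {v | ∀ i, 1 ≤ i → i < j → v ≠ p i} σ v := by
      intro z hz
      have h1 : v z = m z + t := by
        simp only [hv]
        rw [if_neg]
        rintro ⟨i, hi, hij, h⟩
        exact hz i hi hij h
      have h2 := hm.1.2.1 z hz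
      have h3 := nbrSum_mono G hvle z
      rw [nbrSum_add, nbrSum_const] at h3
      rw [h1, show m z + t + 1 = (m z + 1) + t by ring, mul_add]
      omega
    have hpj : p j ∈ {v | ∀ i, 1 ≤ i → i < j → v ≠ p i} :=
      fun i hi hij => (hp i j hi hij hjk).symm
    have hvj : v (p j) = x j := by
      simp only [hv]
      rw [if_neg]
      · omega
      · rintro ⟨i, hi, hij, h⟩
        exact hpj i hi hij h
    have hmin : u ⊓ v ∈ levelSet G σ p k X (j + 1) x := by
      refine ⟨fun i hi hij => ?_, hmem.2.1.inf (hsup.mono ?_), fun i hi hik => ?_⟩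
      · have h1 := hmem.1 i hi hij
        suffices u (p i) ≤ v (p i) from (min_eq_left this).trans h1
        rcases Nat.lt_succ_iff_lt_or_eq.1 hij with h | rfl
        · have : v (p i) = m (p i) := by
            simp only [hv]
            rw [if_pos ⟨i, hi, h, rfl⟩]
          rw [this, hm.1.1 i hi h, h1]
        · rw [hvj, h1]
      · exact fun z hz i hi hij => hz i hi (by omega)
      · exact lt_of_le_of_lt inf_le_left (hmem.2.2 i hi hik)
    have huv : u ≤ v := (hu'.2 hmin).trans inf_le_right
    apply hs
    unfold IsSat
    rw [hmem.1 j hj (by omega), ← hvj]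
    exact lt_of_le_of_lt (Nat.add_le_add_left (nbrSum_mono G huv _) _) (hsup _ hpj)

end Odometer

end Sandpile

/-! ### A small imperative language over registers and arrays, compiled to the word RAM -/

namespace WordRAM

set_option linter.constructorNameAsVariable false

/-- The registers of the program. -/
inductive Reg
  | n | m2 | ib | eb | k | nn | pw | half | pp | a | i | j | d | e | u | z | qt | qh | st | nc | cc
  | en | ng | ep | len | ok | run | feas | t
  deriving DecidableEq

/-- The arrays of the program; the input lies in `inp`. -/
inductive Arr
  | inp | pl | loc | head | nxt | deg | dst | ppe | q | start | buf | out | x | cnt | pwr | h | fin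
  deriving DecidableEq

namespace Reg

/-- The number of a register; register `0` holds the common length of the arrays. -/
def idx : Reg → ℕ
  | n => 1 | m2 => 2 | ib => 3 | eb => 4 | k => 5 | nn => 6 | pw => 7 | half => 8 | pp => 9
  | a => 10 | i => 11 | j => 12 | d => 13 | e => 14 | u => 15 | z => 16 | qt => 17 | qh => 18
  | st => 19 | nc => 20 | cc => 21 | en => 22 | ng => 23 | ep => 24 | len => 25 | ok => 26
  | run => 27 | feas => 28 | t => 29

theorem idx_pos (x : Reg) : 0 < x.idx := by cases x <;> decide

theorem idx_lt (x : Reg) : x.idx < 32 := by cases x <;> decide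

theorem idx_inj {x y : Reg} (h : x.idx = y.idx) : x = y := by
  cases x <;> cases y <;> first | rfl | exact absurd h (by decide)

end Reg

namespace Arr

/-- The position of an array in memory. -/
def idx : Arr → ℕ
  | inp => 0 | pl => 1 | loc => 2 | head => 3 | nxt => 4 | deg => 5 | dst => 6 | ppe => 7 | q => 8
  | start => 9 | buf => 10 | out => 11 | x => 12 | cnt => 13 | pwr => 14 | h => 15 | fin => 16

theorem idx_lt (x : Arr) : x.idx < 17 := by cases x <;> decide

theorem idx_inj {x y : Arr} (h : x.idx = y.idx) : x = y := by
  cases x <;> cases y <;> first | rfl | exact absurd h (by decide)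

end Arr

/-- Contents of the registers and arrays. -/
structure Store where
  reg : Reg → ℕ
  arr : Arr → ℕ → ℕ

namespace Store

/-- Assignment to a register. -/
def setReg (s : Store) (x : Reg) (v : ℕ) : Store :=
  { s with reg := fun y => if y = x then v else s.reg y }

/-- Replacement of an array. -/
def setArr (s : Store) (a : Arr) (f : ℕ → ℕ) : Store :=
  { s with arr := fun y => if y = a then f else s.arr y }

@[simp] theorem setReg_reg (s : Store) (x y : Reg) (v : ℕ) :
    (s.setReg x v).reg y = if y = x then v else s.reg y := by
  rfl

@[simp] theorem setReg_arr (s : Store) (x : Reg) (v : ℕ) : (s.setReg x v).arr = s.arr := rfl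

@[simp] theorem setArr_reg (s : Store) (a : Arr) (f : ℕ → ℕ) : (s.setArr a f).reg = s.reg := rfl

@[simp] theorem setArr_arr (s : Store) (a b : Arr) (f : ℕ → ℕ) :
    (s.setArr a f).arr b = if b = a then f else s.arr b := by
  rfl

end Store

/-- Word length, common length of the arrays, and a bound for the memory of called procedures. -/
structure Mach where
  w : ℕ
  N : ℕ
  b : ℕ

/-- All arrays are addressable. -/
structure Mach.Valid (M : Mach) : Prop where
  arr : 17 * M.N ≤ 2 ^ M.w
  lit : 64 ≤ 2 ^ M.w

/-- The frame `s` represents the contents `h`. -/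
structure Rel (M : Mach) (h : Store) (s : State) : Prop where
  len : s.reg 0 = M.N
  reg : ∀ x : Reg, s.reg x.idx = h.reg x
  arr : ∀ (a : Arr) (i : ℕ), i < M.N → s.mem (a.idx * M.N + i) = h.arr a i
  reg_lt : ∀ x : Reg, h.reg x < 2 ^ M.w
  arr_lt : ∀ (a : Arr) (i : ℕ), i < M.N → h.arr a i < 2 ^ M.w

/-- Expressions. -/
inductive Exp
  | v (x : Reg)
  | c (n : ℕ)
  | add (e f : Exp)
  | sub (e f : Exp)
  | mul (e f : Exp)
  | div (e f : Exp)
  | mod (e f : Exp)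
  | lt (e f : Exp)
  | eq (e f : Exp)
  | get (a : Arr) (e : Exp)

namespace Exp

/-- The value of an expression. -/
def val (h : Store) : Exp → ℕ
  | v x => h.reg x
  | c n => n
  | add e f => e.val h + f.val h
  | sub e f => e.val h - f.val h
  | mul e f => e.val h * f.val h
  | div e f => e.val h / f.val h
  | mod e f => e.val h % f.val h
  | lt e f => if e.val h < f.val h then 1 else 0
  | eq e f => if e.val h = f.val h then 1 else 0
  | get a e => h.arr a (e.val h)

/-- The evaluation neither overflows nor leaves the arrays. -/
def ok (M : Mach) (h : Store) : Exp → Prop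
  | v _ => True
  | c n => n < 2 ^ M.w
  | add e f => e.ok M h ∧ f.ok M h ∧ e.val h + f.val h < 2 ^ M.w
  | sub e f => e.ok M h ∧ f.ok M h ∧ f.val h ≤ e.val h
  | mul e f => e.ok M h ∧ f.ok M h ∧ e.val h * f.val h < 2 ^ M.w
  | div e f => e.ok M h ∧ f.ok M h
  | mod e f => e.ok M h ∧ f.ok M h
  | lt e f => e.ok M h ∧ f.ok M h
  | eq e f => e.ok M h ∧ f.ok M h
  | get _ e => e.ok M h ∧ e.val h < M.N

/-- The number of steps of the evaluation. -/
def cost : Exp → ℕ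
  | v _ => 1
  | c _ => 1
  | add e f => e.cost + f.cost + 1
  | sub e f => e.cost + f.cost + 1
  | mul e f => e.cost + f.cost + 1
  | div e f => e.cost + f.cost + 1
  | mod e f => e.cost + f.cost + 1
  | lt e f => e.cost + f.cost + 1
  | eq e f => e.cost + f.cost + 1
  | get _ e => e.cost + 4

/-- Code for a binary operation with operands computed into `t` and `t + 1`. -/
def binCode (o : BinOp) (p q : Prog) (t : ℕ) : Prog := .seq p (.seq q (.op o t t (t + 1)))

/-- Code that computes an expression into register `t`; it uses only registers from `t` on. -/
def code : Exp → ℕ → Prog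
  | v x, t => .op .or t x.idx x.idx
  | c n, t => .const t n
  | add e f, t => binCode .add (e.code t) (f.code (t + 1)) t
  | sub e f, t => binCode .sub (e.code t) (f.code (t + 1)) t
  | mul e f, t => binCode .mul (e.code t) (f.code (t + 1)) t
  | div e f, t => binCode .div (e.code t) (f.code (t + 1)) t
  | mod e f, t => binCode .mod (e.code t) (f.code (t + 1)) t
  | lt e f, t => binCode .lt (e.code t) (f.code (t + 1)) t
  | eq e f, t => binCode .eq (e.code t) (f.code (t + 1)) t
  | get a e, t => .seq (e.code t) (.seq (.const (t + 1) a.idx) (.seq (.op .mul (t + 1) (t + 1) 0)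
      (.seq (.op .add t t (t + 1)) (.load t t))))

end Exp

theorem addr_lt {M : Mach} {a : Arr} {i : ℕ} (hi : i < M.N) : a.idx * M.N + i < 17 * M.N := by
  have h1 := a.idx_lt
  have h2 : (a.idx + 1) * M.N ≤ 17 * M.N := Nat.mul_le_mul_right _ h1
  rw [add_mul, one_mul] at h2
  omega

/-- Registers from `32` on represent nothing and serve as scratch space for evaluations. -/
theorem Rel.of_eq {M : Mach} {h : Store} {s s' : State} (hs : Rel M h s) (hm : s'.mem = s.mem)
    (hr : ∀ y < 32, s'.reg y = s.reg y) : Rel M h s' where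
  len := by rw [hr 0 (by norm_num), hs.len]
  reg x := by rw [hr _ x.idx_lt, hs.reg]
  arr a i hi := by rw [hm, hs.arr a i hi]
  reg_lt := hs.reg_lt
  arr_lt := hs.arr_lt

theorem Exp.run_bin {M : Mach} {s : State} {o : BinOp} {p q : Prog} {t v v' c c' : ℕ}
    (hp : ∃ s' k, Run M.w p s s' k ∧ k.time = c ∧ k.own ≤ 17 * M.N ∧ k.sub = 0 ∧
      s'.mem = s.mem ∧ s'.reg t = v ∧ ∀ y < t, s'.reg y = s.reg y)
    (hq : ∀ s', s'.mem = s.mem → (∀ y < t, s'.reg y = s.reg y) →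
      ∃ s'' k, Run M.w q s' s'' k ∧ k.time = c' ∧ k.own ≤ 17 * M.N ∧ k.sub = 0 ∧
      s''.mem = s'.mem ∧ s''.reg (t + 1) = v' ∧ ∀ y < t + 1, s''.reg y = s'.reg y) :
    ∃ s' k, Run M.w (binCode o p q t) s s' k ∧ k.time = c + c' + 1 ∧ k.own ≤ 17 * M.N ∧
      k.sub = 0 ∧ s'.mem = s.mem ∧ s'.reg t = o.eval M.w v v' ∧ ∀ y < t, s'.reg y = s.reg y := by
  obtain ⟨s1, k1, r1, ht1, ho1, hb1, hm1, hv1, hr1⟩ := hp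
  obtain ⟨s2, k2, r2, ht2, ho2, hb2, hm2, hv2, hr2⟩ := hq s1 hm1 hr1
  refine ⟨_, _, Run.seq r1 (Run.seq r2 (Run.op s2 o t t (t + 1))), ?_, ?_, ?_, ?_, ?_, ?_⟩
  · simp only [Cost.andThen]; omega
  · simp only [Cost.andThen]; omega
  · simp only [Cost.andThen]; omega
  · simp [State.setReg, hm2, hm1]
  · simp [State.setReg, hv2, hr2 t (by omega), hv1]
  · intro y hy
    simp [State.setReg, Function.update_of_ne (show y ≠ t by omega), hr2 y (by omega), hr1 y hy]

/-- The second operand of an operation is computed one register higher, so the first survives. The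
induction therefore includes that registers below `t` and the memory are preserved. -/
theorem Exp.run {M : Mach} (hM : M.Valid) {h : Store} (e : Exp) : ∀ {s : State} {t : ℕ},
    Rel M h s → e.ok M h → 32 ≤ t →
    e.val h < 2 ^ M.w ∧
    ∃ s' k, Run M.w (e.code t) s s' k ∧ k.time = e.cost ∧ k.own ≤ 17 * M.N ∧ k.sub = 0 ∧
      s'.mem = s.mem ∧ s'.reg t = e.val h ∧ ∀ y < t, s'.reg y = s.reg y := by
  have hbin : ∀ (o : BinOp) (e f : Exp) {s : State} {t : ℕ}, Rel M h s →
      (∀ {s : State} {t : ℕ}, Rel M h s → 32 ≤ t → e.val h < 2 ^ M.w ∧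
        ∃ s' k, Run M.w (e.code t) s s' k ∧ k.time = e.cost ∧ k.own ≤ 17 * M.N ∧ k.sub = 0 ∧
        s'.mem = s.mem ∧ s'.reg t = e.val h ∧ ∀ y < t, s'.reg y = s.reg y) →
      (∀ {s : State} {t : ℕ}, Rel M h s → 32 ≤ t → f.val h < 2 ^ M.w ∧
        ∃ s' k, Run M.w (f.code t) s s' k ∧ k.time = f.cost ∧ k.own ≤ 17 * M.N ∧ k.sub = 0 ∧
        s'.mem = s.mem ∧ s'.reg t = f.val h ∧ ∀ y < t, s'.reg y = s.reg y) → 32 ≤ t →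
      e.val h < 2 ^ M.w ∧ f.val h < 2 ^ M.w ∧
      ∃ s' k, Run M.w (binCode o (e.code t) (f.code (t + 1)) t) s s' k ∧
        k.time = e.cost + f.cost + 1 ∧ k.own ≤ 17 * M.N ∧ k.sub = 0 ∧ s'.mem = s.mem ∧
        s'.reg t = o.eval M.w (e.val h) (f.val h) ∧ ∀ y < t, s'.reg y = s.reg y := by
    intro o e f s t hs he hf ht
    refine ⟨(he hs ht).1, (hf hs ht).1, Exp.run_bin (he hs ht).2 fun s' hm hr => ?_⟩
    exact (hf (hs.of_eq hm fun y hy => hr y (by omega)) (by omega)).2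
  induction e with
  | v x =>
    intro s t hs _ ht
    refine ⟨hs.reg_lt x, _, _, Run.op _ _ _ _ _, rfl, Nat.zero_le _, rfl, rfl, ?_, ?_⟩
    · simp only [State.setReg, Function.update_self, BinOp.eval, Nat.or_self, hs.reg]
      exact Nat.mod_eq_of_lt (hs.reg_lt x)
    · intro y hy
      simp [State.setReg, Function.update_of_ne (show y ≠ t by omega)]
  | c n =>
    intro s t hs hok ht
    refine ⟨hok, _, _, Run.const _ _ _, rfl, Nat.zero_le _, rfl, rfl, ?_, ?_⟩
    · simp only [State.setReg, Function.update_self]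
      exact Nat.mod_eq_of_lt hok
    · intro y hy
      simp [State.setReg, Function.update_of_ne (show y ≠ t by omega)]
  | add e f ihe ihf =>
    intro s t hs hok ht
    obtain ⟨_, _, s', k, h1, h2, h3, h4, h5, h6, h7⟩ := hbin .add e f hs
      (fun hs ht => ihe hs hok.1 ht) (fun hs ht => ihf hs hok.2.1 ht) ht
    exact ⟨hok.2.2, s', k, h1, h2, h3, h4, h5, h6.trans (Nat.mod_eq_of_lt hok.2.2), h7⟩
  | mul e f ihe ihf =>
    intro s t hs hok ht
    obtain ⟨_, _, s', k, h1, h2, h3, h4, h5, h6, h7⟩ := hbin .mul e f hs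
      (fun hs ht => ihe hs hok.1 ht) (fun hs ht => ihf hs hok.2.1 ht) ht
    exact ⟨hok.2.2, s', k, h1, h2, h3, h4, h5, h6.trans (Nat.mod_eq_of_lt hok.2.2), h7⟩
  | sub e f ihe ihf =>
    intro s t hs hok ht
    obtain ⟨h8, _, s', k, h1, h2, h3, h4, h5, h6, h7⟩ := hbin .sub e f hs
      (fun hs ht => ihe hs hok.1 ht) (fun hs ht => ihf hs hok.2.1 ht) ht
    have h9 := hok.2.2
    refine ⟨(Nat.sub_le _ _).trans_lt h8, s', k, h1, h2, h3, h4, h5, h6.trans ?_, h7⟩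
    simp only [BinOp.eval, Exp.val]
    -- Subtraction modulo `2 ^ w` agrees with subtraction of natural numbers because `Exp.ok`
    -- forbids a negative difference.
    rw [show e.val h + (2 ^ M.w - f.val h) = (e.val h - f.val h) + 2 ^ M.w by omega,
      Nat.add_mod_right, Nat.mod_eq_of_lt (by omega)]
  | div e f ihe ihf =>
    intro s t hs hok ht
    obtain ⟨h8, _, s', k, h1, h2, h3, h4, h5, h6, h7⟩ := hbin .div e f hs
      (fun hs ht => ihe hs hok.1 ht) (fun hs ht => ihf hs hok.2 ht) ht
    have h9 : e.val h / f.val h < 2 ^ M.w := (Nat.div_le_self _ _).trans_lt h8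
    exact ⟨h9, s', k, h1, h2, h3, h4, h5, h6.trans (Nat.mod_eq_of_lt h9), h7⟩
  | mod e f ihe ihf =>
    intro s t hs hok ht
    obtain ⟨h8, _, s', k, h1, h2, h3, h4, h5, h6, h7⟩ := hbin .mod e f hs
      (fun hs ht => ihe hs hok.1 ht) (fun hs ht => ihf hs hok.2 ht) ht
    have h9 : e.val h % f.val h < 2 ^ M.w := (Nat.mod_le _ _).trans_lt h8
    exact ⟨h9, s', k, h1, h2, h3, h4, h5, h6.trans (Nat.mod_eq_of_lt h9), h7⟩
  | lt e f ihe ihf =>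
    intro s t hs hok ht
    obtain ⟨_, _, s', k, h1, h2, h3, h4, h5, h6, h7⟩ := hbin .lt e f hs
      (fun hs ht => ihe hs hok.1 ht) (fun hs ht => ihf hs hok.2 ht) ht
    have h9 : (if e.val h < f.val h then 1 else 0) < 2 ^ M.w := by
      have := hM.lit
      split_ifs <;> omega
    exact ⟨h9, s', k, h1, h2, h3, h4, h5, h6.trans (Nat.mod_eq_of_lt h9), h7⟩
  | eq e f ihe ihf =>
    intro s t hs hok ht
    obtain ⟨_, _, s', k, h1, h2, h3, h4, h5, h6, h7⟩ := hbin .eq e f hs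
      (fun hs ht => ihe hs hok.1 ht) (fun hs ht => ihf hs hok.2 ht) ht
    have h9 : (if e.val h = f.val h then 1 else 0) < 2 ^ M.w := by
      have := hM.lit
      split_ifs <;> omega
    exact ⟨h9, s', k, h1, h2, h3, h4, h5, h6.trans (Nat.mod_eq_of_lt h9), h7⟩
  | get a e ih =>
    intro s t hs hok ht
    obtain ⟨_, s1, k1, r1, ht1, ho1, hb1, hm1, hv1, hr1⟩ := ih hs hok.1 ht
    have hlt := addr_lt (a := a) hok.2
    have hal := hM.arr
    have hid := a.idx_lt
    have hlit := hM.lit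
    refine ⟨hs.arr_lt a _ hok.2, _, _, Run.seq r1 (Run.seq (Run.const _ _ _)
      (Run.seq (Run.op _ _ _ _ _) (Run.seq (Run.op _ _ _ _ _) (Run.load _ _ _)))), ?_, ?_, ?_, ?_,
      ?_, ?_⟩
    all_goals simp only [Cost.andThen, State.setReg, BinOp.eval, Function.update_self, ne_eq,
      not_false_eq_true, Function.update_of_ne, Nat.left_eq_add, one_ne_zero,
      show ¬ 0 = t + 1 by omega, hr1 0 (by omega), hs.len, hv1,
      Nat.mod_eq_of_lt (show a.idx < 2 ^ M.w by omega),
      Nat.mod_eq_of_lt (show a.idx * M.N < 2 ^ M.w by omega)]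
    all_goals try rw [add_comm (e.val h), Nat.mod_eq_of_lt (by omega)]
    · simp only [Exp.cost]; omega
    · omega
    · omega
    · exact hm1
    · rw [hm1, hs.arr _ _ hok.2]; rfl
    · intro y hy
      rw [Function.update_of_ne (by omega), Function.update_of_ne (by omega),
        Function.update_of_ne (by omega), Function.update_of_ne (by omega), hr1 y hy]

/-- Commands. -/
inductive Cmd
  | skip
  | asg (x : Reg) (e : Exp)
  | put (a : Arr) (i e : Exp)
  | seq (p q : Cmd)
  | ite (e : Exp) (p q : Cmd)
  | whl (e : Exp) (p : Cmd)
  | call (p : Prog) (src dst : Arr) (len : Reg)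

namespace Cmd

/-- The program of a command. -/
def code : Cmd → Prog
  | skip => .skip
  | asg x e => .seq (e.code 32) (.op .or x.idx 32 32)
  | put a i e => .seq (i.code 32) (.seq (.const 33 a.idx) (.seq (.op .mul 33 33 0)
      (.seq (.op .add 32 32 33) (.seq (e.code 33) (.store 32 33)))))
  | seq p q => .seq p.code q.code
  | ite e p q => .seq (e.code 32) (.ite 32 p.code q.code)
  | whl e p => .seq (e.code 32) (.loop 32 (.seq p.code (e.code 32)))
  | call p src dst len => .seq (.const 32 src.idx) (.seq (.op .mul 32 32 0)
      (.seq (.const 33 dst.idx) (.seq (.op .mul 33 33 0) (.call p 32 len.idx 33))))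

/-- The command, started in `h` at time `c`, halts in some contents and at some time that
satisfy `Q`, within the arrays. -/
def Halts (M : Mach) (p : Prog) (Q : Store → ℕ → Prop) (h : Store) (c : ℕ) : Prop :=
  ∀ s, Rel M h s → ∃ s' k h', Run M.w p s s' k ∧ Rel M h' s' ∧ k.own ≤ 17 * M.N ∧ k.sub ≤ M.b ∧
    Q h' (c + k.time)

/-- Verification condition of a command. -/
def vc (M : Mach) : Cmd → (Store → ℕ → Prop) → Store → ℕ → Prop
  | skip, Q, h, c => Q h (c + 1)
  | asg x e, Q, h, c => e.ok M h ∧ Q (h.setReg x (e.val h)) (c + (e.cost + 1))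
  | put a i e, Q, h, c => i.ok M h ∧ e.ok M h ∧ i.val h < M.N ∧
      Q (h.setArr a (Function.update (h.arr a) (i.val h) (e.val h))) (c + (i.cost + e.cost + 4))
  | seq p q, Q, h, c => vc M p (vc M q Q) h c
  | ite e p q, Q, h, c => e.ok M h ∧ (e.val h ≠ 0 → vc M p Q h (c + (e.cost + 1))) ∧
      (e.val h = 0 → vc M q Q h (c + (e.cost + 1)))
  | whl e p, Q, h, c => Halts M (whl e p).code Q h c
  | call p src dst len, Q, h, c => ∃ out t m,
      Returns M.w p ((List.range (h.reg len)).map (h.arr src)) out t m ∧ h.reg len ≤ M.N ∧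
      out.length ≤ M.N ∧ (∀ v ∈ out, v < 2 ^ M.w) ∧ m ≤ M.b ∧
      Q ((h.setArr dst fun i => if i < out.length then out.getD i 0 else h.arr dst i).setReg len
        out.length) (c + (t + 5))

end Cmd

theorem Rel.setReg {M : Mach} {h : Store} {s : State} (hs : Rel M h s) (x : Reg) {v : ℕ}
    (hv : v < 2 ^ M.w) : Rel M (h.setReg x v) (s.setReg x.idx v) where
  len := by
    simp only [State.setReg]
    rw [Function.update_of_ne x.idx_pos.ne, hs.len]
  reg y := by
    simp only [State.setReg, Store.setReg_reg]
    split_ifs with hy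
    · rw [hy, Function.update_self]
    · rw [Function.update_of_ne (fun h => hy (Reg.idx_inj h)), hs.reg]
  arr := hs.arr
  reg_lt y := by
    simp only [Store.setReg_reg]
    split_ifs
    · exact hv
    · exact hs.reg_lt y
  arr_lt := hs.arr_lt

/-- Division by the common length recovers array and index from an address, so the arrays do not
overlap. -/
theorem addr_inj {N : ℕ} {a b : Arr} {i j : ℕ} (hi : i < N) (hj : j < N)
    (h : a.idx * N + i = b.idx * N + j) : a = b ∧ i = j := by
  have h1 : (i + N * a.idx) / N = a.idx := by
    rw [Nat.add_mul_div_left _ _ (by omega), Nat.div_eq_of_lt hi, zero_add]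
  have h2 : (j + N * b.idx) / N = b.idx := by
    rw [Nat.add_mul_div_left _ _ (by omega), Nat.div_eq_of_lt hj, zero_add]
  have h3 : a.idx = b.idx := by
    rw [← h1, ← h2, mul_comm N, mul_comm N, add_comm i, add_comm j, h]
  exact ⟨Arr.idx_inj h3, by rw [h3] at h; omega⟩

theorem Rel.setMem {M : Mach} {h : Store} {s : State} (hs : Rel M h s) (a : Arr) {i v : ℕ}
    (hi : i < M.N) (hv : v < 2 ^ M.w) :
    Rel M (h.setArr a (Function.update (h.arr a) i v)) (s.setMem (a.idx * M.N + i) v) where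
  len := hs.len
  reg := hs.reg
  arr b j hj := by
    simp only [State.setMem, Store.setArr_arr]
    by_cases hb : b = a
    · subst hb
      by_cases hij : j = i
      · subst hij; simp
      · rw [if_pos rfl, Function.update_of_ne (by omega), Function.update_of_ne hij, hs.arr _ _ hj]
    · rw [if_neg hb, Function.update_of_ne, hs.arr _ _ hj]
      exact fun he => hb (addr_inj hj hi he).1
  reg_lt := hs.reg_lt
  arr_lt b j hj := by
    simp only [Store.setArr_arr]
    split_ifs with hb
    · by_cases hij : j = i
      · subst hij; simpa using hv
      · rw [Function.update_of_ne hij]; exact hs.arr_lt _ _ hj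
    · exact hs.arr_lt _ _ hj

theorem Rel.setBlock {M : Mach} {h : Store} {s : State} (hs : Rel M h s) (a : Arr) {l : List ℕ}
    (hl : l.length ≤ M.N) (hv : ∀ v ∈ l, v < 2 ^ M.w) :
    Rel M (h.setArr a fun i => if i < l.length then l.getD i 0 else h.arr a i)
      (s.setBlock (a.idx * M.N) l) where
  len := hs.len
  reg := hs.reg
  arr b j hj := by
    simp only [State.setBlock, Store.setArr_arr]
    by_cases hb : b = a
    · subst hb
      simp only [le_add_iff_nonneg_right, zero_le, add_lt_add_iff_left, true_and,
        add_tsub_cancel_left, if_true]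
      rw [hs.arr _ _ hj]
    · rw [if_neg hb, if_neg, hs.arr _ _ hj]
      rintro ⟨h1, h2⟩
      have := (addr_inj (a := b) (b := a) (i := j) (j := b.idx * M.N + j - a.idx * M.N) hj
        (by omega) (by omega)).1
      exact hb this
  reg_lt := hs.reg_lt
  arr_lt b j hj := by
    simp only [Store.setArr_arr]
    split_ifs with hb
    · dsimp only
      split_ifs with hj'
      · rw [List.getD_eq_getElem _ _ hj']
        exact hv _ (List.getElem_mem hj')
      · exact hs.arr_lt _ _ hj
    · exact hs.arr_lt _ _ hj

namespace Cmd

theorem Halts.imp {M : Mach} {p : Prog} {Q Q' : Store → ℕ → Prop} {h : Store} {c : ℕ}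
    (hp : Halts M p Q h c) (hQ : ∀ h c, Q h c → Q' h c) : Halts M p Q' h c := by
  intro s hs
  obtain ⟨s', k, h', h1, h2, h3, h4, h5⟩ := hp s hs
  exact ⟨s', k, h', h1, h2, h3, h4, hQ _ _ h5⟩

theorem halts_seq {M : Mach} {p q : Prog} {Q : Store → ℕ → Prop} {h : Store} {c : ℕ}
    (hp : Halts M p (Halts M q Q) h c) : Halts M (.seq p q) Q h c := by
  intro s hs
  obtain ⟨s', k, h', r, h2, h3, h4, h5⟩ := hp s hs
  obtain ⟨s'', k', h'', r', h2', h3', h4', h5'⟩ := h5 s' h2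
  refine ⟨s'', _, h'', Run.seq r r', h2', ?_, ?_, ?_⟩
  · simp only [Cost.andThen]; omega
  · simp only [Cost.andThen]; omega
  · simp only [Cost.andThen]; rw [← add_assoc]; exact h5'

/-- The shared opening of assignments, branches and loops: an expression is evaluated into register
`32`, and the remaining code starts from there. -/
theorem halts_test {M : Mach} (hM : M.Valid) {q : Prog} {Q : Store → ℕ → Prop} {h : Store} {c : ℕ}
    (e : Exp) (he : e.ok M h)
    (hq : ∀ s, Rel M h s → s.reg 32 = e.val h → ∃ s' k h', Run M.w q s s' k ∧ Rel M h' s' ∧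
      k.own ≤ 17 * M.N ∧ k.sub ≤ M.b ∧ Q h' (c + e.cost + k.time)) :
    Halts M (.seq (e.code 32) q) Q h c := by
  intro s hs
  obtain ⟨_, s1, k1, r1, ht1, ho1, hb1, hm1, hv1, hr1⟩ := Exp.run hM e hs he le_rfl
  obtain ⟨s2, k2, h2, r2, hs2, ho2, hb2, hQ⟩ := hq s1 (hs.of_eq hm1 hr1) hv1
  refine ⟨s2, _, h2, Run.seq r1 r2, hs2, ?_, ?_, ?_⟩
  · simp only [Cost.andThen]; omega
  · simp only [Cost.andThen]; omega
  · simp only [Cost.andThen]; rw [ht1, ← add_assoc]; exact hQ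

/-- A loop with an invariant and a decreasing measure. -/
theorem vc_whl_of_halts {M : Mach} (hM : M.Valid) {e : Exp} {p : Cmd} {Q : Store → ℕ → Prop}
    (I : Store → ℕ → Prop) (μ : Store → ℕ)
    (hstep : ∀ h c, I h c → e.ok M h ∧ (e.val h = 0 → Q h (c + (e.cost + 1))) ∧
      (e.val h ≠ 0 → Halts M p.code (fun h' c' => I h' c' ∧ μ h' < μ h) h (c + (e.cost + 1))))
    {h : Store} {c : ℕ} (hI : I h c) : vc M (whl e p) Q h c := by
  -- The compiled loop evaluates its test once before entry and again at the end of each round, so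
  -- the induction on the measure assumes that register `32` already holds the value of the test.
  have key : ∀ (m : ℕ) (h : Store) (c : ℕ), μ h = m → I h c → ∀ s, Rel M h s →
      s.reg 32 = e.val h → ∃ s' k h', Run M.w (.loop 32 (.seq p.code (e.code 32))) s s' k ∧
        Rel M h' s' ∧ k.own ≤ 17 * M.N ∧ k.sub ≤ M.b ∧ Q h' (c + e.cost + k.time) := by
    intro m
    induction m using Nat.strong_induction_on with
    | _ m ih =>
      intro h c hm hI s hs hv
      obtain ⟨_, h0, h1⟩ := hstep h c hI
      by_cases hz : e.val h = 0
      · exact ⟨s, _, h, Run.loop_exit (hv.trans hz), hs, Nat.zero_le _, Nat.zero_le _, h0 hz⟩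
      · obtain ⟨s1, k1, h1', r1, hs1, ho1, hb1, hI1, hμ⟩ := h1 hz s hs
        obtain ⟨he1, -, -⟩ := hstep _ _ hI1
        obtain ⟨_, s2, k2, r2, ht2, ho2, hb2, hm2, hv2, hr2⟩ := Exp.run hM e hs1 he1 le_rfl
        obtain ⟨s3, k3, h3, r3, hs3, ho3, hb3, hQ⟩ := ih _ (hm ▸ hμ) h1' _ rfl hI1 s2
          (hs1.of_eq hm2 hr2) hv2
        refine ⟨s3, _, h3, Run.loop_step (hv ▸ hz) (Run.seq r1 r2) r3, hs3, ?_, ?_, ?_⟩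
        · simp only [Cost.andThen]; omega
        · simp only [Cost.andThen]; omega
        · simp only [Cost.andThen]
          convert hQ using 1
          omega
  exact halts_test hM e (hstep h c hI).1 fun s hs hv => key _ h c rfl hI s hs hv

/-- Soundness of the verification conditions. For loops nothing has to be shown, since there `vc` is
defined as `Halts` of the compiled code; `vc_whl` supplies that from an invariant. -/
theorem vc.halts {M : Mach} (hM : M.Valid) (p : Cmd) : ∀ {Q : Store → ℕ → Prop} {h : Store}
    {c : ℕ}, vc M p Q h c → Halts M p.code Q h c := by
  induction p with
  | skip => exact fun hv s hs => ⟨s, _, _, Run.skip s, hs, Nat.zero_le _, Nat.zero_le _, hv⟩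
  | asg x e =>
    intro Q h c ⟨he, hQ⟩
    refine halts_test hM e he fun s hs hv => ?_
    have hlt := (Exp.run hM e hs he le_rfl).1
    refine ⟨_, _, _, Run.op _ _ _ _ _, ?_, Nat.zero_le _, Nat.zero_le _, hQ⟩
    rw [hv]
    simp only [BinOp.eval, Nat.or_self]
    rw [Nat.mod_eq_of_lt hlt]
    exact hs.setReg x hlt
  | put a i e =>
    intro Q h c ⟨hi, he, hlt, hQ⟩
    refine halts_test hM i hi fun s hs hv => ?_
    have ha := addr_lt (a := a) hlt
    have hal := hM.arr
    have hid := a.idx_lt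
    have hlit := hM.lit
    set s1 := ((s.setReg 33 a.idx).setReg 33 (a.idx * M.N)).setReg 32 (a.idx * M.N + i.val h)
      with hs1
    have hr : Rel M h s1 := by
      refine hs.of_eq rfl fun y hy => ?_
      simp only [hs1, State.setReg]
      rw [Function.update_of_ne (by omega), Function.update_of_ne (by omega),
        Function.update_of_ne (by omega)]
    obtain ⟨hlt', s2, k2, r2, ht2, ho2, hb2, hm2, hv2, hr2⟩ := Exp.run hM e hr he
      (show 32 ≤ 33 by norm_num)
    have e1 : a.idx % 2 ^ M.w = a.idx := Nat.mod_eq_of_lt (by omega)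
    have e2 : a.idx * M.N % 2 ^ M.w = a.idx * M.N := Nat.mod_eq_of_lt (by omega)
    have e3 : (i.val h + a.idx * M.N) % 2 ^ M.w = a.idx * M.N + i.val h := by
      rw [Nat.mod_eq_of_lt (by omega), add_comm]
    have ra := Run.const (w := M.w) s 33 a.idx
    rw [e1] at ra
    have rb := Run.op (w := M.w) (s.setReg 33 a.idx) .mul 33 33 0
    simp only [BinOp.eval, State.setReg, Function.update_self, ne_eq, OfNat.zero_ne_ofNat,
      not_false_eq_true, Function.update_of_ne, hs.len, e2] at rb
    have rc := Run.op (w := M.w) ((s.setReg 33 a.idx).setReg 33 (a.idx * M.N)) .add 32 32 33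
    simp only [BinOp.eval, State.setReg, Function.update_self, ne_eq, Nat.reduceEqDiff,
      not_false_eq_true, Function.update_of_ne, hv, e3] at rc
    have haddr : s2.reg 32 = a.idx * M.N + i.val h := by
      rw [hr2 32 (by norm_num)]; simp [hs1, State.setReg]
    refine ⟨_, _, h.setArr a (Function.update (h.arr a) (i.val h) (e.val h)),
      Run.seq ra (Run.seq rb (Run.seq rc (Run.seq r2 (Run.store _ _ _)))), ?_, ?_, ?_, ?_⟩
    · rw [hv2, haddr]
      exact (hr.of_eq hm2 fun y hy => hr2 y (by omega)).setMem a hlt hlt'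
    · simp only [Cost.andThen]
      omega
    · simp only [Cost.andThen]
      omega
    · simp only [Cost.andThen]
      convert hQ using 1
      omega
  | seq p q ihp ihq =>
    intro Q h c hv
    exact halts_seq ((ihp hv).imp fun h c hq => ihq hq)
  | ite e p q ihp ihq =>
    intro Q h c ⟨he, h1, h2⟩
    refine halts_test hM e he fun s hs hv => ?_
    by_cases hz : e.val h = 0
    · obtain ⟨s', k, h', r, hs', ho, hb, hQ⟩ := ihq (h2 hz) s hs
      refine ⟨s', _, h', Run.ite_false (hv.trans hz) r, hs', ?_, ?_, ?_⟩
      · simpa [Cost.andThen] using ho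
      · simpa [Cost.andThen] using hb
      · simp only [Cost.andThen]; convert hQ using 1; omega
    · obtain ⟨s', k, h', r, hs', ho, hb, hQ⟩ := ihp (h1 hz) s hs
      refine ⟨s', _, h', Run.ite_true (hv ▸ hz) r, hs', ?_, ?_, ?_⟩
      · simpa [Cost.andThen] using ho
      · simpa [Cost.andThen] using hb
      · simp only [Cost.andThen]; convert hQ using 1; omega
  | whl e p _ => exact fun hv => hv
  | call p src dst len =>
    intro Q h c ⟨out, t, m, ⟨sp, kp, rp, ho, ht, hm⟩, hlen, hout, hlt, hmb, hQ⟩ s hs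
    have hal := hM.arr
    have hlit := hM.lit
    have his := src.idx_lt
    have hid := dst.idx_lt
    have hs17 : src.idx * M.N + M.N ≤ 17 * M.N := by
      rw [← Nat.succ_mul]; exact Nat.mul_le_mul_right _ his
    have hd17 : dst.idx * M.N + M.N ≤ 17 * M.N := by
      rw [← Nat.succ_mul]; exact Nat.mul_le_mul_right _ hid
    have e1 : src.idx % 2 ^ M.w = src.idx := Nat.mod_eq_of_lt (by omega)
    have e2 : dst.idx % 2 ^ M.w = dst.idx := Nat.mod_eq_of_lt (by omega)
    have hN : h.reg len ≤ M.N := hlen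
    have hlen0 := hs.reg len
    have hl32 := len.idx_lt
    have e3 : src.idx * M.N % 2 ^ M.w = src.idx * M.N := Nat.mod_eq_of_lt (by omega)
    have e4 : dst.idx * M.N % 2 ^ M.w = dst.idx * M.N := Nat.mod_eq_of_lt (by omega)
    set s1 := (((s.setReg 32 src.idx).setReg 32 (src.idx * M.N)).setReg 33 dst.idx).setReg 33
      (dst.idx * M.N) with hs1
    have hr : Rel M h s1 := by
      refine hs.of_eq rfl fun y hy => ?_
      simp only [hs1, State.setReg]
      rw [Function.update_of_ne (by omega), Function.update_of_ne (by omega),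
        Function.update_of_ne (by omega), Function.update_of_ne (by omega)]
    have hr32 : s1.reg 32 = src.idx * M.N := by simp [hs1, State.setReg]
    have hr33 : s1.reg 33 = dst.idx * M.N := by simp [hs1, State.setReg]
    have ra := Run.const (w := M.w) s 32 src.idx
    rw [e1] at ra
    have rb := Run.op (w := M.w) (s.setReg 32 src.idx) .mul 32 32 0
    simp only [BinOp.eval, State.setReg, Function.update_self, ne_eq, OfNat.zero_ne_ofNat,
      not_false_eq_true, Function.update_of_ne, hs.len, e3] at rb
    have rc := Run.const (w := M.w) ((s.setReg 32 src.idx).setReg 32 (src.idx * M.N)) 33 dst.idx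
    rw [e2] at rc
    have rd := Run.op (w := M.w)
      (((s.setReg 32 src.idx).setReg 32 (src.idx * M.N)).setReg 33 dst.idx) .mul 33 33 0
    simp only [BinOp.eval, State.setReg, Function.update_self, ne_eq, OfNat.zero_ne_ofNat,
      not_false_eq_true, Function.update_of_ne, hs.len, e4] at rd
    have hblock : s1.block (s1.reg 32) (s1.reg len.idx)
        = (List.range (h.reg len)).map (h.arr src) := by
      rw [hr.reg, hr32, State.block]
      apply List.map_congr_left
      intro i hi
      exact hr.arr src i (by have := List.mem_range.1 hi; omega)
    have rcall := Run.call (w := M.w) (p := p) (src := 32) (len := len.idx) (dst := 33) (s := s1)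
      (inp := (List.range (h.reg len)).map (h.arr src)) hblock.symm rp ho
      (by rw [hr32]; simp; omega) (by rw [hr33]; omega) (by omega)
    refine ⟨_, _, _, Run.seq ra (Run.seq rb (Run.seq rc (Run.seq rd rcall))),
      ((hr33 ▸ hr.setBlock dst hout hlt).setReg len (by omega)), ?_, ?_, ?_⟩
    · simp [Cost.andThen, hr32, hr33]
      omega
    · simp only [Cost.andThen]
      omega
    · simp only [Cost.andThen]
      convert hQ using 1
      omega

theorem vc_whl {M : Mach} (hM : M.Valid) {e : Exp} {p : Cmd} {Q : Store → ℕ → Prop}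
    (I : Store → ℕ → Prop) (μ : Store → ℕ)
    (hstep : ∀ h c, I h c → e.ok M h ∧ (e.val h = 0 → Q h (c + (e.cost + 1))) ∧
      (e.val h ≠ 0 → vc M p (fun h' c' => I h' c' ∧ μ h' < μ h) h (c + (e.cost + 1))))
    {h : Store} {c : ℕ} (hI : I h c) : vc M (whl e p) Q h c :=
  vc_whl_of_halts hM I μ (fun h c hI => ⟨(hstep h c hI).1, (hstep h c hI).2.1,
    fun hz => ((hstep h c hI).2.2 hz).halts hM⟩) hI

theorem vc.imp {M : Mach} (p : Cmd) : ∀ {Q Q' : Store → ℕ → Prop} {h : Store} {c : ℕ},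
    vc M p Q h c → (∀ h c, Q h c → Q' h c) → vc M p Q' h c := by
  induction p with
  | skip => exact fun hv hQ => hQ _ _ hv
  | asg x e => exact fun hv hQ => ⟨hv.1, hQ _ _ hv.2⟩
  | put a i e => exact fun hv hQ => ⟨hv.1, hv.2.1, hv.2.2.1, hQ _ _ hv.2.2.2⟩
  | seq p q ihp ihq => exact fun hv hQ => ihp hv fun h c hq => ihq hq hQ
  | ite e p q ihp ihq =>
    exact fun hv hQ => ⟨hv.1, fun hz => ihp (hv.2.1 hz) hQ, fun hz => ihq (hv.2.2 hz) hQ⟩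
  | whl e p _ => exact fun hv hQ => Halts.imp hv hQ
  | call p src dst len =>
    intro Q Q' h c ⟨out, t, m, h1, h2, h3, h4, h5, h6⟩ hQ
    exact ⟨out, t, m, h1, h2, h3, h4, h5, hQ _ _ h6⟩

/-- A counting loop. -/
def forr (x : Reg) (lo hi : Exp) (p : Cmd) : Cmd :=
  seq (asg x lo) (whl (.lt (.v x) hi) (seq p (asg x (.add (.v x) (.c 1)))))

/-- `I i` holds when the counter is about to be tested with value `i`. The bound `hi` is evaluated
anew each time and must keep the value `b`. The `hi.cost + 3` steps pay for a test, the `4` steps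
for the increment. -/
theorem vc_forr {M : Mach} (hM : M.Valid) {x : Reg} {lo hi : Exp} {p : Cmd}
    {Q : Store → ℕ → Prop} (I : ℕ → Store → ℕ → Prop) (a b : ℕ) {h : Store} {c : ℕ}
    (hlo : lo.ok M h) (ha : lo.val h = a) (hab : a ≤ b) (hb : b < 2 ^ M.w)
    (h0 : I a (h.setReg x a) (c + (lo.cost + 1)))
    (hhi : ∀ i h c, i ≤ b → I i h c → hi.ok M h ∧ hi.val h = b)
    (hstep : ∀ i h c, a ≤ i → i < b → I i h c → h.reg x = i →
      vc M p (fun h' c' => h'.reg x = i ∧ I (i + 1) (h'.setReg x (i + 1)) (c' + 4)) h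
        (c + (hi.cost + 3)))
    (hQ : ∀ h c, I b h c → h.reg x = b → Q h (c + (hi.cost + 3))) :
    vc M (forr x lo hi p) Q h c := by
  refine ⟨hlo, ?_⟩
  refine vc_whl hM (fun h c => ∃ i, a ≤ i ∧ i ≤ b ∧ h.reg x = i ∧ I i h c) (fun h => b - h.reg x)
    ?_ ⟨a, le_rfl, hab, by simp [ha], by rw [ha]; exact h0⟩
  rintro h c ⟨i, hai, hib, hx, hI⟩
  obtain ⟨h1, h2⟩ := hhi i h c hib hI
  refine ⟨⟨trivial, h1⟩, ?_, ?_⟩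
  · intro hz
    have hib' : i = b := by
      simp only [Exp.val, hx, h2] at hz
      split_ifs at hz
      omega
    subst hib'
    have := hQ h c hI hx
    simp only [Exp.cost]
    convert this using 1
    omega
  · intro hz
    have hib' : i < b := by
      simp only [Exp.val, hx, h2] at hz
      by_contra hcon
      simp [hcon] at hz
    have := hstep i h c hai hib' hI hx
    show vc M p _ _ _
    simp only [Exp.cost]
    rw [show c + (1 + hi.cost + 1 + 1) = c + (hi.cost + 3) by omega]
    refine vc.imp _ this ?_
    rintro h' c' ⟨hx', hI'⟩
    refine ⟨⟨trivial, ?_, ?_⟩, ⟨i + 1, by omega, by omega, ?_, ?_⟩, ?_⟩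
    · show 1 < 2 ^ M.w
      have := hM.lit
      omega
    · simp only [Exp.val, hx']; omega
    · simp [Exp.val, hx']
    · simp only [Exp.val, hx', Exp.cost]; exact hI'
    · simp only [Exp.val, Store.setReg_reg, if_true, hx', hx]; omega

end Cmd

end WordRAM

/-! ### Input data -/

namespace Sandpile

/-- An input of the prediction problem. -/
structure Inst (V : Type u) where
  n : ℕ
  npos : 0 < n
  e : Fin n ≃ V
  es : List (V × V)
  G : SimpleGraph V
  σ : V → ℕ
  P : Set V
  listing : IsEdgeListing G es

namespace Inst

variable {V : Type u} (I : Inst V)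

/-- The vertex with number `i`. -/
def vt (i : ℕ) : V := I.e ⟨i % I.n, Nat.mod_lt _ I.npos⟩

/-- The number of a vertex. -/
def ix (v : V) : ℕ := (I.e.symm v : Fin I.n)

theorem ix_lt (v : V) : I.ix v < I.n := (I.e.symm v).2

@[simp] theorem vt_ix (v : V) : I.vt (I.ix v) = v := by
  unfold vt ix
  simp [Nat.mod_eq_of_lt (I.e.symm v).2]

theorem ix_vt {i : ℕ} (hi : i < I.n) : I.ix (I.vt i) = i := by
  unfold vt ix
  simp [Nat.mod_eq_of_lt hi]

theorem vt_fin (i : Fin I.n) : I.vt i = I.e i := by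
  unfold vt
  congr 1
  ext
  exact Nat.mod_eq_of_lt i.2

theorem vt_inj {i j : ℕ} (hi : i < I.n) (hj : j < I.n) (h : I.vt i = I.vt j) : i = j := by
  rw [← I.ix_vt hi, h, I.ix_vt hj]

/-- The number of darts (directed edges). -/
def D : ℕ := 2 * I.es.length

/-- The input list. -/
noncomputable def enc : List ℕ := encode I.e I.es I.σ I.P

/-- The input array. -/
noncomputable def inp (i : ℕ) : ℕ := I.enc.getD i 0

/-- The endpoints of the edges, one after the other. -/
def ends : List ℕ := I.es.flatMap fun d => [I.ix d.1, I.ix d.2]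

/-- The source of dart `d`. -/
def src (d : ℕ) : ℕ := I.ends.getD d 0

/-- The target of dart `d`. -/
def dst (d : ℕ) : ℕ := I.ends.getD (d + 1 - 2 * (d % 2)) 0

theorem flatMap_pair_getD {α β : Type*} (f g : α → β) (l : List α) (z : β) (i : ℕ)
    (hi : i < l.length) :
    (l.flatMap fun a => [f a, g a]).getD (2 * i) z = f l[i] ∧
    (l.flatMap fun a => [f a, g a]).getD (2 * i + 1) z = g l[i] := by
  induction l generalizing i with
  | nil => simp at hi
  | cons a l ih =>
    cases i with
    | zero => simp
    | succ i =>
      have := ih i (by simpa using hi)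
      simpa [mul_add] using this

theorem flatMap_pair_length {α β : Type*} (f g : α → β) (l : List α) :
    (l.flatMap fun a => [f a, g a]).length = 2 * l.length := by
  induction l with
  | nil => rfl
  | cons a l ih => simp only [List.flatMap_cons, List.length_append, ih, List.length_cons]; simp; ring

theorem ends_length : I.ends.length = I.D := flatMap_pair_length _ _ _

/-- Only the position of the indicator block matters here, so it is quoted through `inp` itself. -/
theorem enc_eq : I.enc = [I.n, I.es.length] ++ (List.ofFn (fun i => I.σ (I.e i))) ++
    (List.ofFn (fun i => I.inp (2 + I.n + i) : Fin I.n → ℕ)) ++ I.ends := by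
  unfold inp enc encode ends ix
  congr 2
  congr 1
  funext i
  rw [List.append_assoc, List.append_assoc, List.getD_append_right _ _ _ _ (by simp; omega),
    List.getD_append_right _ _ _ _ (by simp; omega),
    List.getD_append _ _ _ _ (by simp; have := i.2; omega)]
  simp [show 2 + I.n + (i : ℕ) - 2 - I.n = i by omega]

theorem enc_length : I.enc.length = 2 + 2 * I.n + I.D := by
  rw [enc_eq]
  simp [ends_length]
  ring

theorem inp_zero : I.inp 0 = I.n := rfl

theorem inp_one : I.inp 1 = I.es.length := rfl

theorem inp_chips {i : ℕ} (hi : i < I.n) : I.inp (2 + i) = I.σ (I.vt i) := by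
  rw [show i = ((⟨i, hi⟩ : Fin I.n) : ℕ) from rfl, vt_fin]
  rw [inp, enc_eq, List.append_assoc, List.append_assoc,
    List.getD_append_right _ _ _ _ (by simp), List.getD_append _ _ _ _ (by simp; omega)]
  simp [hi]

open Classical in
theorem inp_ind {i : ℕ} (hi : i < I.n) :
    I.inp (2 + I.n + i) = if I.vt i ∈ I.P then 1 else 0 := by
  rw [show i = ((⟨i, hi⟩ : Fin I.n) : ℕ) from rfl, vt_fin]
  unfold inp enc encode
  rw [List.append_assoc, List.append_assoc, List.getD_append_right _ _ _ _ (by simp; omega),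
    List.getD_append_right _ _ _ _ (by simp; omega), List.getD_append _ _ _ _ (by simp; omega)]
  simp [show 2 + I.n + i - 2 - I.n = i by omega, hi]

theorem inp_src (d : ℕ) : I.inp (2 + I.n + I.n + d) = I.src d := by
  rw [inp, enc_eq, List.getD_append_right _ _ _ _ (by simp; omega), src]
  congr 1
  simp
  omega

/-- Edge `i` of the list yields the mutually reverse darts `2 * i` and `2 * i + 1`. -/
theorem dart_cases {d : ℕ} (hd : d < I.D) : ∃ (i : ℕ) (hi : i < I.es.length),
    (d = 2 * i ∧ I.src d = I.ix I.es[i].1 ∧ I.dst d = I.ix I.es[i].2) ∨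
    (d = 2 * i + 1 ∧ I.src d = I.ix I.es[i].2 ∧ I.dst d = I.ix I.es[i].1) := by
  have hi : d / 2 < I.es.length := by unfold D at hd; omega
  refine ⟨d / 2, hi, ?_⟩
  obtain ⟨h1, h2⟩ := flatMap_pair_getD (fun d : V × V => I.ix d.1) (fun d => I.ix d.2) I.es 0 _ hi
  rcases Nat.mod_two_eq_zero_or_one d with h | h
  · refine Or.inl ⟨by omega, ?_, ?_⟩
    · unfold src ends
      rw [← h1]; congr 1; omega
    · unfold dst ends
      rw [← h2]; congr 1; omega
  · refine Or.inr ⟨by omega, ?_, ?_⟩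
    · unfold src ends
      rw [← h2]; congr 1; omega
    · unfold dst ends
      rw [← h1]; congr 1; omega

theorem src_lt {d : ℕ} (hd : d < I.D) : I.src d < I.n := by
  obtain ⟨i, hi, ⟨_, h, _⟩ | ⟨_, h, _⟩⟩ := I.dart_cases hd <;> rw [h] <;> exact I.ix_lt _

theorem dst_lt {d : ℕ} (hd : d < I.D) : I.dst d < I.n := by
  obtain ⟨i, hi, ⟨_, _, h⟩ | ⟨_, _, h⟩⟩ := I.dart_cases hd <;> rw [h] <;> exact I.ix_lt _

theorem dart_adj {d : ℕ} (hd : d < I.D) : I.G.Adj (I.vt (I.src d)) (I.vt (I.dst d)) := by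
  obtain ⟨i, hi, ⟨_, h1, h2⟩ | ⟨_, h1, h2⟩⟩ := I.dart_cases hd
  all_goals
    rw [h1, h2, vt_ix, vt_ix]
    have h3 : s(I.es[i].1, I.es[i].2) ∈ I.G.edgeSet := by
      rw [← I.listing.2]
      exact List.mem_map.2 ⟨I.es[i], List.getElem_mem hi, rfl⟩
    first | exact h3 | exact SimpleGraph.Adj.symm h3

theorem exists_dart {v w : V} (h : I.G.Adj v w) :
    ∃ d < I.D, I.src d = I.ix v ∧ I.dst d = I.ix w := by
  have h3 : s(v, w) ∈ I.es.map fun d => s(d.1, d.2) := (I.listing.2 _).2 h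
  obtain ⟨x, hx, he⟩ := List.mem_map.1 h3
  obtain ⟨i, hi, rfl⟩ := List.getElem_of_mem hx
  have hD0 : 2 * i < I.D := by unfold D; omega
  have hD1 : 2 * i + 1 < I.D := by unfold D; omega
  rcases Sym2.eq_iff.1 he with ⟨h1, h2⟩ | ⟨h1, h2⟩
  · obtain ⟨j, hj, ⟨hd, h4, h5⟩ | ⟨hd, h4, h5⟩⟩ := I.dart_cases hD0
    · obtain rfl : i = j := by omega
      exact ⟨_, hD0, by rw [h4, h1], by rw [h5, h2]⟩
    · omega
  · obtain ⟨j, hj, ⟨hd, h4, h5⟩ | ⟨hd, h4, h5⟩⟩ := I.dart_cases hD1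
    · omega
    · obtain rfl : i = j := by omega
      exact ⟨_, hD1, by rw [h4, h2], by rw [h5, h1]⟩

theorem ix_inj {v w : V} (h : I.ix v = I.ix w) : v = w := by
  rw [← I.vt_ix v, h, vt_ix]

theorem src_ne_dst {d : ℕ} (hd : d < I.D) : I.src d ≠ I.dst d := fun h =>
  (I.dart_adj hd).ne (by rw [h])

/-- Both darts belong to the same edge, which is listed only once; as there are no loops, the ends
also determine the orientation. -/
theorem dart_unique {d d' : ℕ} (hd : d < I.D) (hd' : d' < I.D) (h1 : I.src d = I.src d')
    (h2 : I.dst d = I.dst d') : d = d' := by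
  have hnd := I.src_ne_dst hd
  obtain ⟨i, hi, hc⟩ := I.dart_cases hd
  obtain ⟨j, hj, hc'⟩ := I.dart_cases hd'
  have hs : s(I.es[i].1, I.es[i].2) = s(I.es[j].1, I.es[j].2) := by
    rw [Sym2.eq_iff]
    rcases hc with ⟨_, h3, h4⟩ | ⟨_, h3, h4⟩ <;> rcases hc' with ⟨_, h5, h6⟩ | ⟨_, h5, h6⟩ <;>
      rw [h1, h5] at h3 <;> rw [h2, h6] at h4 <;>
      simp [I.ix_inj h3, I.ix_inj h4]
  have hij : i = j := by
    have h := List.nodup_iff_injective_get.1 I.listing.1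
    have := @h ⟨i, by simpa using hi⟩ ⟨j, by simpa using hj⟩ (by simpa using hs)
    simpa using this
  subst hij
  rcases hc with ⟨h0, h3, h4⟩ | ⟨h0, h3, h4⟩ <;> rcases hc' with ⟨h0', h5, h6⟩ | ⟨h0', h5, h6⟩
  · omega
  · rw [h3, h4] at hnd
    rw [h1, h5] at h3
    exact absurd h3.symm hnd
  · rw [h3, h4] at hnd
    rw [h1, h5] at h3
    exact absurd h3 hnd.symm
  · omega

/-- The darts below `m` with source `i`, the latest first. -/
def darts (i m : ℕ) : List ℕ := ((List.range m).filter fun d => I.src d = i).reverse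

/-- One more than the last dart below `m` with source `i`, or `0`. -/
def lastDart (i : ℕ) : ℕ → ℕ
  | 0 => 0
  | m + 1 => if I.src m = i then m + 1 else lastDart i m

theorem darts_succ (i m : ℕ) :
    I.darts i (m + 1) = if I.src m = i then m :: I.darts i m else I.darts i m := by
  unfold darts
  rw [List.range_succ, List.filter_append]
  split_ifs with h <;> simp [h]

/-- This is the linked list of the darts out of `i`, as later stored in `head` and `nxt`. Entries
are shifted by one so that `0` can mark its end. -/
theorem lastDart_spec (i m : ℕ) : (I.lastDart i m = 0 ∧ I.darts i m = []) ∨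
    ∃ d < m, I.src d = i ∧ I.lastDart i m = d + 1 ∧ I.darts i m = d :: I.darts i d := by
  induction m with
  | zero => left; exact ⟨rfl, rfl⟩
  | succ m ih =>
    rw [darts_succ, lastDart]
    split_ifs with h
    · exact Or.inr ⟨m, by omega, h, rfl, rfl⟩
    · rcases ih with ih | ⟨d, h1, h2⟩
      · exact Or.inl ih
      · exact Or.inr ⟨d, by omega, h2⟩

theorem mem_darts {i m d : ℕ} : d ∈ I.darts i m ↔ d < m ∧ I.src d = i := by
  simp [darts]

theorem darts_nodup (i m : ℕ) : (I.darts i m).Nodup :=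
  List.nodup_reverse.2 (List.nodup_range.filter _)

theorem sum_darts_length_le (s : Finset ℕ) : ∑ i ∈ s, (I.darts i I.D).length ≤ I.D := by
  have : ∀ i, (I.darts i I.D).length = ((Finset.range I.D).filter fun d => I.src d = i).card := by
    intro i
    rw [← List.toFinset_card_of_nodup (I.darts_nodup i I.D)]
    congr 1
    ext d
    simp [mem_darts]
  rw [Finset.sum_congr rfl fun i _ => this i]
  rw [← Finset.card_biUnion]
  · calc _ ≤ (Finset.range I.D).card := Finset.card_le_card (by
        intro d
        simp only [Finset.mem_biUnion, Finset.mem_filter]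
        rintro ⟨_, _, h, _⟩
        exact h)
      _ = I.D := Finset.card_range _
  · intro i _ j _ hij
    rw [Function.onFun, Finset.disjoint_left]
    intro d
    simp only [Finset.mem_filter]
    rintro ⟨_, h1⟩ ⟨_, h2⟩
    exact hij (h1.symm.trans h2)

theorem D_le : I.D ≤ I.n * I.n := by
  have hinj : Set.InjOn (fun d => (I.src d, I.dst d)) (Finset.range I.D) := by
    intro d hd d' hd' h
    simp only [Prod.mk.injEq] at h
    exact I.dart_unique (by simpa using hd) (by simpa using hd') h.1 h.2
  have := Finset.card_le_card_of_injOn (s := Finset.range I.D)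
    (t := Finset.range I.n ×ˢ Finset.range I.n) (fun d => (I.src d, I.dst d))
    (fun d hd => by
      have hd : d < I.D := by simpa using hd
      simpa using ⟨I.src_lt hd, I.dst_lt hd⟩) hinj
  simpa using this

variable [Fintype V]

theorem nbrSum_eq (u : V → ℕ) {i : ℕ} (hi : i < I.n) :
    nbrSum I.G u (I.vt i) = ((I.darts i I.D).map fun d => u (I.vt (I.dst d))).sum := by
  classical
  have hnd : ((I.darts i I.D).map fun d => I.vt (I.dst d)).Nodup := by
    refine List.Nodup.map_on ?_ (I.darts_nodup i I.D)
    intro d hd d' hd' h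
    rw [mem_darts] at hd hd'
    exact I.dart_unique hd.1 hd'.1 (hd.2.trans hd'.2.symm)
      (I.vt_inj (I.dst_lt hd.1) (I.dst_lt hd'.1) h)
  have h1 := List.sum_toFinset u hnd
  rw [List.map_map] at h1
  change _ = ((I.darts i I.D).map fun d => u (I.vt (I.dst d))).sum at h1
  rw [← h1, nbrSum, ← Finset.sum_filter]
  apply Finset.sum_congr _ fun _ _ => rfl
  ext w
  simp only [Finset.mem_filter, Finset.mem_univ, true_and, List.mem_toFinset, List.mem_map,
    mem_darts]
  constructor
  · intro h
    obtain ⟨d, hd, h1, h2⟩ := I.exists_dart h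
    exact ⟨d, ⟨hd, by rw [h1, I.ix_vt hi]⟩, by rw [h2, vt_ix]⟩
  · rintro ⟨d, ⟨hd, h1⟩, rfl⟩
    rw [← h1]
    exact I.dart_adj hd

theorem deg_eq {i : ℕ} (hi : i < I.n) : deg I.G (I.vt i) = (I.darts i I.D).length := by
  have := I.nbrSum_eq (fun _ => 1) hi
  rw [nbrSum_const, mul_one] at this
  rw [this]
  simp

end Inst

end Sandpile

/-! ### The program -/

namespace WordRAM

set_option linter.constructorNameAsVariable false

infixr:60 " ;; " => Cmd.seq

/-- `h` differs from `h0` only in the listed registers and arrays. -/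
structure Frame (R : List Reg) (A : List Arr) (h0 h : Store) : Prop where
  reg : ∀ x, x ∉ R → h.reg x = h0.reg x
  arr : ∀ a, a ∉ A → h.arr a = h0.arr a

namespace Frame

variable {R R' : List Reg} {A A' : List Arr} {h0 h h1 : Store}

theorem refl (R : List Reg) (A : List Arr) (h : Store) : Frame R A h h :=
  ⟨fun _ _ => rfl, fun _ _ => rfl⟩

theorem trans (h01 : Frame R A h0 h) (h12 : Frame R' A' h h1) (hR : R' ⊆ R) (hA : A' ⊆ A) :
    Frame R A h0 h1 :=
  ⟨fun x hx => (h12.reg x fun h => hx (hR h)).trans (h01.reg x hx),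
    fun a ha => (h12.arr a fun h => ha (hA h)).trans (h01.arr a ha)⟩

theorem setReg {x : Reg} {v : ℕ} (hx : x ∈ R) (hF : Frame R A h0 h) :
    Frame R A h0 (h.setReg x v) := by
  refine ⟨fun y hy => ?_, hF.arr⟩
  rw [Store.setReg_reg, if_neg (by rintro rfl; exact hy hx), hF.reg y hy]

theorem setArr {a : Arr} {f : ℕ → ℕ} (ha : a ∈ A) (hF : Frame R A h0 h) :
    Frame R A h0 (h.setArr a f) := by
  refine ⟨hF.reg, fun y hy => ?_⟩
  rw [Store.setArr_arr, if_neg (by rintro rfl; exact hy ha), hF.arr y hy]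

end Frame

theorem Mach.Valid.w_ne {M : Mach} (hM : M.Valid) : M.w ≠ 0 := by
  intro h
  have := hM.lit
  simp [h] at this

theorem Mach.Valid.lt {M : Mach} (hM : M.Valid) {i : ℕ} (hi : i ≤ M.N) : i < 2 ^ M.w := by
  have h1 := hM.lit
  have h2 := hM.arr
  omega

namespace Exp

theorem val_lt_ne_zero {h : Store} {e f : Exp} : (lt e f).val h ≠ 0 ↔ e.val h < f.val h := by
  simp only [val]
  split_ifs with hc <;> simp [hc]

theorem val_lt_eq_zero {h : Store} {e f : Exp} : (lt e f).val h = 0 ↔ f.val h ≤ e.val h := by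
  simp only [val]
  split_ifs with hc <;> simp <;> omega

end Exp

namespace Cmd

open Exp

/-- Follows the list of the darts out of the vertex in register `u`. -/
def trav (p : Cmd) : Cmd :=
  asg .e (get .head (v .u)) ;; whl (v .e) (asg .d (sub (v .e) (c 1)) ;; p ;;
    asg .e (get .nxt (v .d)))

/-- Records the dart from `a` to `z` if it represents an edge inside the distinguished set. -/
def emitInner : Cmd :=
  ite (get .inp (add (v .ib) (v .a))) (ite (get .inp (add (v .ib) (v .z)))
    (ite (lt (get .loc (v .z)) (get .loc (v .a)))
      (put .ppe (v .pp) (sub (get .loc (v .a)) (c 1)) ;;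
      put .ppe (add (v .pp) (c 1)) (sub (get .loc (v .z)) (c 1)) ;;
      asg .pp (add (v .pp) (c 2))) skip) skip) skip

/-- Reads the darts of the input and the edges inside the distinguished set. -/
def readDarts : Cmd :=
  forr .d (c 0) (v .m2)
    (asg .a (get .inp (add (v .eb) (v .d))) ;;
    asg .z (get .inp (add (v .eb) (sub (add (v .d) (c 1)) (mul (c 2) (mod (v .d) (c 2)))))) ;;
    put .nxt (v .d) (get .head (v .a)) ;; put .head (v .a) (add (v .d) (c 1)) ;;
    put .deg (v .a) (add (get .deg (v .a)) (c 1)) ;; put .dst (v .d) (v .z) ;;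
    emitInner)

/-- The first power of two above the cube of the number of vertices, and its half. -/
def power : Cmd :=
  asg .nn (mul (v .n) (mul (v .n) (v .n))) ;; asg .pw (c 1) ;;
  whl (eq (lt (v .nn) (v .pw)) (c 0)) (asg .pw (mul (v .pw) (c 2))) ;;
  asg .half (div (v .pw) (c 2))

/-- Appends the vertex in register `y` to the queue. -/
def push (y : Reg) : Cmd :=
  put .q (v .qt) (v y) ;; asg .qt (add (v .qt) (c 1)) ;;
  put .loc (v y) (sub (add (v .k) (v .qt)) (v .st))

/-- Processes the queue. -/
def search : Cmd :=
  whl (lt (v .qh) (v .qt)) (asg .u (get .q (v .qh)) ;; asg .qh (add (v .qh) (c 1)) ;;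
    trav (asg .z (get .dst (v .d)) ;; ite (get .loc (v .z)) skip (push .z)))

/-- Lists the vertices outside the distinguished set by components. -/
def bfs : Cmd :=
  forr .i (c 0) (v .n) (ite (get .loc (v .i)) skip
    (asg .st (v .qt) ;; put .start (v .nc) (v .qt) ;; asg .nc (add (v .nc) (c 1)) ;; push .i ;;
    search)) ;;
  put .start (v .nc) (v .qt)

/-- Starts the search at all levels from `lo` on. -/
def reset (lo : Exp) : Cmd :=
  forr .i lo (add (v .k) (c 1)) (put .cnt (v .i) (c 0) ;; put .pwr (v .i) (v .half) ;;
    put .x (v .i) (sub (v .half) (c 1)))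

/-- Computes into register `a` the chips of the vertex in register `u`, including those sent by
the distinguished vertices. -/
def gather : Cmd :=
  asg .a (get .inp (add (c 2) (v .u))) ;; trav (asg .z (get .dst (v .d)) ;;
    ite (get .inp (add (v .ib) (v .z))) (asg .a (add (v .a) (get .x (get .loc (v .z))))) skip)

/-- Writes the vertices of the current component and of the distinguished set. -/
def writeVertices : Cmd :=
  put .buf (c 0) (v .ng) ;;
  forr .j (c 0) (v .k) (put .buf (add (c 2) (v .j)) (c 0) ;;
    put .buf (add (add (c 2) (v .ng)) (v .j)) (c 1)) ;;
  forr .i (v .st) (v .en) (asg .u (get .q (v .i)) ;; gather ;;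
    put .buf (add (c 2) (sub (add (v .k) (v .i)) (v .st))) (v .a) ;;
    put .buf (add (add (c 2) (v .ng)) (sub (add (v .k) (v .i)) (v .st))) (c 0))

/-- Writes the edges of the current piece. -/
def writeEdges : Cmd :=
  asg .ep (add (add (c 2) (v .ng)) (v .ng)) ;;
  forr .j (c 0) (v .pp) (put .buf (v .ep) (get .ppe (v .j)) ;; asg .ep (add (v .ep) (c 1))) ;;
  forr .i (v .st) (v .en) (asg .u (get .q (v .i)) ;; trav (asg .z (get .dst (v .d)) ;;
    ite (lt (get .loc (v .z)) (get .loc (v .u)))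
      (put .buf (v .ep) (sub (get .loc (v .u)) (c 1)) ;;
      put .buf (add (v .ep) (c 1)) (sub (get .loc (v .z)) (c 1)) ;;
      asg .ep (add (v .ep) (c 2))) skip)) ;;
  put .buf (c 1) (div (sub (v .ep) (add (add (c 2) (v .ng)) (v .ng))) (c 2))

/-- Collects the answer for the current piece. -/
def collect : Cmd :=
  ite (get .out (c 0)) (
    forr .j (c 1) (add (v .k) (c 1)) (put .h (v .j) (add (get .h (v .j)) (get .out (v .j)))) ;;
    forr .i (v .st) (v .en) (put .fin (get .q (v .i))
      (get .out (add (c 1) (sub (add (v .k) (v .i)) (v .st)))))) (asg .ok (c 0))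

/-- Solves one piece by the program `A`. -/
def onePiece (A : Prog) : Cmd :=
  asg .st (get .start (v .cc)) ;; asg .en (get .start (add (v .cc) (c 1))) ;;
  asg .ng (sub (add (v .k) (v .en)) (v .st)) ;; writeVertices ;; writeEdges ;;
  asg .len (v .ep) ;; call A .buf .out .len ;; collect

/-- Stabilizes all pieces for the current firing numbers of the distinguished vertices. -/
def leaf (A : Prog) : Cmd :=
  asg .ok (c 1) ;;
  forr .j (c 1) (add (v .k) (c 1)) (asg .u (get .pl (v .j)) ;; gather ;; put .h (v .j) (v .a)) ;;
  forr .cc (c 0) (v .nc) (onePiece A)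

/-- The least number of chips for which the distinguished vertex `j` is full. -/
def need : Exp := mul (get .deg (get .pl (v .j))) (add (get .x (v .j)) (c 1))

/-- Goes to the deepest level whose search has not ended. -/
def climb : Cmd :=
  asg .feas (c 1) ;; asg .j (v .k) ;;
  whl (eq (get .pwr (v .j)) (c 0))
    (ite (lt (get .h (v .j)) need) skip (asg .feas (c 0)) ;; asg .j (sub (v .j) (c 1)))

/-- One step of the search at the current level. -/
def advance : Cmd :=
  ite (v .feas) (ite (lt (get .h (v .j)) need) skip
    (put .cnt (v .j) (add (get .cnt (v .j)) (get .pwr (v .j))))) skip ;;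
  put .pwr (v .j) (div (get .pwr (v .j)) (c 2)) ;;
  ite (get .pwr (v .j)) (put .x (v .j) (sub (add (get .cnt (v .j)) (get .pwr (v .j))) (c 1)))
    (put .x (v .j) (get .cnt (v .j))) ;;
  reset (add (v .j) (c 1))

/-- The nested search. -/
def mainLoop (A : Prog) : Cmd :=
  whl (v .run) (leaf A ;; ite (v .ok) (climb ;; ite (v .j) advance (asg .run (c 0)))
    (asg .feas (c 0) ;; asg .run (c 0)))

/-- Writes the answer. -/
def finish : Cmd :=
  ite (v .feas)
    (forr .j (c 1) (add (v .k) (c 1)) (put .fin (get .pl (v .j)) (sub (get .h (v .j))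
      (mul (get .deg (get .pl (v .j))) (get .x (v .j))))) ;;
    put .inp (c 0) (c 1) ;;
    forr .i (c 0) (v .n) (put .inp (add (v .i) (c 1)) (get .fin (v .i))) ;;
    asg .len (add (v .n) (c 1)))
    (put .inp (c 0) (c 0) ;; asg .len (c 1))

/-- Numbering of the distinguished vertices. -/
def scan : Cmd :=
  forr .i (c 0) (v .n) (ite (get .inp (add (v .ib) (v .i)))
    (asg .k (add (v .k) (c 1)) ;; put .pl (v .k) (v .i) ;; put .loc (v .i) (v .k)) skip)

/-- Preparation. -/
def setup : Cmd :=
  asg .n (get .inp (c 0)) ;; asg .m2 (mul (c 2) (get .inp (c 1))) ;;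
  asg .ib (add (c 2) (v .n)) ;; asg .eb (add (v .ib) (v .n)) ;; scan ;; readDarts ;; power ;;
  bfs ;; put .pwr (c 0) (c 1) ;; reset (c 1) ;; asg .run (c 1)

/-- The whole computation. -/
def all (A : Prog) : Cmd := setup ;; mainLoop A ;; finish

end Cmd

end WordRAM

/-! ### Numbering of the removed vertices -/

namespace Sandpile

open WordRAM Cmd

attribute [local simp] Cmd.vc Exp.ok Exp.val Exp.cost

namespace Inst

variable {V : Type u} (I : Inst V)

open Classical in
/-- The number of distinguished vertices among the first `i`. -/
noncomputable def cntP (i : ℕ) : ℕ := Nat.count (fun j => I.vt j ∈ I.P) i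

theorem cntP_zero : I.cntP 0 = 0 := by simp [cntP]

open Classical in
theorem cntP_succ (i : ℕ) : I.cntP (i + 1) = I.cntP i + if I.vt i ∈ I.P then 1 else 0 :=
  Nat.count_succ _ _

theorem cntP_le (i : ℕ) : I.cntP i ≤ i := by classical exact Nat.count_le _

theorem cntP_mono {i j : ℕ} (h : i ≤ j) : I.cntP i ≤ I.cntP j := by
  classical exact Nat.count_monotone _ h

/-- Labels start at `1`, so that `0` in `loc` means unlabelled; the search for components uses this
as its mark for unvisited vertices. -/
theorem vc_scan {M : Mach} (hM : M.Valid) (hN : M.N = 2 + 2 * I.n + I.D) {h : Store} {c : ℕ}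
    {Q : Store → ℕ → Prop} (hn : h.reg .n = I.n) (hib : h.reg .ib = 2 + I.n) (hk : h.reg .k = 0)
    (hinp : h.arr .inp = I.inp) (hloc : ∀ v, h.arr .loc v = 0)
    (hQ : ∀ h' c', Frame [.i, .k] [.pl, .loc] h h' → h'.reg .k = I.cntP I.n →
      (∀ v < I.n, I.vt v ∈ I.P → h'.arr .loc v = I.cntP v + 1) →
      (∀ v < I.n, I.vt v ∉ I.P → h'.arr .loc v = 0) →
      (∀ v < I.n, I.vt v ∈ I.P → h'.arr .pl (I.cntP v + 1) = v) →
      c' ≤ c + 40 * I.n + 10 → Q h' c') : vc M scan Q h c := by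
  have hal := hM.arr
  have hlit := hM.lit
  refine vc_forr hM (fun i h' c' => Frame [.i, .k] [.pl, .loc] h h' ∧ h'.reg .k = I.cntP i ∧
      (∀ v < i, I.vt v ∈ I.P → h'.arr .loc v = I.cntP v + 1) ∧
      (∀ v < I.n, i ≤ v ∨ I.vt v ∉ I.P → h'.arr .loc v = 0) ∧
      (∀ v < i, I.vt v ∈ I.P → h'.arr .pl (I.cntP v + 1) = v) ∧
      c' ≤ c + 40 * i + 2) 0 I.n (by simp) rfl (Nat.zero_le _) (by omega) ?_ ?_ ?_ ?_
  · refine ⟨.setReg (by decide) (.refl _ _ _), ?_, ?_, ?_, ?_, ?_⟩ <;> simp [hk, hloc, I.cntP_zero]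
  · rintro i h' c' _ ⟨hF, _⟩
    simp [hF.reg .n (by decide), hn]
  · rintro i h' c' _ hi ⟨hF, h1, h2, h3, h4, h5⟩ hx
    have hib' := (hF.reg .ib (by decide)).trans hib
    have hinp' := (hF.arr .inp (by decide)).trans hinp
    have hcl := I.cntP_le i
    simp only [vc, Exp.ok, Exp.val, Exp.cost, hx, hib', hinp', I.inp_ind hi]
    refine ⟨⟨⟨trivial, trivial, by omega⟩, by omega⟩, ?_, ?_⟩
    · intro hP
      have hP : I.vt i ∈ I.P := by
        by_contra hcon
        simp [hcon] at hP
      simp [hx, h1, hM.w_ne]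
      refine ⟨by omega, by omega, by omega, ?_, ?_, ?_, ?_, ?_, ?_⟩
      · repeat' first | exact hF | refine Frame.setReg (by decide) ?_ | refine Frame.setArr (by decide) ?_
      · simp [I.cntP_succ, hP]
      · intro v hv hvP
        by_cases hvi : v = i
        · simp [hvi]
        · simp [hvi, h2 v (by omega) hvP]
      · intro v hv hvP
        have hvi : v ≠ i := by
          rintro rfl
          rcases hvP with h | h
          · omega
          · exact h hP
        rw [Function.update_of_ne hvi]
        exact h3 v hv (hvP.imp (fun h => by omega) id)
      · intro v hv hvP
        by_cases hvi : v = i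
        · simp [hvi]
        · rw [Function.update_of_ne]
          · exact h4 v (by omega) hvP
          · have := I.cntP_mono (show v + 1 ≤ i by omega)
            rw [I.cntP_succ, if_pos hvP] at this
            omega
      · omega
    · intro hP
      have hP : I.vt i ∉ I.P := by
        by_contra hcon
        simp [hcon] at hP
      refine ⟨trivial, .setReg (by decide) hF, ?_, ?_, ?_, ?_, ?_⟩
      · simp [h1, I.cntP_succ, hP]
      · intro v hv hvP
        have hvi : v ≠ i := by rintro rfl; exact hP hvP
        exact h2 v (by omega) hvP
      · intro v hv hvP
        refine h3 v hv ?_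
        by_cases hvi : v = i
        · left; omega
        · exact hvP.imp (fun h => by omega) id
      · intro v hv hvP
        have hvi : v ≠ i := by rintro rfl; exact hP hvP
        exact h4 v (by omega) hvP
      · omega
  · rintro h' c' ⟨hF, h1, h2, h3, h4, h5⟩ hx
    exact hQ _ _ hF h1 h2 (fun v hv hvP => h3 v hv (Or.inr hvP)) h4 (by simp; omega)

end Inst

end Sandpile

/-! ### Adjacency lists, edges inside the removed set, and the range of the search -/

namespace Sandpile

open WordRAM Cmd

set_option linter.constructorNameAsVariable false

attribute [local simp] Cmd.vc Exp.ok Exp.val Exp.cost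

attribute [local irreducible] Cmd.emitInner

namespace Inst

variable {V : Type u} (I : Inst V)

theorem dart_rev {d d' : ℕ} (hd : d < I.D) (hd' : d' < I.D) (h : d / 2 = d' / 2) (hne : d ≠ d') :
    I.src d = I.dst d' ∧ I.dst d = I.src d' := by
  obtain ⟨i, hi, hc⟩ := I.dart_cases hd
  obtain ⟨j, hj, hc'⟩ := I.dart_cases hd'
  have hij : i = j := by omega
  subst hij
  rcases hc with ⟨h0, h3, h4⟩ | ⟨h0, h3, h4⟩ <;> rcases hc' with ⟨h0', h5, h6⟩ | ⟨h0', h5, h6⟩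
  · omega
  · exact ⟨h3.trans h6.symm, h4.trans h5.symm⟩
  · exact ⟨h3.trans h6.symm, h4.trans h5.symm⟩
  · omega

/-- Darts that descend for some numbering make up at most half of the darts. -/
theorem two_mul_length_le {l : List ℕ} (hl : l.Nodup) (f : ℕ → ℕ)
    (h : ∀ d ∈ l, d < I.D ∧ f (I.dst d) < f (I.src d)) : 2 * l.length ≤ I.D := by
  -- The number `d / 2` names the edge of `d`. The two darts of an edge are reverse to each other
  -- and cannot both descend.
  have hinj : Set.InjOn (fun d => d / 2) (l.toFinset : Set ℕ) := by
    intro d hd d' hd' he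
    have hd := h d (by simpa using hd)
    have hd' := h d' (by simpa using hd')
    by_contra hne
    obtain ⟨h1, h2⟩ := I.dart_rev hd.1 hd'.1 he hne
    have h3 := hd.2
    have h4 := hd'.2
    rw [h1, h2] at h3
    omega
  have := Finset.card_le_card_of_injOn (s := l.toFinset) (t := Finset.range I.es.length)
    (fun d => d / 2) (fun d hd => by
      have := (h d (by simpa using hd)).1
      unfold D at this
      simp
      omega) hinj
  rw [List.toFinset_card_of_nodup hl, Finset.card_range] at this
  unfold D
  omega

open Classical in
/-- The edges inside the distinguished set among the first `m` darts. -/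
noncomputable def inner (m : ℕ) : List ℕ := (List.range m).filter fun d =>
  I.vt (I.src d) ∈ I.P ∧ I.vt (I.dst d) ∈ I.P ∧ I.cntP (I.dst d) < I.cntP (I.src d)

open Classical in
theorem inner_succ (m : ℕ) : I.inner (m + 1) =
    if I.vt (I.src m) ∈ I.P ∧ I.vt (I.dst m) ∈ I.P ∧ I.cntP (I.dst m) < I.cntP (I.src m)
    then I.inner m ++ [m] else I.inner m := by
  unfold inner
  rw [List.range_succ, List.filter_append]
  split_ifs with h <;> simp [h]

theorem mem_inner {m d : ℕ} : d ∈ I.inner m ↔ d < m ∧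
    I.vt (I.src d) ∈ I.P ∧ I.vt (I.dst d) ∈ I.P ∧ I.cntP (I.dst d) < I.cntP (I.src d) := by
  simp [inner]

theorem inner_nodup (m : ℕ) : (I.inner m).Nodup := List.nodup_range.filter _

theorem inner_length {m : ℕ} (hm : m ≤ I.D) : 2 * (I.inner m).length ≤ I.D :=
  I.two_mul_length_le (I.inner_nodup m) I.cntP fun _ hd =>
    ⟨(I.mem_inner.1 hd).1.trans_le hm, (I.mem_inner.1 hd).2.2.2⟩

/-- The recorded edges inside the distinguished set are those among the first `m` darts. -/
def InnerFacts (m : ℕ) (h : Store) : Prop :=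
  h.reg .pp = 2 * (I.inner m).length ∧ ∀ i < (I.inner m).length,
    h.arr .ppe (2 * i) = I.cntP (I.src ((I.inner m).getD i 0)) ∧
    h.arr .ppe (2 * i + 1) = I.cntP (I.dst ((I.inner m).getD i 0))

theorem vc_emitInner {M : Mach} (hM : M.Valid) (hN : M.N = 2 + 2 * I.n + I.D) {h : Store} {c : ℕ}
    {Q : Store → ℕ → Prop} (hib : h.reg .ib = 2 + I.n) (hinp : h.arr .inp = I.inp)
    (hloc : ∀ v < I.n, I.vt v ∈ I.P → h.arr .loc v = I.cntP v + 1) {m : ℕ} (hm : m < I.D)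
    (ha : h.reg .a = I.src m) (hz : h.reg .z = I.dst m) (hI : I.InnerFacts m h)
    (hQ : ∀ h' c', Frame [.pp] [.ppe] h h' → I.InnerFacts (m + 1) h' → c' ≤ c + 70 → Q h' c') :
    vc M emitInner Q h c := by
  obtain ⟨h5, h6⟩ := hI
  have hal := hM.arr
  have hlit := hM.lit
  have hs := I.src_lt hm
  have ht := I.dst_lt hm
  have hcs := I.cntP_le (I.src m)
  have hct := I.cntP_le (I.dst m)
  have hno : ¬ (I.vt (I.src m) ∈ I.P ∧ I.vt (I.dst m) ∈ I.P ∧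
      I.cntP (I.dst m) < I.cntP (I.src m)) → I.InnerFacts (m + 1) h := by
    intro hc
    unfold InnerFacts
    rw [inner_succ, if_neg hc]
    exact ⟨h5, h6⟩
  simp [emitInner, hib, hinp, hM.w_ne, I.inp_ind hs, I.inp_ind ht, ha, hz]
  refine ⟨by omega, fun hP => ⟨by omega, fun hP' => ?_, fun hP' => ?_⟩, fun hP => ?_⟩
  · rw [hloc _ hs hP, hloc _ ht hP']
    refine ⟨by omega, fun hlt => ?_, fun hlt => ?_⟩
    · have hlt : I.cntP (I.dst m) < I.cntP (I.src m) := by omega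
      have hinn : I.inner (m + 1) = I.inner m ++ [m] := by
        rw [inner_succ, if_pos ⟨hP, hP', hlt⟩]
      -- Each recorded edge takes two words and only one of its two darts is recorded, so the list
      -- fits into an array.
      have hil := I.inner_length (show m + 1 ≤ I.D from hm)
      rw [hinn] at hil
      simp at hil
      and_intros
      any_goals omega
      apply hQ
      · repeat' first | exact .refl _ _ _ | refine Frame.setReg (by decide) ?_ |
          refine Frame.setArr (by decide) ?_
      · unfold InnerFacts
        rw [hinn]
        refine ⟨by simp [h5]; ring, fun i hi => ?_⟩
        simp only [Store.setReg_arr, Store.setArr_arr, if_true, h5]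
        by_cases hi' : i = (I.inner m).length
        · subst hi'
          simp
        · have hi'' : i < (I.inner m).length := by simp at hi; omega
          rw [List.getD_append _ _ _ _ hi'', Function.update_of_ne (by omega),
            Function.update_of_ne (by omega), Function.update_of_ne (by omega),
            Function.update_of_ne (by omega)]
          exact h6 i hi''
      · omega
    · exact hQ _ _ (.refl _ _ _) (hno fun hc => by omega) (by omega)
  · exact hQ _ _ (.refl _ _ _) (hno fun hc => hP' hc.2.1) (by omega)
  · exact hQ _ _ (.refl _ _ _) (hno fun hc => hP hc.1) (by omega)

/-- The stored darts are the first `m` darts. -/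
def DartFacts (m : ℕ) (h : Store) : Prop :=
  (∀ v < I.n, h.arr .head v = I.lastDart v m) ∧
  (∀ v < I.n, h.arr .deg v = (I.darts v m).length) ∧
  (∀ d < m, h.arr .nxt d = I.lastDart (I.src d) d) ∧ (∀ d < m, h.arr .dst d = I.dst d)

theorem vc_readDarts {M : Mach} (hM : M.Valid) (hN : M.N = 2 + 2 * I.n + I.D) {h : Store} {c : ℕ}
    {Q : Store → ℕ → Prop} (hm2 : h.reg .m2 = I.D) (hib : h.reg .ib = 2 + I.n)
    (heb : h.reg .eb = 2 + I.n + I.n) (hpp : h.reg .pp = 0) (hinp : h.arr .inp = I.inp)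
    (hloc : ∀ v < I.n, I.vt v ∈ I.P → h.arr .loc v = I.cntP v + 1)
    (hhead : ∀ v, h.arr .head v = 0) (hdeg : ∀ v, h.arr .deg v = 0)
    (hQ : ∀ h' c', Frame [.d, .a, .z, .pp] [.nxt, .head, .deg, .dst, .ppe] h h' →
      I.DartFacts I.D h' → I.InnerFacts I.D h' → c' ≤ c + 150 * I.D + 10 → Q h' c') :
    vc M readDarts Q h c := by
  have hal := hM.arr
  have hlit := hM.lit
  refine vc_forr hM (fun m h' c' => Frame [.d, .a, .z, .pp] [.nxt, .head, .deg, .dst, .ppe] h h' ∧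
      I.DartFacts m h' ∧ I.InnerFacts m h' ∧
      c' ≤ c + 150 * m + 2) 0 I.D (by simp) rfl (Nat.zero_le _) (hM.lt (by omega)) ?_ ?_ ?_ ?_
  · refine ⟨.setReg (by decide) (.refl _ _ _), ⟨?_, ?_, ?_, ?_⟩, ⟨?_, ?_⟩, ?_⟩ <;>
      simp [hpp, hhead, hdeg, lastDart, darts, inner]
  · rintro i h' c' _ ⟨hF, _⟩
    simp [hF.reg .m2 (by decide), hm2]
  · rintro m h' c' _ hm ⟨hF, ⟨h1, h2, h3, h4⟩, ⟨h5, h6⟩, h7⟩ hx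
    have heb' := (hF.reg .eb (by decide)).trans heb
    have hib' := (hF.reg .ib (by decide)).trans hib
    have hinp' := (hF.arr .inp (by decide)).trans hinp
    have hloc' := hF.arr .loc (by decide)
    have hs := I.src_lt hm
    have ht := I.dst_lt hm
    have hmod : m % 2 < 2 := Nat.mod_lt _ (by norm_num)
    have hD : I.D = 2 * I.es.length := rfl
    have hdl : (I.darts (I.src m) m).length ≤ m := by
      unfold darts
      rw [List.length_reverse]
      exact (List.length_filter_le _ _).trans (by simp)
    have h8 := h2 _ hs
    simp [hx, heb', hinp', hM.w_ne, I.inp_src]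
    and_intros
    any_goals omega
    refine I.vc_emitInner hM hN (m := m) ?_ ?_ ?_ hm ?_ ?_ ⟨?_, ?_⟩ ?_
    · simpa using hib'
    · simpa using hinp'
    · simpa [hloc'] using hloc
    · simp
    · simp; rfl
    · simpa using h5
    · simpa using h6
    intro h'' c'' hF' hI hc
    have hF'' : Frame [.d, .a, .z, .pp] [.nxt, .head, .deg, .dst, .ppe] h' h'' := by
      refine Frame.trans ?_ hF' (by simp) (by simp)
      repeat' first | exact .refl _ _ _ | refine Frame.setReg (by decide) ?_ |
          refine Frame.setArr (by decide) ?_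
    refine ⟨(hF'.reg .d (by decide)).trans (by simpa using hx),
      .setReg (by decide) (hF.trans hF'' (by simp) (by simp)), ?_, hI, by omega⟩
    have e1 := hF'.arr .head (by decide)
    have e2 := hF'.arr .deg (by decide)
    have e3 := hF'.arr .nxt (by decide)
    have e4 := hF'.arr .dst (by decide)
    simp at e1 e2 e3 e4
    unfold DartFacts
    rw [Store.setReg_arr, e1, e2, e3, e4]
    refine ⟨fun v hv => ?_, fun v hv => ?_, fun d hd => ?_, fun d hd => ?_⟩
    · rw [lastDart]
      by_cases hv' : I.src m = v
      · subst hv'; simp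
      · rw [Function.update_of_ne (Ne.symm hv'), if_neg hv', h1 v hv]
    · rw [darts_succ]
      by_cases hv' : I.src m = v
      · subst hv'; simp [h2 _ hs]
      · rw [Function.update_of_ne (Ne.symm hv'), if_neg hv', h2 v hv]
    · by_cases hd' : d = m
      · subst hd'; simp [h1 _ hs]
      · rw [Function.update_of_ne hd', h3 d (by omega)]
    · by_cases hd' : d = m
      · subst hd'; simp; rfl
      · rw [Function.update_of_ne hd', h4 d (by omega)]
  · rintro h' c' ⟨hF, hD, hI, h7⟩ hx
    exact hQ _ _ hF hD hI (by simp; omega)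

/-- The range `2 ^ (b + 1)` exceeds `n ^ 3` and thus all firing numbers of a terminating instance,
yet it is at most `2 * n ^ 3`, which keeps the number of halvings logarithmic. -/
theorem vc_power {M : Mach} (hM : M.Valid) (hw : 2 * I.n ^ 3 < 2 ^ M.w) {h : Store} {c : ℕ}
    {Q : Store → ℕ → Prop} (hn : h.reg .n = I.n)
    (hQ : ∀ h' c' b, Frame [.nn, .pw, .half] [] h h' → h'.reg .half = 2 ^ b →
      2 ^ (b + 1) ≤ 2 * I.n ^ 3 → I.n ^ 3 < 2 ^ (b + 1) → c' ≤ c + 20 * b + 60 → Q h' c') :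
    vc M power Q h c := by
  have hlit := hM.lit
  have hn0 := I.npos
  have hn3 : I.n * (I.n * I.n) = I.n ^ 3 := by ring
  have hn2 : I.n * I.n ≤ I.n ^ 3 := by rw [← hn3]; exact Nat.le_mul_of_pos_left _ hn0
  have hn1 : 0 < I.n ^ 3 := by positivity
  unfold power
  simp [hn, hM.w_ne, hn3]
  refine ⟨⟨by omega, by omega⟩, ?_⟩
  refine vc_whl hM (fun h' c' => ∃ b, Frame [.nn, .pw, .half] [] h h' ∧ h'.reg .nn = I.n ^ 3 ∧
    h'.reg .pw = 2 ^ b ∧ 2 ^ b ≤ 2 * I.n ^ 3 ∧ c' ≤ c + 20 * b + 10)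
    (fun h' => 2 * I.n ^ 3 - h'.reg .pw) ?_ ?_
  · rintro h' c' ⟨b, hF, h1, h2, h3, h4⟩
    have hb : 0 < 2 ^ b := by positivity
    refine ⟨by simp, ?_, ?_⟩
    · intro hz
      have hlt : I.n ^ 3 < 2 ^ b := by
        simp [h1, h2] at hz
        exact hz
      -- The power exceeds `n ^ 3 ≥ 1`, so its exponent is positive and halving it is exact.
      obtain ⟨b', rfl⟩ : ∃ b', b = b' + 1 := ⟨b - 1, by
        rcases b with _ | b
        · rw [pow_zero] at hlt
          omega
        · rfl⟩
      simp [h2]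
      refine ⟨by omega, hQ _ _ b' ?_ (by simp [pow_succ]) h3 hlt (by omega)⟩
      exact .setReg (by decide) hF
    · intro hz
      have hlt : 2 ^ b ≤ I.n ^ 3 := by
        simp [h1, h2] at hz
        exact hz
      simp only [vc, Exp.ok, Exp.val, Exp.cost, h2]
      refine ⟨⟨trivial, by omega, by omega⟩, ⟨b + 1, .setReg (by decide) hF, h1, ?_, ?_, ?_⟩, ?_⟩
      · simp [pow_succ]
      · rw [pow_succ]; omega
      · omega
      · simp; omega
  · refine ⟨0, ?_, by simp, by simp, by omega, by omega⟩
    repeat' first | exact .refl _ _ _ | refine Frame.setReg (by decide) ?_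

/-- The traversal of the darts out of `u0`, the latest dart first. -/
theorem vc_trav {M : Mach} (hM : M.Valid) (hN : M.N = 2 + 2 * I.n + I.D) {p : Cmd} {h : Store}
    {c : ℕ} {Q : Store → ℕ → Prop} (J : List ℕ → Store → ℕ → Prop) {u0 : ℕ} (hu0 : u0 < I.n)
    (hhead : ∀ v < I.n, h.arr .head v = I.lastDart v I.D) (hu : h.reg .u = u0)
    (hnxt : ∀ l h c, J l h c → ∀ d < I.D, h.arr .nxt d = I.lastDart (I.src d) d)
    (he : ∀ l h c x, J l h c → J l (h.setReg .e x) c)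
    (hd : ∀ l h c x, J l h c → J l (h.setReg .d x) c)
    (h0 : J [] h (c + 6))
    (hstep : ∀ l d h c, d < I.D → I.src d = u0 → l ++ [d] <+: I.darts u0 I.D → J l h c →
      h.reg .d = d → vc M p (fun h' c' => h'.reg .d = d ∧ J (l ++ [d]) h' (c' + 6)) h (c + 6))
    (hQ : ∀ h c, J (I.darts u0 I.D) h c → Q h (c + 2)) : vc M (trav p) Q h c := by
  have hlit := hM.lit
  have hal := hM.arr
  unfold trav
  simp only [vc, Exp.ok, Exp.val, Exp.cost, hu, hhead u0 hu0]
  refine ⟨⟨trivial, by omega⟩, ?_⟩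
  refine vc_whl hM (fun h' c' => ∃ l m, m ≤ I.D ∧ J l h' c' ∧ I.darts u0 I.D = l ++ I.darts u0 m ∧
    h'.reg .e = I.lastDart u0 m) (fun h' => h'.reg .e) ?_
    ⟨[], I.D, le_rfl, he _ _ _ _ h0, by simp, by simp⟩
  rintro h' c' ⟨l, m, hm, hJ, hl, hE⟩
  refine ⟨trivial, fun hz => ?_, fun hz => ?_⟩
  · simp only [Exp.val, hE] at hz
    rcases I.lastDart_spec u0 m with ⟨_, h2⟩ | ⟨d, _, _, h2, _⟩
    · rw [h2, List.append_nil] at hl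
      exact hQ _ _ (hl ▸ hJ)
    · omega
  · simp only [Exp.val, hE] at hz
    rcases I.lastDart_spec u0 m with ⟨h2, _⟩ | ⟨d, hdm, hsd, h2, h3⟩
    · exact absurd h2 hz
    · rw [h3] at hl
      simp only [vc, Exp.ok, Exp.val, Exp.cost, hE, h2]
      refine ⟨⟨trivial, by omega, by omega⟩, ?_⟩
      have := hstep l d (h'.setReg .d d) c' (by omega) hsd
        ⟨I.darts u0 d, by rw [hl]; simp⟩ (hd _ _ _ d hJ) (by simp)
      refine vc.imp _ this ?_
      rintro h'' c'' ⟨hd'', hJ'⟩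
      have hn := hnxt _ _ _ hJ' d (by omega)
      simp only [hd'', hn, hsd]
      refine ⟨⟨trivial, by omega⟩, ⟨l ++ [d], d, by omega, he _ _ _ _ hJ', by rw [hl]; simp,
        by simp⟩, ?_⟩
      simp
      rcases I.lastDart_spec u0 d with ⟨h4, _⟩ | ⟨d', hd', _, h4, _⟩ <;> omega

end Inst

end Sandpile

/-! ### Connected components outside the removed set -/

namespace Sandpile

open WordRAM Cmd

set_option linter.constructorNameAsVariable false

attribute [local simp] Cmd.vc Exp.ok Exp.val Exp.cost

attribute [local irreducible] Cmd.push Cmd.search Cmd.trav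

namespace Inst

variable {V : Type u} (I : Inst V)

/-- `a` and `b` are connected outside the distinguished set. -/
def conn (a b : ℕ) : Prop := ∃ (ha : I.vt a ∈ I.Pᶜ) (hb : I.vt b ∈ I.Pᶜ),
  (I.G.induce I.Pᶜ).Reachable ⟨I.vt a, ha⟩ ⟨I.vt b, hb⟩

theorem conn.dart {I : Inst V} {a d : ℕ} (h : I.conn a (I.src d)) (hd : d < I.D)
    (hP : I.vt (I.dst d) ∉ I.P) : I.conn a (I.dst d) := by
  obtain ⟨ha, hb, hr⟩ := h
  refine ⟨ha, hP, hr.trans (SimpleGraph.Adj.reachable ?_)⟩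
  exact I.dart_adj hd

/-- State of the search of the component of `r`, whose vertices occupy the queue from position
`st` on; `q` and `loc` are the arrays before the search. -/
structure Searching (q loc : ℕ → ℕ) (st r : ℕ) (h : Store) : Prop where
  k_eq : h.reg .k = I.cntP I.n
  st_eq : h.reg .st = st
  le : st ≤ h.reg .qt
  mem : ∀ i < h.reg .qt, h.arr .q i < I.n ∧ I.vt (h.arr .q i) ∉ I.P ∧ h.arr .loc (h.arr .q i) ≠ 0
  inj : ∀ i < h.reg .qt, ∀ j < h.reg .qt, h.arr .q i = h.arr .q j → i = j
  old_q : ∀ i < st, h.arr .q i = q i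
  old_loc : ∀ v < I.n, loc v ≠ 0 → h.arr .loc v = loc v
  new : ∀ i, st ≤ i → i < h.reg .qt → loc (h.arr .q i) = 0 ∧
    h.arr .loc (h.arr .q i) + st = I.cntP I.n + 1 + i ∧ I.conn r (h.arr .q i)
  vis : ∀ v < I.n, h.arr .loc v ≠ 0 → loc v ≠ 0 ∨ ∃ i, st ≤ i ∧ i < h.reg .qt ∧ h.arr .q i = v

theorem le_of_injOn {q : ℕ → ℕ} {L m : ℕ} (h : ∀ i < L, q i < m)
    (hinj : ∀ i < L, ∀ j < L, q i = q j → i = j) : L ≤ m := by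
  have := Finset.card_le_card_of_injOn (s := Finset.range L) (t := Finset.range m) q
    (fun i hi => by simpa using h i (by simpa using hi))
    (fun i hi j hj => hinj i (by simpa using hi) j (by simpa using hj))
  simpa using this

theorem Searching.congr {I : Inst V} {q loc : ℕ → ℕ} {st r : ℕ} {h h' : Store}
    (hs : I.Searching q loc st r h) (hk : h'.reg .k = h.reg .k) (hst : h'.reg .st = h.reg .st)
    (hqt : h'.reg .qt = h.reg .qt) (hq : h'.arr .q = h.arr .q)
    (hloc : h'.arr .loc = h.arr .loc) : I.Searching q loc st r h' := by
  obtain ⟨h1, h2, h3, h4, h5, h6, h7, h8, h9⟩ := hs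
  constructor <;> simpa only [hk, hst, hqt, hq, hloc]

/-- The label written is the position within the current segment, counted after the removed
vertices. Its nonzero value also marks the vertex as visited. -/
theorem vc_push {M : Mach} (hM : M.Valid) (hN : M.N = 2 + 2 * I.n + I.D) {h : Store} {c : ℕ}
    {Q : Store → ℕ → Prop} {q loc : ℕ → ℕ} {st r : ℕ} (hs : I.Searching q loc st r h)
    {y : Reg} {z : ℕ} (hy : h.reg y = z) (hyt : y ≠ .qt) (hz : z < I.n) (hzP : I.vt z ∉ I.P)
    (hloc : h.arr .loc z = 0) (hc : I.conn r z)
    (hQ : ∀ h' c', Frame [.qt] [.q, .loc] h h' → I.Searching q loc st r h' →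
      h'.reg .qt = h.reg .qt + 1 → h'.arr .loc z ≠ 0 →
      (∀ v, h.arr .loc v ≠ 0 → h'.arr .loc v ≠ 0) → (∀ i < h.reg .qt, h'.arr .q i = h.arr .q i) →
      h'.arr .q (h.reg .qt) = z →
      c' ≤ c + 20 → Q h' c') : vc M (push y) Q h c := by
  have hlit := hM.lit
  have hal := hM.arr
  obtain ⟨h1, h2, h3, h4, h5, h6, h7, h8, h9⟩ := hs
  have hK := I.cntP_le I.n
  have hne : ∀ i < h.reg .qt, h.arr .q i ≠ z := by
    rintro i hi rfl
    exact (h4 i hi).2.2 hloc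
  -- The queue together with the new vertex has no repetitions, so it has at most `n` entries and
  -- the write stays inside the array.
  have hL1 : h.reg .qt + 1 ≤ I.n := by
    refine le_of_injOn (q := Function.update (h.arr .q) (h.reg .qt) z) (fun i hi => ?_)
      fun i hi j hj he => ?_
    · by_cases hi' : i = h.reg .qt
      · simpa [hi'] using hz
      · rw [Function.update_of_ne hi']; exact (h4 i (by omega)).1
    · by_cases hi' : i = h.reg .qt <;> by_cases hj' : j = h.reg .qt
      · omega
      · rw [Function.update_of_ne hj', hi', Function.update_self] at he
        exact absurd he.symm (hne j (by omega))
      · rw [Function.update_of_ne hi', hj', Function.update_self] at he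
        exact absurd he (hne i (by omega))
      · rw [Function.update_of_ne hi', Function.update_of_ne hj'] at he
        exact h5 i (by omega) j (by omega) he
  have hz0 : loc z = 0 := by
    by_contra hcon
    rw [h7 z hz hcon] at hloc
    exact hcon hloc
  unfold push
  simp [hy, hyt, h1, h2, hM.w_ne]
  refine ⟨by omega, by omega, by omega, by omega, ?_⟩
  refine hQ _ _ ?_ ?_ (by simp) (by simp; omega) ?_ ?_ (by simp) (by omega)
  · repeat' first | exact .refl _ _ _ | refine Frame.setReg (by decide) ?_ |
      refine Frame.setArr (by decide) ?_
  · constructor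
    · simpa using h1
    · simpa using h2
    · simp; omega
    · intro i hi
      simp at hi ⊢
      by_cases hi' : i = h.reg .qt
      · simp [hi', hz, hzP]; omega
      · rw [Function.update_of_ne hi', Function.update_of_ne (hne i (by omega))]
        exact h4 i (by omega)
    · intro i hi j hj
      simp at hi hj ⊢
      intro he
      by_cases hi' : i = h.reg .qt <;> by_cases hj' : j = h.reg .qt
      · omega
      · rw [Function.update_of_ne hj', hi', Function.update_self] at he
        exact absurd he.symm (hne j (by omega))
      · rw [Function.update_of_ne hi', hj', Function.update_self] at he
        exact absurd he (hne i (by omega))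
      · rw [Function.update_of_ne hi', Function.update_of_ne hj'] at he
        exact h5 i (by omega) j (by omega) he
    · intro i hi
      simp
      rw [Function.update_of_ne (by omega)]
      exact h6 i hi
    · intro v hv hv0
      have : v ≠ z := by rintro rfl; exact hv0 hz0
      simp
      rw [Function.update_of_ne this]
      exact h7 v hv hv0
    · intro i hi hi'
      simp at hi' ⊢
      by_cases hie : i = h.reg .qt
      · subst hie
        simp [hz0, hc]
        omega
      · rw [Function.update_of_ne hie, Function.update_of_ne (hne i (by omega))]
        exact h8 i hi (by omega)
    · intro v hv
      simp
      by_cases hvz : v = z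
      · intro _
        exact Or.inr ⟨h.reg .qt, by omega, by omega, by simp [hvz]⟩
      · rw [Function.update_of_ne hvz]
        intro hl
        rcases h9 v hv hl with h10 | ⟨i, hi, hi', he⟩
        · exact Or.inl h10
        · exact Or.inr ⟨i, hi, by omega, by rw [Function.update_of_ne (by omega)]; exact he⟩
  · intro v hv
    simp
    by_cases hvz : v = z
    · simp [hvz]; omega
    · rw [Function.update_of_ne hvz]; exact hv
  · intro i hi
    simp
    rw [Function.update_of_ne (by omega)]

/-- The number of steps for processing the vertex `v` in the queue, up to a constant. -/
def load (v : ℕ) : ℕ := 100 + 100 * (I.darts v I.D).length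

/-- Every processed vertex has all its neighbours labelled. When head and tail of the queue meet,
this holds for the whole segment, which is the closure property needed by `Segs.extend`. -/
theorem vc_search {M : Mach} (hM : M.Valid) (hN : M.N = 2 + 2 * I.n + I.D) {h : Store} {c : ℕ}
    {Q : Store → ℕ → Prop} {q loc : ℕ → ℕ} {st r : ℕ} (hs : I.Searching q loc st r h)
    (hdf : I.DartFacts I.D h) (hqh : h.reg .qh = st) (hqt : h.reg .qt = st + 1)
    (hlocP : ∀ v < I.n, I.vt v ∈ I.P → loc v ≠ 0)
    (hQ : ∀ h' c', Frame [.u, .e, .d, .z, .qt, .qh] [.q, .loc] h h' → I.Searching q loc st r h' →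
      h'.arr .q st = h.arr .q st → h'.reg .qh = h'.reg .qt → st < h'.reg .qt →
      (∀ i, st ≤ i → i < h'.reg .qt → ∀ d < I.D, I.src d = h'.arr .q i →
        h'.arr .loc (I.dst d) ≠ 0) →
      c' ≤ c + ∑ i ∈ Finset.Ico st (h'.reg .qt), I.load (h'.arr .q i) + 10 → Q h' c') :
    vc M search Q h c := by
  have hlit := hM.lit
  have hal := hM.arr
  unfold search
  refine vc_whl hM (fun h' c' => Frame [.u, .e, .d, .z, .qt, .qh] [.q, .loc] h h' ∧
    I.Searching q loc st r h' ∧ h'.arr .q st = h.arr .q st ∧ st ≤ h'.reg .qh ∧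
    h'.reg .qh ≤ h'.reg .qt ∧ st < h'.reg .qt ∧
    (∀ i, st ≤ i → i < h'.reg .qh → ∀ d < I.D, I.src d = h'.arr .q i →
      h'.arr .loc (I.dst d) ≠ 0) ∧
    c' ≤ c + ∑ i ∈ Finset.Ico st (h'.reg .qh), I.load (h'.arr .q i))
    (fun h' => I.n - h'.reg .qh) ?_ ?_
  · rintro h' c' ⟨hF, hs', hq0, hq1, hq2, hq3, hcl, hc⟩
    refine ⟨by simp, fun hz => ?_, fun hz => ?_⟩
    · have : h'.reg .qh = h'.reg .qt := by
        have := Exp.val_lt_eq_zero.1 hz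
        simp only [Exp.val] at this
        omega
      refine hQ _ _ hF hs' hq0 this hq3 (this ▸ hcl) ?_
      rw [← this]
      simp
      omega
    · have hlt : h'.reg .qh < h'.reg .qt := Exp.val_lt_ne_zero.1 hz
      have hLn : h'.reg .qt ≤ I.n := le_of_injOn (fun i hi => (hs'.mem i hi).1) hs'.inj
      obtain ⟨hu1, hu2, hu3⟩ := hs'.mem _ hlt
      set u0 := h'.arr .q (h'.reg .qh) with hu0
      simp [hM.w_ne, ← hu0]
      refine ⟨by omega, by omega, ?_⟩
      set h1 := (h'.setReg .u u0).setReg .qh (h'.reg .qh + 1) with hh1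
      have hF1 : Frame [.u, .e, .d, .z, .qt, .qh] [.q, .loc] h h1 :=
        .setReg (by decide) (.setReg (by decide) hF)
      have hdf1 := fun (h2 : Store) (hF2 : Frame [.u, .e, .d, .z, .qt, .qh] [.q, .loc] h h2) =>
        show (∀ v < I.n, h2.arr .head v = I.lastDart v I.D) ∧
          (∀ d < I.D, h2.arr .nxt d = I.lastDart (I.src d) d) ∧ (∀ d < I.D, h2.arr .dst d = I.dst d)
        from ⟨by rw [hF2.arr .head (by decide)]; exact hdf.1,
          by rw [hF2.arr .nxt (by decide)]; exact hdf.2.2.1,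
          by rw [hF2.arr .dst (by decide)]; exact hdf.2.2.2⟩
      refine I.vc_trav hM hN (fun l h2 c2 =>
        Frame [.u, .e, .d, .z, .qt, .qh] [.q, .loc] h h2 ∧ I.Searching q loc st r h2 ∧
        h2.reg .qh = h'.reg .qh + 1 ∧ h2.reg .u = u0 ∧ h'.reg .qt ≤ h2.reg .qt ∧
        (∀ i < h'.reg .qt, h2.arr .q i = h'.arr .q i) ∧
        (∀ v, h'.arr .loc v ≠ 0 → h2.arr .loc v ≠ 0) ∧
        (∀ d ∈ l, h2.arr .loc (I.dst d) ≠ 0) ∧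
        c2 ≤ c' + 30 + 100 * l.length) hu1 (hdf1 _ hF1).1 (by simp [hh1])
        (fun l h2 c2 hJ => (hdf1 _ hJ.1).2.1) ?_ ?_ ?_ ?_ ?_
      · rintro l h2 c2 x ⟨a1, a2, a3, a4, a5, a6, a7, a8, a9⟩
        exact ⟨.setReg (by decide) a1, a2.congr rfl rfl rfl rfl rfl, a3, a4, a5, a6, a7, a8, a9⟩
      · rintro l h2 c2 x ⟨a1, a2, a3, a4, a5, a6, a7, a8, a9⟩
        exact ⟨.setReg (by decide) a1, a2.congr rfl rfl rfl rfl rfl, a3, a4, a5, a6, a7, a8, a9⟩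
      · refine ⟨hF1, hs'.congr rfl rfl rfl rfl rfl, by simp [hh1], by simp [hh1], le_rfl,
          fun _ _ => rfl, fun _ h => h, by simp, by simp⟩
      · rintro l d h2 c2 hd hsd hpre ⟨a1, a2, a3, a4, a5, a6, a7, a8, a9⟩ hxd
        have hdst := (hdf1 _ a1).2.2 d hd
        have hdn := I.dst_lt hd
        simp [hxd, hdst]
        refine ⟨by omega, by omega, fun hv => ?_, fun hv => ?_⟩
        · refine ⟨.setReg (by decide) a1, a2.congr rfl rfl rfl rfl rfl, a3, a4, a5, a6, a7, ?_, by omega⟩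
          rintro d' (hd' | rfl)
          · exact a8 d' hd'
          · exact hv
        · have hzP : I.vt (I.dst d) ∉ I.P := by
            intro hP
            have := hlocP _ hdn hP
            exact this ((a2.old_loc _ hdn this).symm.trans hv)
          have hconn : I.conn r (I.dst d) := by
            refine conn.dart ?_ hd hzP
            rw [hsd, hu0, ← a6 _ hlt]
            exact (a2.new _ hq1 (by omega)).2.2
          refine I.vc_push hM hN (h := h2.setReg .z (I.dst d)) (a2.congr rfl rfl rfl rfl rfl)
            (y := .z) (z := I.dst d) (by simp) (by decide)
            hdn hzP (by simpa using hv) hconn ?_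
          intro h3 c3 b1 b2 b3 b4 b5 b6 b7 b8
          simp at b3 b5 b6
          have hFF := a1.trans (R := [.u, .e, .d, .z, .qt, .qh]) (A := [.q, .loc])
            (Frame.trans (R := [.z, .qt]) (A := [.q, .loc]) (.setReg (by decide) (.refl _ _ _)) b1
              (by decide) (by decide)) (by decide) (by decide)
          refine ⟨(b1.reg .d (by decide)).trans (by simpa using hxd), hFF, b2,
            (b1.reg .qh (by decide)).trans (by simpa using a3),
            (b1.reg .u (by decide)).trans (by simpa using a4), by omega,
            fun i hi => (b6 i (by omega)).trans (a6 i hi), fun v hv => b5 v (a7 v hv), ?_, by omega⟩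
          intro d' hd'
          rcases hd' with hd' | rfl
          · exact b5 _ (a8 d' hd')
          · exact b4
      · rintro h2 c2 ⟨a1, a2, a3, a4, a5, a6, a7, a8, a9⟩
        refine ⟨⟨a1, a2, (a6 st (by omega)).trans hq0, by omega, by omega, by omega, ?_, ?_⟩, by omega⟩
        · intro i hi hi' d hd hsd
          rw [a3] at hi'
          rw [a6 i (by omega)] at hsd
          by_cases hie : i = h'.reg .qh
          · subst hie
            exact a8 d (I.mem_darts.2 ⟨hd, hsd⟩)
          · exact a7 _ (hcl i hi (by omega) d hd hsd)
        · rw [a3, Finset.sum_Ico_succ_top hq1, a6 _ hlt, ← hu0]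
          have : ∑ i ∈ Finset.Ico st (h'.reg .qh), I.load (h2.arr .q i)
              = ∑ i ∈ Finset.Ico st (h'.reg .qh), I.load (h'.arr .q i) := by
            apply Finset.sum_congr rfl
            intro i hi
            rw [Finset.mem_Ico] at hi
            rw [a6 i (by omega)]
          rw [this, load]
          omega
  · exact ⟨.refl _ _ _, hs, rfl, by omega, by omega, by omega, fun i hi hi' => by omega, by omega⟩

/-- The queue `q` of length `L` lists `nc` components, which start at the positions `s`. -/
structure Segs (q loc s : ℕ → ℕ) (L nc : ℕ) : Prop where
  zero : s 0 = 0
  last : s nc = L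
  lt : ∀ c < nc, s c < s (c + 1)
  mem : ∀ i < L, q i < I.n ∧ I.vt (q i) ∉ I.P ∧ loc (q i) ≠ 0
  inj : ∀ i < L, ∀ j < L, q i = q j → i = j
  vis : ∀ v < I.n, I.vt v ∉ I.P → loc v ≠ 0 → ∃ i < L, q i = v
  loc_eq : ∀ c < nc, ∀ i, s c ≤ i → i < s (c + 1) → loc (q i) + s c = I.cntP I.n + 1 + i
  locP : ∀ v < I.n, I.vt v ∈ I.P → loc v = I.cntP v + 1
  comp : ∀ c < nc, ∃ g : (I.G.induce I.Pᶜ).ConnectedComponent, ∀ v < I.n,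
    (∃ i, s c ≤ i ∧ i < s (c + 1) ∧ q i = v) ↔
      ∃ hv : I.vt v ∈ I.Pᶜ, (I.G.induce I.Pᶜ).connectedComponentMk ⟨I.vt v, hv⟩ = g

namespace Segs

variable {I : Inst V} {q loc s : ℕ → ℕ} {L nc : ℕ}

theorem mono (hs : I.Segs q loc s L nc) {a b : ℕ} (hab : a ≤ b) (hb : b ≤ nc) : s a ≤ s b := by
  induction b with
  | zero => simp at hab; rw [hab]
  | succ b ih =>
    rcases Nat.eq_or_lt_of_le hab with rfl | h
    · exact le_rfl
    · exact (ih (by omega) (by omega)).trans (hs.lt b (by omega)).le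

theorem le_last (hs : I.Segs q loc s L nc) {a : ℕ} (ha : a ≤ nc) : s a ≤ L :=
  hs.last ▸ hs.mono ha le_rfl

theorem exists_seg (hs : I.Segs q loc s L nc) {j : ℕ} (hj : j < L) :
    ∃ c < nc, s c ≤ j ∧ j < s (c + 1) := by
  have key : ∀ m ≤ nc, j < s m → ∃ c < m, s c ≤ j ∧ j < s (c + 1) := by
    intro m
    induction m with
    | zero => intro _ h; rw [hs.zero] at h; omega
    | succ m ih =>
      intro hm h
      by_cases hlt : j < s m
      · obtain ⟨c, hc, h1⟩ := ih (by omega) hlt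
        exact ⟨c, by omega, h1⟩
      · exact ⟨m, by omega, by omega, h⟩
  exact key nc le_rfl (by rw [hs.last]; exact hj)

theorem count_le (hs : I.Segs q loc s L nc) : nc ≤ L := by
  have : ∀ m ≤ nc, m ≤ s m := by
    intro m
    induction m with
    | zero => omega
    | succ m ih =>
      intro hm
      have := ih (by omega)
      have := hs.lt m (by omega)
      omega
  have := this nc le_rfl
  rwa [hs.last] at this

theorem le_n (hs : I.Segs q loc s L nc) : L ≤ I.n := le_of_injOn (fun i hi => (hs.mem i hi).1) hs.inj

/-- The new segment consists of vertices connected to the root, and it contains everything connected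
to the root by induction along a walk, since it is closed under neighbours outside the removed set.
-/
theorem extend (hs : I.Segs q loc s L nc) {r : ℕ} {h : Store} (hh : I.Searching q loc L r h)
    (hr : h.arr .q L = r) (hlt : L < h.reg .qt)
    (hcl : ∀ i, L ≤ i → i < h.reg .qt → ∀ d < I.D, I.src d = h.arr .q i →
      h.arr .loc (I.dst d) ≠ 0) :
    I.Segs (h.arr .q) (h.arr .loc) (Function.update s (nc + 1) (h.reg .qt)) (h.reg .qt)
      (nc + 1) := by
  have hup : ∀ c ≤ nc, Function.update s (nc + 1) (h.reg .qt) c = s c := fun c hc =>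
    Function.update_of_ne (by omega) _ _
  have hold : ∀ i < L, h.arr .loc (h.arr .q i) = loc (q i) := by
    intro i hi
    obtain ⟨h1, _, h3⟩ := hs.mem i hi
    rw [hh.old_q i hi, hh.old_loc _ h1 h3]
  constructor
  · rw [hup 0 (by omega), hs.zero]
  · simp
  · intro c hc
    by_cases hcn : c = nc
    · subst hcn
      rw [hup c le_rfl, Function.update_self, hs.last]
      exact hlt
    · rw [hup c (by omega), hup (c + 1) (by omega)]
      exact hs.lt c (by omega)
  · exact hh.mem
  · exact hh.inj
  · intro v hv hvP hl
    rcases hh.vis v hv hl with h1 | ⟨i, _, hi, he⟩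
    · obtain ⟨i, hi, he⟩ := hs.vis v hv hvP h1
      exact ⟨i, by omega, by rw [hh.old_q i hi, he]⟩
    · exact ⟨i, hi, he⟩
  · intro c hc i hi hi'
    by_cases hcn : c = nc
    · subst hcn
      rw [hup c le_rfl, hs.last] at hi ⊢
      rw [Function.update_self] at hi'
      exact (hh.new i hi hi').2.1
    · rw [hup c (by omega)] at hi ⊢
      rw [hup (c + 1) (by omega)] at hi'
      rw [hold i (by have := hs.le_last (show c + 1 ≤ nc by omega); omega)]
      exact hs.loc_eq c (by omega) i hi hi'
  · intro v hv hvP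
    have := hs.locP v hv hvP
    rw [hh.old_loc v hv (by omega), this]
  · intro c hc
    by_cases hcn : c = nc
    · subst hcn
      rw [hup c le_rfl, Function.update_self, hs.last]
      obtain ⟨_, _, hrr⟩ := hh.new L le_rfl hlt
      rw [hr] at hrr
      obtain ⟨hrP, _, _⟩ := hrr
      have hrn : r < I.n := hr ▸ (hh.mem L hlt).1
      refine ⟨(I.G.induce I.Pᶜ).connectedComponentMk ⟨I.vt r, hrP⟩, fun v hv => ⟨?_, ?_⟩⟩
      · rintro ⟨i, hi, hi', rfl⟩
        obtain ⟨_, _, _, hv, hreach⟩ := hh.new i hi hi'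
        exact ⟨hv, SimpleGraph.ConnectedComponent.eq.2 hreach.symm⟩
      · rintro ⟨hvP, he⟩
        have hreach := (SimpleGraph.ConnectedComponent.eq.1 he).symm
        rw [SimpleGraph.reachable_iff_reflTransGen] at hreach
        suffices ∃ i, L ≤ i ∧ i < h.reg .qt ∧ h.arr .q i = I.ix (I.vt v) by
          rwa [I.ix_vt hv] at this
        generalize hx : (⟨I.vt v, hvP⟩ : (I.Pᶜ : Set V)) = x at hreach
        rw [show I.vt v = x from congrArg Subtype.val hx]
        clear hx he
        induction hreach with
        | refl => exact ⟨L, le_rfl, hlt, by rw [hr, I.ix_vt hrn]⟩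
        | @tail w w' _ hadj ih =>
          obtain ⟨i, hi, hi', hiw⟩ := ih
          obtain ⟨d, hd, hsd, hdd⟩ := I.exists_dart (show I.G.Adj w w' from hadj)
          have h1 := hcl i hi hi' d hd (hsd.trans hiw.symm)
          rw [hdd] at h1
          rcases hh.vis _ (I.ix_lt _) h1 with h2 | h2
          -- A neighbour `w'` that was labelled before this search lies in an older segment. That
          -- segment is a full component, so it would contain `w` too, but `w` was unlabelled
          -- before.
          · exfalso
            obtain ⟨j, hj, hjw⟩ := hs.vis _ (I.ix_lt _) (by rw [I.vt_ix]; exact w'.2) h2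
            obtain ⟨c', hc', hj1, hj2⟩ := hs.exists_seg hj
            obtain ⟨g', hg'⟩ := hs.comp c' hc'
            obtain ⟨hP', hm⟩ := (hg' _ (I.ix_lt _)).1 ⟨j, hj1, hj2, hjw⟩
            have hw' : (⟨I.vt (I.ix w'), hP'⟩ : (I.Pᶜ : Set V)) = w' := Subtype.ext (I.vt_ix _)
            rw [hw'] at hm
            have hwP : I.vt (I.ix w) ∈ I.Pᶜ := by rw [I.vt_ix]; exact w.2
            have hw : (⟨I.vt (I.ix w), hwP⟩ : (I.Pᶜ : Set V)) = w := Subtype.ext (I.vt_ix _)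
            obtain ⟨j', hj3, hj4, hj5⟩ := (hg' _ (I.ix_lt w)).2 ⟨hwP, by
              rw [hw, ← hm]
              exact SimpleGraph.ConnectedComponent.eq.2 hadj.reachable⟩
            have hj6 : j' < L := by
              have := hs.le_last (show c' + 1 ≤ _ by omega)
              omega
            have h3 := (hs.mem j' hj6).2.2
            rw [hj5, ← hiw] at h3
            exact h3 (hh.new i hi hi').1
          · exact h2
    · obtain ⟨g, hg⟩ := hs.comp c (by omega)
      refine ⟨g, fun v hv => ?_⟩
      rw [← hg v hv, hup c (by omega), hup (c + 1) (by omega)]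
      have hle := hs.le_last (show c + 1 ≤ nc by omega)
      constructor
      · rintro ⟨i, h1, h2, h3⟩
        exact ⟨i, h1, h2, by rw [← hh.old_q i (by omega), h3]⟩
      · rintro ⟨i, h1, h2, h3⟩
        exact ⟨i, h1, h2, by rw [hh.old_q i (by omega), h3]⟩

end Segs

theorem sum_load_le {q : ℕ → ℕ} {L : ℕ} (h : ∀ i < L, q i < I.n)
    (hinj : ∀ i < L, ∀ j < L, q i = q j → i = j) :
    ∑ i ∈ Finset.range L, I.load (q i) ≤ 100 * I.n + 100 * I.D := by
  have hL := le_of_injOn h hinj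
  unfold load
  rw [Finset.sum_add_distrib, ← Finset.mul_sum]
  have : ∑ i ∈ Finset.range L, (I.darts (q i) I.D).length ≤ I.D := by
    have h2 := I.sum_darts_length_le ((Finset.range L).image q)
    rwa [Finset.sum_image] at h2
    intro i hi j hj
    exact hinj i (by simpa using hi) j (by simpa using hj)
  simp
  omega

theorem vc_bfs {M : Mach} (hM : M.Valid) (hN : M.N = 2 + 2 * I.n + I.D) {h : Store} {c : ℕ}
    {Q : Store → ℕ → Prop} (hn : h.reg .n = I.n) (hk : h.reg .k = I.cntP I.n)
    (hqt : h.reg .qt = 0) (hqh : h.reg .qh = 0) (hnc : h.reg .nc = 0) (hdf : I.DartFacts I.D h)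
    (hlocP : ∀ v < I.n, I.vt v ∈ I.P → h.arr .loc v = I.cntP v + 1)
    (hloc : ∀ v < I.n, I.vt v ∉ I.P → h.arr .loc v = 0)
    (hQ : ∀ h' c', Frame [.i, .st, .nc, .u, .e, .d, .z, .qt, .qh] [.q, .loc, .start] h h' →
      I.Segs (h'.arr .q) (h'.arr .loc) (h'.arr .start) (h'.reg .qt) (h'.reg .nc) →
      (∀ v < I.n, h'.arr .loc v ≠ 0) →
      c' ≤ c + 200 * I.n + 100 * I.D + 40 → Q h' c') :
    vc M bfs Q h c := by
  have hlit := hM.lit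
  have hal := hM.arr
  have hK := I.cntP_le I.n
  -- The end of the last segment is not yet in `start`: it is written either as the start of the
  -- next segment or after the loop. The invariant therefore speaks of the updated array.
  refine vc_forr hM (fun v0 h' c' =>
    Frame [.i, .st, .nc, .u, .e, .d, .z, .qt, .qh] [.q, .loc, .start] h h' ∧
    I.Segs (h'.arr .q) (h'.arr .loc) (Function.update (h'.arr .start) (h'.reg .nc) (h'.reg .qt))
      (h'.reg .qt) (h'.reg .nc) ∧ h'.reg .qh = h'.reg .qt ∧
    (∀ v < v0, h'.arr .loc v ≠ 0) ∧
    c' ≤ c + 2 + 100 * v0 + ∑ i ∈ Finset.range (h'.reg .qt), I.load (h'.arr .q i)) 0 I.n (by simp)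
    rfl (Nat.zero_le _) (hM.lt (by omega)) ?_ ?_ ?_ ?_
  · refine ⟨.setReg (by decide) (.refl _ _ _), ?_, by simp [hqt, hqh], by simp, by simp⟩
    constructor <;> simp [hqt, hnc]
    · intro v hv hvP
      exact hloc v hv hvP
    · exact hlocP
  · rintro i h' c' _ ⟨hF, _⟩
    simp [hF.reg .n (by decide), hn]
  · rintro v0 h' c' _ hv0 ⟨hF, hS, hq, hvis, hc⟩ hx
    simp [hx]
    refine ⟨by omega, fun hl => ?_, fun hl => ?_⟩
    · refine ⟨.setReg (by decide) hF, hS, hq, fun v hv => ?_, by omega⟩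
      by_cases hvv : v = v0
      · rw [hvv]; exact hl
      · exact hvis v (by omega)
    · have hLn := hS.le_n
      have hcl := hS.count_le
      simp [hM.w_ne]
      refine ⟨by omega, by omega, ?_⟩
      set s := Function.update (h'.arr .start) (h'.reg .nc) (h'.reg .qt) with hs
      set h1 := (((h'.setReg .st (h'.reg .qt)).setArr .start s).setReg .nc (h'.reg .nc + 1)) with hh1
      have hk' := (hF.reg .k (by decide)).trans hk
      have hv0P : I.vt v0 ∉ I.P := by
        intro hP
        have := hS.locP v0 hv0 hP
        omega
      have hse : I.Searching (h'.arr .q) (h'.arr .loc) (h'.reg .qt) v0 h1 := by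
        constructor
        · simpa [hh1] using hk'
        · simp [hh1]
        · simp [hh1]
        · simpa [hh1] using hS.mem
        · simpa [hh1] using hS.inj
        · simp [hh1]
        · simp [hh1]
        · intro i hi hi'; simp [hh1] at hi'; omega
        · intro v hv hl; left; simpa [hh1] using hl
      refine I.vc_push hM hN hse (y := .i) (z := v0) (by simpa [hh1] using hx) (by decide) hv0 hv0P
        (by simpa [hh1] using hl) ⟨hv0P, hv0P, .refl _⟩ ?_
      intro h2 c2 b1 b2 b3 b4 b5 b6 b7 b8
      have hq1 : h1.reg .qt = h'.reg .qt := by simp [hh1]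
      rw [hq1] at b3 b6 b7
      have hF2 : Frame [.i, .st, .nc, .u, .e, .d, .z, .qt, .qh] [.q, .loc, .start] h' h2 := by
        refine Frame.trans ?_ b1 (by decide) (by decide)
        repeat' first | exact .refl _ _ _ | refine Frame.setReg (by decide) ?_ |
          refine Frame.setArr (by decide) ?_
      have hF2' := hF.trans hF2 (by simp) (by simp)
      refine I.vc_search hM hN b2 ⟨?_, ?_, ?_, ?_⟩ ?_ b3 ?_ ?_
      · rw [hF2'.arr .head (by decide)]; exact hdf.1
      · rw [hF2'.arr .deg (by decide)]; exact hdf.2.1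
      · rw [hF2'.arr .nxt (by decide)]; exact hdf.2.2.1
      · rw [hF2'.arr .dst (by decide)]; exact hdf.2.2.2
      · rw [b1.reg .qh (by decide)]; simpa [hh1] using hq
      · intro v hv hP
        have := hS.locP v hv hP
        omega
      intro h3 c3 d1 d2 d3 d4 d5 d6 d7
      have hnc3 : h3.reg .nc = h'.reg .nc + 1 := by
        rw [d1.reg .nc (by decide), b1.reg .nc (by decide)]; simp [hh1]
      have hst3 : h3.arr .start = s := by
        rw [d1.arr .start (by decide), b1.arr .start (by decide)]; simp [hh1]
      have hv0l : h3.arr .loc v0 ≠ 0 := by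
        have := (d2.mem _ d5).2.2
        rwa [d3, b7] at this
      refine ⟨?_, .setReg (by decide) (hF2'.trans d1 (by decide) (by decide)), ?_, d4, ?_, ?_⟩
      · rw [d1.reg .i (by decide), b1.reg .i (by decide)]; simpa [hh1] using hx
      · rw [hnc3, hst3]
        exact hS.extend d2 (d3.trans b7) d5 d6
      · intro v hv
        by_cases hvv : v = v0
        · rw [hvv]; exact hv0l
        · have h1 := hvis v (by omega)
          rw [d2.old_loc v (by omega) h1]
          exact h1
      · rw [← Finset.sum_range_add_sum_Ico _ d5.le]
        have : ∑ i ∈ Finset.range (h'.reg .qt), I.load (h3.arr .q i)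
            = ∑ i ∈ Finset.range (h'.reg .qt), I.load (h'.arr .q i) := by
          apply Finset.sum_congr rfl
          intro i hi
          rw [d2.old_q i (by simpa using hi)]
        rw [this]
        omega
  · rintro h' c' ⟨hF, hS, hq, hvis, hc⟩ hx
    have hLn := hS.le_n
    have hcl := hS.count_le
    have hsum := I.sum_load_le (fun i hi => (hS.mem i hi).1) hS.inj
    simp
    refine ⟨by omega, hQ _ _ (.setArr (by decide) hF) (by simpa using hS) (by simpa using hvis)
      (by omega)⟩

end Inst

end Sandpile

open WordRAM in
theorem WordRAM.Frame.mono {R R' : List Reg} {A A' : List Arr} {h0 h : Store}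
    (hF : Frame R A h0 h) (hR : R ⊆ R') (hA : A ⊆ A') : Frame R' A' h0 h :=
  ⟨fun x hx => hF.reg x fun h => hx (hR h), fun a ha => hF.arr a fun h => ha (hA h)⟩

/-! ### Initial intervals of the search and the preparation as a whole -/

namespace Sandpile

open WordRAM Cmd

set_option linter.constructorNameAsVariable false

attribute [local simp] Cmd.vc Exp.ok Exp.val Exp.cost

attribute [local irreducible] Cmd.scan Cmd.readDarts Cmd.power Cmd.bfs Cmd.reset

theorem vc_reset {M : Mach} (hM : M.Valid) {K half a : ℕ} {lo : Exp} {h : Store} {c : ℕ}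
    {Q : Store → ℕ → Prop} (hk : h.reg .k = K) (hK : K + 1 ≤ M.N) (hh : h.reg .half = half)
    (hh0 : 0 < half) (hlo : lo.ok M h) (ha : lo.val h = a) (haK : a ≤ K + 1)
    (hQ : ∀ h' c', Frame [.i] [.cnt, .pwr, .x] h h' →
      (∀ j, a ≤ j → j ≤ K → h'.arr .cnt j = 0 ∧ h'.arr .pwr j = half ∧ h'.arr .x j = half - 1) →
      (∀ j < a, h'.arr .cnt j = h.arr .cnt j ∧ h'.arr .pwr j = h.arr .pwr j ∧
        h'.arr .x j = h.arr .x j) →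
      c' ≤ c + lo.cost + 40 * (K + 1) + 10 → Q h' c') :
    vc M (reset lo) Q h c := by
  have hal := hM.arr
  have hlit := hM.lit
  unfold reset
  refine vc_forr hM (fun i h' c' => Frame [.i] [.cnt, .pwr, .x] h h' ∧
      (∀ j, a ≤ j → j < i → h'.arr .cnt j = 0 ∧ h'.arr .pwr j = half ∧ h'.arr .x j = half - 1) ∧
      (∀ j < a, h'.arr .cnt j = h.arr .cnt j ∧ h'.arr .pwr j = h.arr .pwr j ∧
        h'.arr .x j = h.arr .x j) ∧ c' ≤ c + lo.cost + 40 * i + 1) a (K + 1) hlo ha haK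
        (by omega) ?_ ?_ ?_ ?_
  · refine ⟨.setReg (by decide) (.refl _ _ _), fun j hj hj' => by omega, by simp, by omega⟩
  · rintro i h' c' _ ⟨hF, _⟩
    simp [hF.reg .k (by decide), hk, hM.w_ne]
    omega
  · rintro i h' c' hai hi ⟨hF, h1, h2, h3⟩ hx
    have hh' := (hF.reg .half (by decide)).trans hh
    simp [hx, hh', hM.w_ne]
    refine ⟨by omega, by omega, by omega, ?_, ?_, ?_, by omega⟩
    · repeat' first | exact hF | refine Frame.setReg (by decide) ?_ |
        refine Frame.setArr (by decide) ?_
    · intro j hj hj'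
      by_cases hji : j = i
      · simp [hji]
      · simp only [Function.update_of_ne hji]
        exact h1 j hj (by omega)
    · intro j hj
      simp only [Function.update_of_ne (show j ≠ i by omega)]
      exact h2 j hj
  · rintro h' c' ⟨hF, h1, h2, h3⟩ hx
    exact hQ _ _ hF (fun j hj hj' => h1 j hj (by omega)) h2 (by simp; omega)

namespace Inst

variable {V : Type u} (I : Inst V)

/-- The number of distinguished vertices. -/
noncomputable def K : ℕ := I.cntP I.n

/-- The number of the `j`-th distinguished vertex, counted from `1`. -/
noncomputable def pnum (j : ℕ) : ℕ := Nat.nth (fun v => I.vt v ∈ I.P) (j - 1)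

theorem pnum_cntP {v : ℕ} (hv : I.vt v ∈ I.P) : I.pnum (I.cntP v + 1) = v := by
  classical
  unfold pnum cntP
  exact Nat.nth_count (p := fun v => I.vt v ∈ I.P) hv

theorem cntP_lt_K {v : ℕ} (hv : v < I.n) (hP : I.vt v ∈ I.P) : I.cntP v < I.K := by
  have := I.cntP_mono (show v + 1 ≤ I.n by omega)
  rw [cntP_succ, if_pos hP] at this
  unfold K
  omega

theorem exists_cntP {j : ℕ} (hj : 1 ≤ j) (hK : j ≤ I.K) :
    ∃ v < I.n, I.vt v ∈ I.P ∧ I.cntP v + 1 = j := by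
  have key : ∀ m, j ≤ I.cntP m → ∃ v < m, I.vt v ∈ I.P ∧ I.cntP v + 1 = j := by
    intro m
    induction m with
    | zero => rw [cntP_zero]; omega
    | succ m ih =>
      intro h
      by_cases h1 : j ≤ I.cntP m
      · obtain ⟨v, hv, h2⟩ := ih h1
        exact ⟨v, by omega, h2⟩
      · rw [cntP_succ] at h
        split_ifs at h with hP
        · exact ⟨m, by omega, hP, by omega⟩
        · omega
  exact key _ hK

theorem pnum_spec {j : ℕ} (hj : 1 ≤ j) (hK : j ≤ I.K) :
    I.pnum j < I.n ∧ I.vt (I.pnum j) ∈ I.P ∧ I.cntP (I.pnum j) + 1 = j := by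
  obtain ⟨v, hv, hP, rfl⟩ := I.exists_cntP hj hK
  rw [I.pnum_cntP hP]
  exact ⟨hv, hP, rfl⟩

/-- The `j`-th distinguished vertex, counted from `1`. -/
noncomputable def pv (j : ℕ) : V := I.vt (I.pnum j)

theorem pv_mem {j : ℕ} (hj : 1 ≤ j) (hK : j ≤ I.K) : I.pv j ∈ I.P := (I.pnum_spec hj hK).2.1

theorem pv_ne {i j : ℕ} (hi : 1 ≤ i) (hij : i < j) (hK : j ≤ I.K) : I.pv i ≠ I.pv j := by
  intro h
  obtain ⟨h1, _, h2⟩ := I.pnum_spec hi (by omega)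
  obtain ⟨h3, _, h4⟩ := I.pnum_spec (by omega) hK
  have := I.vt_inj h1 h3 h
  rw [this] at h2
  omega

theorem exists_pv {v : V} (hv : v ∈ I.P) : ∃ j, 1 ≤ j ∧ j ≤ I.K ∧ I.pv j = v := by
  have hP : I.vt (I.ix v) ∈ I.P := by rwa [vt_ix]
  have := I.cntP_lt_K (I.ix_lt v) hP
  refine ⟨I.cntP (I.ix v) + 1, by omega, by omega, ?_⟩
  unfold pv
  rw [I.pnum_cntP hP, vt_ix]

theorem K_eq : I.K = I.P.ncard := by
  classical
  have h1 : I.P = ((Finset.Icc 1 I.K).image I.pv : Finset V) := by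
    ext v
    simp only [Finset.coe_image, Set.mem_image, Finset.coe_Icc, Set.mem_Icc]
    constructor
    · intro hv
      obtain ⟨j, h1, h2, h3⟩ := I.exists_pv hv
      exact ⟨j, ⟨h1, h2⟩, h3⟩
    · rintro ⟨j, ⟨h1, h2⟩, rfl⟩
      exact I.pv_mem h1 h2
  rw [h1, Set.ncard_coe_finset, Finset.card_image_of_injOn]
  · simp
  · intro i hi j hj h
    simp only [Finset.coe_Icc, Set.mem_Icc] at hi hj
    by_contra hne
    rcases Nat.lt_or_gt_of_ne hne with h' | h'
    · exact I.pv_ne hi.1 h' hj.2 h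
    · exact I.pv_ne hj.1 h' hi.2 h.symm

theorem K_le : I.K ≤ I.n := I.cntP_le _

/-- The data computed by the preparation. -/
structure Ready (b : ℕ) (h : Store) : Prop where
  n : h.reg .n = I.n
  ib : h.reg .ib = 2 + I.n
  k : h.reg .k = I.K
  half : h.reg .half = 2 ^ b
  inp : h.arr .inp = I.inp
  pl : ∀ j, 1 ≤ j → j ≤ I.K → h.arr .pl j = I.pnum j
  darts : I.DartFacts I.D h
  inner : I.InnerFacts I.D h
  segs : I.Segs (h.arr .q) (h.arr .loc) (h.arr .start) (h.reg .qt) (h.reg .nc)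
  loc : ∀ v < I.n, h.arr .loc v ≠ 0

/-- Later commands do not touch the prepared data, so each of them inherits `Ready` from its frame
alone. -/
theorem Ready.frame {I : Inst V} {b : ℕ} {h h' : Store} {R : List Reg} {A : List Arr}
    (hr : I.Ready b h) (hF : Frame R A h h')
    (hR : ∀ x ∈ [Reg.n, .ib, .k, .pp, .half, .nc, .qt], x ∉ R)
    (hA : ∀ x ∈ [Arr.inp, .pl, .loc, .head, .nxt, .deg, .dst, .ppe, .q, .start], x ∉ A) :
    I.Ready b h' := by
  obtain ⟨h1, h2, h3, h4, h5, h6, ⟨h7, h8, h9, h10⟩, ⟨h11, h12⟩, h13, h14⟩ := hr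
  have r := fun x hx => hF.reg x (hR x hx)
  have a := fun x hx => hF.arr x (hA x hx)
  refine ⟨?_, ?_, ?_, ?_, ?_, ?_, ⟨?_, ?_, ?_, ?_⟩, ⟨?_, ?_⟩, ?_, ?_⟩
  · rwa [r .n (by decide)]
  · rwa [r .ib (by decide)]
  · rwa [r .k (by decide)]
  · rwa [r .half (by decide)]
  · rwa [a .inp (by decide)]
  · rwa [a .pl (by decide)]
  · rwa [a .head (by decide)]
  · rwa [a .deg (by decide)]
  · rwa [a .nxt (by decide)]
  · rwa [a .dst (by decide)]
  · rwa [r .pp (by decide)]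
  · rwa [a .ppe (by decide)]
  · rwa [a .q (by decide), a .loc (by decide), a .start (by decide), r .qt (by decide),
      r .nc (by decide)]
  · rwa [a .loc (by decide)]

/-- The contents at the start. -/
noncomputable def store : Store := ⟨fun _ => 0, fun a => if a = .inp then I.inp else fun _ => 0⟩

/-- The input array has index `0` and hence lies where a procedure finds its input; register `0`
already holds the common length of the arrays, which is the length of the input. -/
theorem rel_store {M : Mach} (hN : M.N = 2 + 2 * I.n + I.D) (hv : ∀ v ∈ I.enc, v < 2 ^ M.w) :
    Rel M I.store (State.init I.enc) := by
  have hpos : 0 < 2 ^ M.w := by positivity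
  have hlt : ∀ i, I.inp i < 2 ^ M.w := by
    intro i
    unfold inp
    by_cases hi : i < I.enc.length
    · rw [List.getD_eq_getElem _ _ hi]
      exact hv _ (List.getElem_mem hi)
    · rwa [List.getD_eq_default _ _ (by omega)]
  constructor
  · simp [State.init, enc_length, hN]
  · intro x
    have := x.idx_pos
    simp [State.init, store]
    omega
  · intro a i hi
    by_cases ha : a = .inp
    · subst ha
      simp [State.init, store, Arr.idx, inp]
    · have : 1 ≤ a.idx := by
        rcases a <;> simp [Arr.idx] at ha ⊢
      have h1 : 1 * M.N ≤ a.idx * M.N := Nat.mul_le_mul_right _ this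
      simp only [State.init, store, if_neg ha]
      rw [List.getD_eq_default]
      rw [enc_length, ← hN]
      omega
  · intro x; exact hpos
  · intro a i _
    simp only [store]
    split_ifs
    · exact hlt i
    · exact hpos

/-- All searches are at their start. -/
structure Fresh (b a : ℕ) (h : Store) : Prop where
  sent : h.arr .pwr 0 = 1
  cnt : ∀ j, a ≤ j → j ≤ I.K → h.arr .cnt j = 0
  pwr : ∀ j, a ≤ j → j ≤ I.K → h.arr .pwr j = 2 ^ b
  x : ∀ j, a ≤ j → j ≤ I.K → h.arr .x j = 2 ^ b - 1

theorem vc_setup {M : Mach} (hM : M.Valid) (hN : M.N = 2 + 2 * I.n + I.D)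
    (hw : 2 * I.n ^ 3 < 2 ^ M.w) {Q : Store → ℕ → Prop}
    (hQ : ∀ h' c' b, I.Ready b h' → I.Fresh b 1 h' → h'.reg .run = 1 →
      2 ^ (b + 1) ≤ 2 * I.n ^ 3 → I.n ^ 3 < 2 ^ (b + 1) →
      c' ≤ 400 * I.n + 300 * I.D + 20 * b + 300 → Q h' c') :
    vc M setup Q I.store 0 := by
  have hal := hM.arr
  have hlit := hM.lit
  have hD : I.D = 2 * I.es.length := rfl
  have hKn := I.K_le
  unfold setup
  simp [store, hM.w_ne, inp_zero, inp_one]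
  and_intros
  any_goals omega
  refine I.vc_scan hM hN (by simp) (by simp) (by simp) (by simp) (by simp) ?_
  intro h1 c1 F1 hk1 hloc1 hloc1' hpl1 hc1
  refine I.vc_readDarts hM hN ?_ ?_ ?_ ?_ ?_ hloc1 ?_ ?_ ?_
  · rw [F1.reg .m2 (by decide)]; simp [hD]
  · rw [F1.reg .ib (by decide)]; simp
  · rw [F1.reg .eb (by decide)]; simp
  · rw [F1.reg .pp (by decide)]; simp
  · rw [F1.arr .inp (by decide)]; simp
  · rw [F1.arr .head (by decide)]; simp
  · rw [F1.arr .deg (by decide)]; simp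
  intro h2 c2 F2 hd2 hi2 hc2
  refine I.vc_power hM hw ?_ ?_
  · rw [F2.reg .n (by decide), F1.reg .n (by decide)]; simp
  intro h3 c3 b F3 hh3 hb1 hb2 hc3
  have F13 : Frame [.d, .a, .z, .pp, .nn, .pw, .half] [.nxt, .head, .deg, .dst, .ppe] h1 h3 :=
    Frame.trans (R := [.d, .a, .z, .pp, .nn, .pw, .half]) (A := [.nxt, .head, .deg, .dst, .ppe])
      (F2.mono (by decide) (by decide)) F3 (by simp) (by simp)
  refine I.vc_bfs hM hN ?_ ?_ ?_ ?_ ?_ ⟨?_, ?_, ?_, ?_⟩ ?_ ?_ ?_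
  · rw [F13.reg .n (by decide), F1.reg .n (by decide)]; simp
  · rw [F13.reg .k (by decide), hk1]
  · rw [F13.reg .qt (by decide), F1.reg .qt (by decide)]; simp
  · rw [F13.reg .qh (by decide), F1.reg .qh (by decide)]; simp
  · rw [F13.reg .nc (by decide), F1.reg .nc (by decide)]; simp
  · rw [F3.arr .head (by decide)]; exact hd2.1
  · rw [F3.arr .deg (by decide)]; exact hd2.2.1
  · rw [F3.arr .nxt (by decide)]; exact hd2.2.2.1
  · rw [F3.arr .dst (by decide)]; exact hd2.2.2.2
  · rw [F13.arr .loc (by decide)]; exact hloc1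
  · rw [F13.arr .loc (by decide)]; exact hloc1'
  intro h4 c4 F4 hs4 hl4 hc4
  have hk4 : h4.reg .k = I.K := by
    rw [F4.reg .k (by decide), F13.reg .k (by decide), hk1]; rfl
  have hh4 : h4.reg .half = 2 ^ b := by rw [F4.reg .half (by decide), hh3]
  have hready : I.Ready b h4 := by
    refine ⟨?_, ?_, hk4, hh4, ?_, ?_, ⟨?_, ?_, ?_, ?_⟩, ⟨?_, ?_⟩, hs4, hl4⟩
    · rw [F4.reg .n (by decide), F13.reg .n (by decide), F1.reg .n (by decide)]; simp
    · rw [F4.reg .ib (by decide), F13.reg .ib (by decide), F1.reg .ib (by decide)]; simp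
    · rw [F4.arr .inp (by decide), F13.arr .inp (by decide), F1.arr .inp (by decide)]; simp
    · intro j hj hjK
      obtain ⟨e1, e2, e3⟩ := I.pnum_spec hj hjK
      rw [F4.arr .pl (by decide), F13.arr .pl (by decide)]
      have := hpl1 _ e1 e2
      rwa [e3] at this
    · rw [F4.arr .head (by decide), F3.arr .head (by decide)]; exact hd2.1
    · rw [F4.arr .deg (by decide), F3.arr .deg (by decide)]; exact hd2.2.1
    · rw [F4.arr .nxt (by decide), F3.arr .nxt (by decide)]; exact hd2.2.2.1
    · rw [F4.arr .dst (by decide), F3.arr .dst (by decide)]; exact hd2.2.2.2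
    · rw [F4.reg .pp (by decide), F3.reg .pp (by decide)]; exact hi2.1
    · rw [F4.arr .ppe (by decide), F3.arr .ppe (by decide)]; exact hi2.2
  refine ⟨by omega, ?_⟩
  refine vc_reset hM (K := I.K) (half := 2 ^ b) (a := 1) (by simpa using hk4) (by omega)
    (by simpa using hh4) (by positivity) (by simp [hM.w_ne]) rfl (by omega) ?_
  intro h5 c5 F5 hin hout hc5
  simp at hc5
  refine hQ _ _ b (hready.frame (R := [.i, .run]) (A := [.pwr, .cnt, .x]) ?_ (by decide)
    (by decide)) ⟨?_, ?_, ?_, ?_⟩ (by simp) hb1 hb2 ?_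
  · refine .setReg (by decide) ?_
    exact Frame.trans (.setArr (by decide) (.refl _ _ _)) F5 (by simp) (by simp)
  · simpa using (hout 0 (by norm_num)).2.1
  · intro j hj hjK; exact (hin j hj hjK).1
  · intro j hj hjK; exact (hin j hj hjK).2.1
  · intro j hj hjK; exact (hin j hj hjK).2.2
  · omega

end Inst

end Sandpile

/-! ### Pieces -/

namespace Sandpile

section Pieces

open scoped Classical

variable {V : Type u} [Fintype V] {G : SimpleGraph V}

theorem nbrSum_induce {W : Set V} [Fintype W] (u : V → ℕ) (v : W)
    (h : ∀ w, G.Adj v w → w ∉ W → u w = 0) :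
    nbrSum (G.induce W) (fun x => u x) v = nbrSum G u v := by
  unfold nbrSum
  have h1 : ∑ w : W, (if (G.induce W).Adj v w then u w else 0)
      = ∑ w ∈ Finset.univ.filter (· ∈ W), if G.Adj v w then u w else 0 := by
    rw [Finset.sum_subtype (p := (· ∈ W)) _ (by simp)]
    rfl
  refine h1.trans ?_
  apply Finset.sum_subset (Finset.subset_univ _)
  intro w _ hw
  split_ifs with hadj
  · exact h w hadj (by simpa using hw)
  · rfl

theorem deg_induce {W : Set V} [Fintype W] (v : W) (h : ∀ w, G.Adj v w → w ∈ W) :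
    deg (G.induce W) v = deg G v := by
  have := nbrSum_induce (G := G) (fun _ => 1) v fun w h1 h2 => absurd (h w h1) h2
  simpa only [nbrSum_const, mul_one] using this

variable {W P : Set V} [Fintype W] {τ : W → ℕ} {σ : V → ℕ}

/-- A vertex of `W \ P` keeps all its neighbours in the piece, so its condition is the same there as
in the whole graph. -/
theorem IsSuper.induce (hcl : ∀ v ∈ W, v ∉ P → ∀ w, G.Adj v w → w ∈ W)
    (hτ : ∀ v : W, (v : V) ∉ P → τ v = σ v) {F : V → ℕ} (hF : IsSuper G (W \ P) σ F) :
    IsSuper (G.induce W) {v | (v : V) ∈ P}ᶜ τ fun v => F v := by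
  intro v hv
  have hv : (v : V) ∉ P := hv
  rw [deg_induce v (hcl v v.2 hv), nbrSum_induce F v fun w h1 h2 => absurd (hcl v v.2 hv w h1) h2,
    hτ v hv]
  exact hF v ⟨v.2, hv⟩

theorem terminates_induce (hcl : ∀ v ∈ W, v ∉ P → ∀ w, G.Adj v w → w ∈ W)
    (hτ : ∀ v : W, (v : V) ∉ P → τ v = σ v) {F : V → ℕ} (hF : IsSuper G (W \ P) σ F) :
    Terminates (G.induce W) {v | (v : V) ∈ P} τ :=
  exists_terminal_of_isSuper (hF.induce hcl hτ)

theorem sum_induce_le (hτ : ∀ v : W, (v : V) ∉ P → τ v = σ v)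
    (hτ0 : ∀ v : W, (v : V) ∈ P → τ v = 0) : ∑ v, τ v ≤ ∑ v, σ v := by
  calc ∑ v, τ v ≤ ∑ v : W, σ v := Finset.sum_le_sum fun v _ => by
        by_cases hv : (v : V) ∈ P
        · rw [hτ0 v hv]; exact Nat.zero_le _
        · rw [hτ v hv]
    _ = ∑ v ∈ Finset.univ.filter (· ∈ W), σ v := by
        rw [Finset.sum_subtype (p := (· ∈ W)) _ (by simp)]
    _ ≤ _ := Finset.sum_le_sum_of_subset (Finset.subset_univ _)

/-- The odometer of a piece, extended to the whole graph. -/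
theorem exists_odometer_induce (hcl : ∀ v ∈ W, v ∉ P → ∀ w, G.Adj v w → w ∈ W)
    (hτ : ∀ v : W, (v : V) ∉ P → τ v = σ v) (hτ0 : ∀ v : W, (v : V) ∈ P → τ v = 0) {ρ : W → ℕ}
    (hρ : IsTerminalOf (G.induce W) {v | (v : V) ∈ P} τ ρ) :
    ∃ F : V → ℕ, (∀ v, v ∉ W \ P → F v = 0) ∧ (∀ v : W, (v : V) ∈ P → ρ v = nbrSum G F v) ∧
      (∀ v : W, (v : V) ∉ P → ρ v + deg G v * F v = σ v + nbrSum G F v) ∧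
      IsLeast {F' | IsSuper G (W \ P) σ F'} F ∧ ∀ v, ρ v ≤ ∑ v, σ v := by
  obtain ⟨c, hc0, hc1, hc2⟩ := hρ.exists_odometer
  set F : V → ℕ := fun v => if h : v ∈ W then c ⟨v, h⟩ else 0 with hF
  have hFc : (fun v : W => F v) = c := by
    funext v
    simp [hF]
  have hn : ∀ v : W, nbrSum (G.induce W) c v = nbrSum G F v := by
    intro v
    rw [← hFc]
    exact nbrSum_induce F v fun w _ h2 => by simp [hF, h2]
  have hd : ∀ v : W, (v : V) ∉ P → deg (G.induce W) v = deg G v := fun v hv =>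
    deg_induce v (hcl v v.2 hv)
  refine ⟨F, fun v hv => ?_, fun v hv => ?_, fun v hv => ?_, ⟨fun v hv => ?_, fun F' hF' v => ?_⟩,
    fun v => ?_⟩
  · by_cases h : v ∈ W
    · simp only [hF, h, dif_pos]
      exact hc0 _ (by by_contra hcon; exact hv ⟨h, hcon⟩)
    · simp [hF, h]
  -- A sink never fires and starts empty, so its final content is exactly what it has received.
  · have := hc1 v
    rwa [hc0 v hv, mul_zero, add_zero, hτ0 v hv, zero_add, hn] at this
  · have := hc1 v
    rwa [hn, hd v hv, hτ v hv, ← hFc] at this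
  · have := hc2.1 ⟨v, hv.1⟩ (show (⟨v, hv.1⟩ : W) ∈ _ from hv.2)
    rwa [hn, hd ⟨v, hv.1⟩ hv.2, hτ ⟨v, hv.1⟩ hv.2, ← hFc] at this
  · by_cases h : v ∈ W
    · have := hc2.2 (IsSuper.induce hcl hτ hF') ⟨v, h⟩
      rwa [← hFc] at this
    · simp [hF, h]
  · refine le_trans ?_ (sum_induce_le hτ hτ0)
    rw [← sum_eq_of_balance hc1]
    exact Finset.single_le_sum (f := ρ) (fun _ _ => Nat.zero_le _) (Finset.mem_univ v)

theorem nbrSum_eq_zero {F : V → ℕ} {v : V} (h : ∀ w, G.Adj v w → F w = 0) : nbrSum G F v = 0 := by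
  apply Finset.sum_eq_zero
  intro w _
  split_ifs with hadj
  · exact h w hadj
  · rfl

/-- No chip passes between `D` and `D'`, so the conditions on the two sets are independent and the
least functions add up. -/
theorem isLeast_isSuper_union {D D' : Set V} {F F' : V → ℕ} (hDD : Disjoint D D')
    (hadj : ∀ v ∈ D, ∀ w ∈ D', ¬ G.Adj v w)
    (hF : IsLeast {F | IsSuper G D σ F} F) (hF' : IsLeast {F | IsSuper G D' σ F} F')
    (hF0 : ∀ v, v ∉ D → F v = 0) (hF0' : ∀ v, v ∉ D' → F' v = 0) :
    IsLeast {F | IsSuper G (D ∪ D') σ F} (F + F') := by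
  have h1 : ∀ v ∈ D, F' v = 0 := fun v hv => hF0' v (Set.disjoint_left.1 hDD hv)
  have h2 : ∀ v ∈ D', F v = 0 := fun v hv => hF0 v (Set.disjoint_right.1 hDD hv)
  refine ⟨?_, fun u hu v => ?_⟩
  · rintro v (hv | hv)
    · have := hF.1 v hv
      rw [nbrSum_add, Pi.add_apply, h1 v hv, nbrSum_eq_zero (F := F')]
      · exact this
      · exact fun w hw => hF0' w fun h => hadj v hv w h hw
    · have := hF'.1 v hv
      rw [nbrSum_add, Pi.add_apply, h2 v hv, nbrSum_eq_zero (F := F), zero_add, zero_add]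
      · exact this
      · exact fun w hw => hF0 w fun h => hadj w h v hv hw.symm
  · have h3 := hF.2 (hu.mono Set.subset_union_left) v
    have h4 := hF'.2 (hu.mono Set.subset_union_right) v
    rw [Pi.add_apply]
    by_cases hv : v ∈ D
    · rw [h1 v hv]; exact h3
    · rw [hF0 v hv, zero_add]; exact h4

/-- If the graph without sinks stabilizes, then so does the rest for all firing numbers `x` of
the vertices in `P`. -/
theorem IsSuper.exists_shift {u x : V → ℕ} (hu : IsSuper G Set.univ σ u) (hx : ∀ v ∉ P, x v = 0) :
    ∃ F, IsSuper G Pᶜ (fun v => σ v + nbrSum G x v) F := by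
  set t := ∑ v, x v with ht
  have hxt : ∀ v, x v ≤ t := fun v => Finset.single_le_sum (fun _ _ => Nat.zero_le _)
    (Finset.mem_univ v)
  refine ⟨fun v => u v + t - x v, fun v hv => ?_⟩
  have h1 := hu v (Set.mem_univ v)
  -- The prescribed numbers and the new function add up to `u + t`, because `t` bounds every `x w`.
  -- A constant adds `deg * t` on both sides of the inequality of `u`.
  have h2 : nbrSum G x v + nbrSum G (fun v => u v + t - x v) v = nbrSum G (u + fun _ => t) v := by
    rw [← nbrSum_add]
    congr 1
    funext w
    have := hxt w
    simp only [Pi.add_apply]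
    omega
  rw [nbrSum_add, nbrSum_const] at h2
  show σ v + nbrSum G x v + _ < deg G v * (u v + t - x v + 1)
  rw [hx v hv, show u v + t - 0 + 1 = (u v + 1) + t by omega, mul_add]
  omega

end Pieces

/-! ### The piece of a component: numbering, edges and encoding -/

namespace Inst

variable {V : Type u} (I : Inst V)

/-- The vertices with numbers `q a, …, q (b - 1)` form with the distinguished ones the piece `W`,
which is closed under neighbours of its other vertices; `loc` labels the vertices of `W`. -/
structure IsPiece (W : Set V) (q loc : ℕ → ℕ) (a b : ℕ) : Prop where
  mem : ∀ v, v ∈ W ↔ v ∈ I.P ∨ ∃ i, a ≤ i ∧ i < b ∧ I.vt (q i) = v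
  q_lt : ∀ i, a ≤ i → i < b → q i < I.n
  q_mem : ∀ i, a ≤ i → i < b → I.vt (q i) ∉ I.P
  loc_q : ∀ i, a ≤ i → i < b → loc (q i) + a = I.K + 1 + i
  loc_P : ∀ v < I.n, I.vt v ∈ I.P → loc v = I.cntP v + 1
  closed : ∀ v ∈ W, v ∉ I.P → ∀ w, I.G.Adj v w → w ∈ W
  lt : a < b
  le : b ≤ I.n

/-- A neighbour of a vertex of the component is either removed or in the same component, whence the
closure condition. -/
theorem Segs.isPiece {I : Inst V} {q loc s : ℕ → ℕ} {L nc c : ℕ} (hs : I.Segs q loc s L nc)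
    (hc : c < nc)
    {g : (I.G.induce (I.Pᶜ : Set V)).ConnectedComponent}
    (hg : ∀ v < I.n, (∃ i, s c ≤ i ∧ i < s (c + 1) ∧ q i = v) ↔
      ∃ hv : I.vt v ∈ I.Pᶜ, (I.G.induce I.Pᶜ).connectedComponentMk ⟨I.vt v, hv⟩ = g) :
    I.IsPiece (piece I.G I.P g) q loc (s c) (s (c + 1)) := by
  have hL : ∀ i, i < s (c + 1) → i < L := fun i hi => by
    have := hs.le_last (show c + 1 ≤ nc by omega)
    omega
  have hmem : ∀ v, v ∈ piece I.G I.P g ↔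
      v ∈ I.P ∨ ∃ i, s c ≤ i ∧ i < s (c + 1) ∧ I.vt (q i) = v := by
    intro v
    unfold piece
    rw [Set.mem_union, or_comm]
    refine or_congr_right ?_
    simp only [Set.mem_image, SimpleGraph.ConnectedComponent.mem_supp_iff]
    constructor
    · rintro ⟨⟨w, hw⟩, hwg, rfl⟩
      obtain ⟨i, h1, h2, h3⟩ := (hg _ (I.ix_lt w)).2 ⟨by rwa [I.vt_ix], by
        rw [← hwg]; congr 1; exact Subtype.ext (I.vt_ix w)⟩
      exact ⟨i, h1, h2, by rw [h3, I.vt_ix]⟩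
    · rintro ⟨i, h1, h2, rfl⟩
      obtain ⟨hP, he⟩ := (hg _ (hs.mem i (hL i h2)).1).1 ⟨i, h1, h2, rfl⟩
      exact ⟨⟨_, hP⟩, he, rfl⟩
  refine ⟨hmem, fun i _ h2 => (hs.mem i (hL i h2)).1, fun i _ h2 => (hs.mem i (hL i h2)).2.1,
    fun i h1 h2 => hs.loc_eq c hc i h1 h2, hs.locP, ?_, hs.lt c hc,
    (hs.le_last hc).trans hs.le_n⟩
  intro v hv hvP w hvw
  by_cases hwP : w ∈ I.P
  · exact Or.inr hwP
  · obtain h | ⟨i, h1, h2, rfl⟩ := (hmem v).1 hv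
    · exact absurd h hvP
    · obtain ⟨hP, he⟩ := (hg _ (hs.mem i (hL i h2)).1).1 ⟨i, h1, h2, rfl⟩
      refine Or.inl ⟨⟨w, hwP⟩, ?_, rfl⟩
      rw [SimpleGraph.ConnectedComponent.mem_supp_iff, ← he]
      exact (SimpleGraph.ConnectedComponent.eq.2 (SimpleGraph.Adj.reachable
        (show (I.G.induce I.Pᶜ).Adj ⟨_, hP⟩ ⟨w, hwP⟩ from hvw))).symm

namespace IsPiece

variable {I} {W : Set V} {q loc : ℕ → ℕ} {a b : ℕ}

theorem P_subset (hp : I.IsPiece W q loc a b) : I.P ⊆ W := fun v hv => (hp.mem v).2 (Or.inl hv)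

theorem q_memW (hp : I.IsPiece W q loc a b) {i : ℕ} (h1 : a ≤ i) (h2 : i < b) :
    I.vt (q i) ∈ W := (hp.mem _).2 (Or.inr ⟨i, h1, h2, rfl⟩)

/-- The `i`-th vertex of the piece. -/
noncomputable def vtx (I : Inst V) (q : ℕ → ℕ) (a i : ℕ) : V :=
  if i < I.K then I.pv (i + 1) else I.vt (q (a + i - I.K))

theorem vtx_memW (hp : I.IsPiece W q loc a b) {i : ℕ} (hi : i < I.K + (b - a)) :
    vtx I q a i ∈ W := by
  unfold vtx
  split_ifs with h
  · exact hp.P_subset (I.pv_mem (by omega) h)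
  · exact hp.q_memW (by omega) (by omega)

theorem loc_vtx (hp : I.IsPiece W q loc a b) {i : ℕ} (hi : i < I.K + (b - a)) :
    loc (I.ix (vtx I q a i)) = i + 1 := by
  unfold vtx
  split_ifs with h
  · obtain ⟨h1, h2, h3⟩ := I.pnum_spec (show 1 ≤ i + 1 by omega) h
    rw [pv, I.ix_vt h1, hp.loc_P _ h1 h2, h3]
  · rw [I.ix_vt (hp.q_lt _ (by omega) (by omega))]
    have := hp.loc_q (a + i - I.K) (by omega) (by omega)
    omega

theorem exists_vtx (hp : I.IsPiece W q loc a b) {v : V} (hv : v ∈ W) :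
    ∃ i < I.K + (b - a), vtx I q a i = v := by
  rcases (hp.mem v).1 hv with h | ⟨i, h1, h2, rfl⟩
  · obtain ⟨j, h1, h2, rfl⟩ := I.exists_pv h
    refine ⟨j - 1, by omega, ?_⟩
    rw [vtx, if_pos (by omega)]
    congr 1
    omega
  · refine ⟨I.K + (i - a), by omega, ?_⟩
    rw [vtx, if_neg (by omega)]
    congr 2
    omega

theorem loc_spec (hp : I.IsPiece W q loc a b) {v : V} (hv : v ∈ W) :
    1 ≤ loc (I.ix v) ∧ loc (I.ix v) - 1 < I.K + (b - a) ∧ vtx I q a (loc (I.ix v) - 1) = v := by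
  obtain ⟨i, hi, rfl⟩ := hp.exists_vtx hv
  rw [hp.loc_vtx hi]
  exact ⟨by omega, hi, rfl⟩

/-- The numbering of the vertices of the piece. -/
noncomputable def equiv (hp : I.IsPiece W q loc a b) : Fin (I.K + (b - a)) ≃ W where
  toFun i := ⟨vtx I q a i, hp.vtx_memW i.2⟩
  invFun v := ⟨loc (I.ix v) - 1, (hp.loc_spec v.2).2.1⟩
  left_inv i := by
    ext
    simp [hp.loc_vtx i.2]
  right_inv v := Subtype.ext (hp.loc_spec v.2).2.2

theorem equiv_symm (hp : I.IsPiece W q loc a b) (v : W) :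
    ((hp.equiv.symm v : Fin (I.K + (b - a))) : ℕ) = loc (I.ix v) - 1 := rfl

theorem equiv_apply (hp : I.IsPiece W q loc a b) (i : Fin (I.K + (b - a))) :
    (hp.equiv i : V) = vtx I q a i := rfl

theorem card_le (hp : I.IsPiece W q loc a b) : I.K + (b - a) ≤ I.n := by
  have : Function.Injective fun i : Fin (I.K + (b - a)) => I.e.symm (hp.equiv i) := by
    intro i j h
    exact hp.equiv.injective (Subtype.ext (I.e.symm.injective h))
  simpa using Fintype.card_le_of_injective _ this

theorem loc_inj (hp : I.IsPiece W q loc a b) {v w : V} (hv : v ∈ W) (hw : w ∈ W)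
    (h : loc (I.ix v) = loc (I.ix w)) : v = w := by
  rw [← (hp.loc_spec hv).2.2, h, (hp.loc_spec hw).2.2]

/-- The darts out of `q a, …, q (i - 1)` that descend for the labelling. -/
def outer (I : Inst V) (q loc : ℕ → ℕ) (a i : ℕ) : List ℕ :=
  (List.range' a (i - a)).flatMap fun j =>
    (I.darts (q j) I.D).filter fun d => loc (I.dst d) < loc (q j)

theorem outer_succ (I : Inst V) (q loc : ℕ → ℕ) {a i : ℕ} (h : a ≤ i) :
    outer I q loc a (i + 1) = outer I q loc a i ++
      (I.darts (q i) I.D).filter fun d => loc (I.dst d) < loc (q i) := by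
  unfold outer
  rw [show i + 1 - a = (i - a) + 1 by omega, List.range'_concat, List.flatMap_append]
  simp [show a + (i - a) = i by omega]

theorem outer_prefix (I : Inst V) (q loc : ℕ → ℕ) {a i j : ℕ} (h : a ≤ i) (hij : i ≤ j) :
    outer I q loc a i <+: outer I q loc a j := by
  induction j, hij using Nat.le_induction with
  | base => exact List.prefix_refl _
  | succ j hij ih =>
    rw [outer_succ I q loc (by omega)]
    exact ih.trans (List.prefix_append _ _)

theorem mem_outer {i d : ℕ} : d ∈ outer I q loc a i ↔
    ∃ j, a ≤ j ∧ j < i ∧ d < I.D ∧ I.src d = q j ∧ loc (I.dst d) < loc (q j) := by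
  unfold outer
  simp only [List.mem_flatMap, List.mem_range'_1, List.mem_filter, mem_darts, decide_eq_true_eq]
  constructor
  · rintro ⟨j, ⟨h1, h2⟩, ⟨h3, h4⟩, h5⟩
    exact ⟨j, h1, by omega, h3, h4, h5⟩
  · rintro ⟨j, h1, h2, h3, h4, h5⟩
    exact ⟨j, ⟨h1, by omega⟩, ⟨h3, h4⟩, h5⟩

/-- The edges of the piece, as darts that descend for the labelling. -/
noncomputable def pieceDarts (I : Inst V) (q loc : ℕ → ℕ) (a i : ℕ) : List ℕ :=
  I.inner I.D ++ outer I q loc a i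

theorem pieceDarts_nodup (hp : I.IsPiece W q loc a b) : (pieceDarts I q loc a b).Nodup := by
  unfold pieceDarts
  refine List.Nodup.append (I.inner_nodup _) ?_ ?_
  · unfold outer
    rw [List.nodup_flatMap]
    refine ⟨fun j _ => (I.darts_nodup _ _).filter _, ?_⟩
    refine List.Pairwise.imp_of_mem ?_ (List.pairwise_lt_range' (s := a) (n := b - a))
    intro i j hi hj hij d h1 h2
    simp only [List.mem_filter, mem_darts, List.mem_range'_1] at h1 h2 hi hj
    -- A dart found at two positions would mean that the same vertex stands at both, but the label
    -- of a vertex determines its position.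
    have h3 : q i = q j := h1.1.2.symm.trans h2.1.2
    have h4 := hp.loc_q i (by omega) (by omega)
    have h5 := hp.loc_q j (by omega) (by omega)
    rw [h3] at h4
    omega
  · intro d h1 h2
    obtain ⟨j, hj1, hj2, _, hs, _⟩ := mem_outer.1 h2
    have := (I.mem_inner.1 h1).2.1
    rw [hs] at this
    exact hp.q_mem j hj1 hj2 this

/-- Removed vertices have labels at most `K` and the others larger ones. So a descending dart either
joins two removed vertices or starts at a vertex of the component. -/
theorem mem_pieceDarts (hp : I.IsPiece W q loc a b) {d : ℕ} : d ∈ pieceDarts I q loc a b ↔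
    d < I.D ∧ I.vt (I.src d) ∈ W ∧ I.vt (I.dst d) ∈ W ∧ loc (I.dst d) < loc (I.src d) := by
  unfold pieceDarts
  rw [List.mem_append, I.mem_inner, mem_outer]
  constructor
  · rintro (⟨h1, h2, h3, h4⟩ | ⟨j, h1, h2, h3, h4, h5⟩)
    · refine ⟨h1, hp.P_subset h2, hp.P_subset h3, ?_⟩
      rw [hp.loc_P _ (I.dst_lt h1) h3, hp.loc_P _ (I.src_lt h1) h2]
      omega
    · refine ⟨h3, h4 ▸ hp.q_memW h1 h2, ?_, by rwa [h4]⟩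
      refine hp.closed _ (hp.q_memW h1 h2) (hp.q_mem j h1 h2) _ ?_
      rw [← h4]
      exact I.dart_adj h3
  · rintro ⟨h1, h2, h3, h4⟩
    have hs := I.src_lt h1
    have hd := I.dst_lt h1
    rcases (hp.mem _).1 h2 with h | ⟨j, hj1, hj2, hj⟩
    · rcases (hp.mem _).1 h3 with h' | ⟨j, hj1, hj2, hj⟩
      · left
        rw [hp.loc_P _ hs h, hp.loc_P _ hd h'] at h4
        exact ⟨h1, h, h', by omega⟩
      · exfalso
        have h5 := I.vt_inj (hp.q_lt j hj1 hj2) hd hj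
        have h6 := hp.loc_q j hj1 hj2
        rw [h5] at h6
        rw [hp.loc_P _ hs h] at h4
        have := I.cntP_lt_K hs h
        omega
    · right
      have h5 := I.vt_inj (hp.q_lt j hj1 hj2) hs hj
      exact ⟨j, hj1, hj2, h1, h5.symm, by rwa [h5]⟩

theorem pieceDarts_length (hp : I.IsPiece W q loc a b) :
    2 * (pieceDarts I q loc a b).length ≤ I.D :=
  I.two_mul_length_le hp.pieceDarts_nodup loc fun _ hd =>
    ⟨((hp.mem_pieceDarts).1 hd).1, ((hp.mem_pieceDarts).1 hd).2.2.2⟩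

open Classical in
/-- The edges of the piece. -/
noncomputable def edges (hp : I.IsPiece W q loc a b) : List (W × W) :=
  (pieceDarts I q loc a b).map fun d =>
    let f : V → W := fun v => if h : v ∈ W then ⟨v, h⟩ else ⟨_, hp.q_memW le_rfl hp.lt⟩
    (f (I.vt (I.src d)), f (I.vt (I.dst d)))

/-- Labels are injective on the piece, so exactly one of the two orientations of each edge descends.
-/
theorem edges_isListing (hp : I.IsPiece W q loc a b) :
    IsEdgeListing (I.G.induce W) hp.edges := by
  classical
  unfold edges IsEdgeListing
  rw [List.map_map]
  constructor
  · refine List.Nodup.map_on ?_ hp.pieceDarts_nodup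
    intro d hd d' hd' he
    obtain ⟨h1, h2, h3, h4⟩ := hp.mem_pieceDarts.1 hd
    obtain ⟨h1', h2', h3', h4'⟩ := hp.mem_pieceDarts.1 hd'
    simp only [Function.comp_apply, dif_pos h2, dif_pos h3, dif_pos h2', dif_pos h3',
      Sym2.eq_iff, Subtype.mk.injEq] at he
    rcases he with ⟨e1, e2⟩ | ⟨e1, e2⟩
    · exact I.dart_unique h1 h1' (I.vt_inj (I.src_lt h1) (I.src_lt h1') e1)
        (I.vt_inj (I.dst_lt h1) (I.dst_lt h1') e2)
    · have e3 := I.vt_inj (I.src_lt h1) (I.dst_lt h1') e1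
      have e4 := I.vt_inj (I.dst_lt h1) (I.src_lt h1') e2
      rw [e3, e4] at h4
      omega
  · intro e
    induction e using Sym2.ind with
    | _ x y =>
      simp only [List.mem_map, Function.comp_apply, SimpleGraph.mem_edgeSet]
      constructor
      · rintro ⟨d, hd, he⟩
        obtain ⟨h1, h2, h3, h4⟩ := hp.mem_pieceDarts.1 hd
        simp only [dif_pos h2, dif_pos h3] at he
        have hadj := I.dart_adj h1
        rcases Sym2.eq_iff.1 he with ⟨e1, e2⟩ | ⟨e1, e2⟩
        · rw [← e1, ← e2]; exact hadj
        · rw [← e1, ← e2]; exact hadj.symm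
      · intro hadj
        have hadj' : I.G.Adj x y := hadj
        obtain ⟨d, h1, h2, h3⟩ := I.exists_dart hadj'
        obtain ⟨d', h1', h2', h3'⟩ := I.exists_dart hadj'.symm
        have hne : loc (I.ix x) ≠ loc (I.ix y) := fun h => hadj'.ne (hp.loc_inj x.2 y.2 h)
        rcases Nat.lt_or_gt_of_ne hne with h | h
        · refine ⟨d', hp.mem_pieceDarts.2 ⟨h1', by simp [h2'], by simp [h3'], by
            rwa [h2', h3']⟩, ?_⟩
          simp [h2', h3']
        · refine ⟨d, hp.mem_pieceDarts.2 ⟨h1, by simp [h2], by simp [h3], by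
            rwa [h2, h3]⟩, ?_⟩
          simp [h2, h3]

/-- The form in which the program writes the piece: removed vertices first, then the component in
queue order, with labels minus one as numbers. -/
theorem encode_eq (hp : I.IsPiece W q loc a b) (τ : W → ℕ) :
    encode hp.equiv hp.edges τ {v | (v : V) ∈ I.P} =
      [I.K + (b - a), (pieceDarts I q loc a b).length] ++
        List.ofFn (fun i => τ (hp.equiv i)) ++
        (List.range (I.K + (b - a))).map (fun i => if i < I.K then 1 else 0) ++
        (pieceDarts I q loc a b).flatMap fun d => [loc (I.src d) - 1, loc (I.dst d) - 1] := by
  unfold encode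
  have hl : hp.edges.length = (pieceDarts I q loc a b).length := by simp [edges]
  rw [hl]
  congr 1
  · congr 1
    refine List.ext_getElem (by simp) fun i h1 h2 => ?_
    simp only [List.length_ofFn] at h1
    simp only [List.getElem_ofFn, List.getElem_map, List.getElem_range]
    have key : hp.equiv ⟨i, h1⟩ ∈ {v : W | (v : V) ∈ I.P} ↔ i < I.K := by
      rw [Set.mem_ofPred_eq, hp.equiv_apply, vtx]
      split_ifs with h
      · exact iff_of_true (I.pv_mem (by omega) h) h
      · exact iff_of_false (hp.q_mem _ (by omega) (by simp only; omega)) h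
    by_cases h : i < I.K
    · rw [if_pos h, if_pos (key.2 h)]
    · rw [if_neg h, if_neg fun h' => h (key.1 h')]
  · simp only [edges, List.flatMap_map]
    apply List.flatMap_congr
    intro d hd
    obtain ⟨h1, h2, h3, h4⟩ := hp.mem_pieceDarts.1 hd
    simp only [equiv_symm, dif_pos h2, dif_pos h3, I.ix_vt (I.src_lt h1), I.ix_vt (I.dst_lt h1)]

end IsPiece

end Inst

end Sandpile

/-! ### Chips sent by the removed vertices, and the vertices of a piece -/

namespace Sandpile

open WordRAM Cmd

set_option linter.constructorNameAsVariable false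

attribute [local simp] Cmd.vc Exp.ok Exp.val Exp.cost

attribute [local irreducible] Cmd.gather Cmd.trav

namespace Inst

variable {V : Type u} (I : Inst V)

open Classical in
/-- The firing numbers `x` of the distinguished vertices, extended by zero. -/
noncomputable def ext (x : ℕ → ℕ) (v : V) : ℕ := if v ∈ I.P then x (I.cntP (I.ix v) + 1) else 0

theorem ext_pv (x : ℕ → ℕ) {j : ℕ} (hj : 1 ≤ j) (hK : j ≤ I.K) : I.ext x (I.pv j) = x j := by
  obtain ⟨h1, h2, h3⟩ := I.pnum_spec hj hK
  rw [ext, if_pos (I.pv_mem hj hK), pv, I.ix_vt h1, h3]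

theorem ext_of_notMem (x : ℕ → ℕ) {v : V} (hv : v ∉ I.P) : I.ext x v = 0 := if_neg hv

variable [Fintype V]

/-- The chips after the firings `x` of the distinguished vertices, as far as received. -/
noncomputable def chips (x : ℕ → ℕ) (v : V) : ℕ := I.σ v + nbrSum I.G (I.ext x) v

theorem vc_gather {M : Mach} (hM : M.Valid) (hN : M.N = 2 + 2 * I.n + I.D) {b : ℕ} {h : Store}
    {c : ℕ} {Q : Store → ℕ → Prop} (hr : I.Ready b h) {u0 : ℕ} (hu : h.reg .u = u0)
    (hu0 : u0 < I.n) (hv : I.chips (h.arr .x) (I.vt u0) < 2 ^ M.w)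
    (hQ : ∀ h' c', Frame [.a, .e, .d, .z] [] h h' → h'.reg .a = I.chips (h.arr .x) (I.vt u0) →
      c' ≤ c + I.load u0 → Q h' c') : vc M gather Q h c := by
  have hal := hM.arr
  have hlit := hM.lit
  have hK := I.K_le
  rw [chips, I.nbrSum_eq _ hu0] at hv hQ
  unfold gather
  simp [hu, hr.inp, I.inp_chips hu0]
  refine ⟨by omega, ?_⟩
  set S := fun l : List ℕ => (l.map fun d => I.ext (h.arr .x) (I.vt (I.dst d))).sum with hS
  have hvS : I.σ (I.vt u0) + S (I.darts u0 I.D) < 2 ^ M.w := hv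
  -- Partial sums are bounded by the full one, so a single bound on the result excludes overflow on
  -- the way.
  have hpre : ∀ l, l <+: I.darts u0 I.D → S l ≤ S (I.darts u0 I.D) := by
    rintro l ⟨t, ht⟩
    rw [hS]
    simp only [← ht, List.map_append, List.sum_append]
    omega
  have hhd : ∀ h', Frame [.a, .e, .d, .z] [] h h' → I.Ready b h' := fun h' hF =>
    hr.frame hF (by decide) (by decide)
  refine I.vc_trav hM hN (fun l h' c' => Frame [.a, .e, .d, .z] [] h h' ∧
    h'.reg .a = I.σ (I.vt u0) + S l ∧ c' ≤ c + 30 + 50 * l.length) hu0 hr.darts.1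
    (by simpa using hu) ?_ ?_ ?_ ?_ ?_ ?_
  · rintro l h' c' ⟨hF, _⟩
    exact (hhd _ hF).darts.2.2.1
  · rintro l h' c' x ⟨hF, h1, h2⟩
    exact ⟨.setReg (by decide) hF, by simpa using h1, h2⟩
  · rintro l h' c' x ⟨hF, h1, h2⟩
    exact ⟨.setReg (by decide) hF, by simpa using h1, h2⟩
  · exact ⟨.setReg (by decide) (.refl _ _ _), by simp [hS], by simp⟩
  · rintro l d h' c' hd hsd hl ⟨hF, h1, h2⟩ hx
    have hr' := hhd _ hF
    have hdn := I.dst_lt hd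
    have hle := hpre _ hl
    have hSd : S (l ++ [d]) = S l + I.ext (h.arr .x) (I.vt (I.dst d)) := by simp [hS]
    have hxx : h'.arr .x = h.arr .x := hF.arr .x (by decide)
    have hdd := hr'.darts.2.2.2 d hd
    have hct := I.cntP_lt_K hdn
    simp [hx, hdd, hr'.inp, hr'.ib, I.inp_ind hdn, h1]
    refine ⟨by omega, by omega, fun hP => ?_, fun hP => ?_⟩
    · have hct := hct hP
      have hlo := hr'.segs.locP _ hdn hP
      have hext : I.ext (h.arr .x) (I.vt (I.dst d)) = h.arr .x (I.cntP (I.dst d) + 1) := by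
        rw [ext, if_pos hP, I.ix_vt hdn]
      rw [hlo, hxx, ← hext]
      and_intros
      any_goals omega
      repeat' first | exact hF | refine Frame.setReg (by decide) ?_
    · refine ⟨.setReg (by decide) hF, ?_, by omega⟩
      rw [hSd, I.ext_of_notMem _ hP, add_zero]
  · rintro h' c' ⟨hF, h1, h2⟩
    exact hQ _ _ hF h1 (by unfold load; omega)

variable {I}

/-- Gathering the chips of a vertex takes at most `load` steps and the remaining work of its round
fewer than `100`, whence the factor `2`. -/
theorem vc_writeVertices {M : Mach} (hM : M.Valid) (hN : M.N = 2 + 2 * I.n + I.D) {bb : ℕ}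
    {h : Store} {c : ℕ} {Q : Store → ℕ → Prop} (hr : I.Ready bb h) {W : Set V} {a b : ℕ}
    (hp : I.IsPiece W (h.arr .q) (h.arr .loc) a b) (hst : h.reg .st = a) (hen : h.reg .en = b)
    (hng : h.reg .ng = I.K + (b - a)) (hv : ∀ v, I.chips (h.arr .x) v < 2 ^ M.w)
    (hQ : ∀ h' c', Frame [.j, .i, .u, .a, .e, .d, .z] [.buf] h h' →
      h'.arr .buf 0 = I.K + (b - a) →
      (∀ i < I.K + (b - a), h'.arr .buf (2 + i) = if i < I.K then 0 else
        I.chips (h.arr .x) (I.vt (h.arr .q (a + i - I.K)))) →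
      (∀ i < I.K + (b - a), h'.arr .buf (2 + (I.K + (b - a)) + i) = if i < I.K then 1 else 0) →
      c' ≤ c + 100 * (I.K + 1) + 2 * ∑ i ∈ Finset.Ico a b, I.load (h.arr .q i) → Q h' c') :
    vc M writeVertices Q h c := by
  have hal := hM.arr
  have hlit := hM.lit
  have hcl := hp.card_le
  have hab := hp.lt
  have hKn := I.K_le
  set ng := I.K + (b - a) with hngd
  set R : List Reg := [.j, .i, .u, .a, .e, .d, .z] with hR
  have hrd : ∀ h', Frame R [.buf] h h' → I.Ready bb h' := fun h' hF =>
    hr.frame hF (by decide) (by decide)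
  unfold writeVertices
  simp only [vc, Exp.ok, Exp.val, Exp.cost, hng]
  refine ⟨by omega, trivial, by omega, ?_⟩
  refine vc_forr hM (fun i h' c' => Frame R [.buf] h h' ∧ h'.arr .buf 0 = ng ∧
    (∀ t < i, h'.arr .buf (2 + t) = 0) ∧ (∀ t < i, h'.arr .buf (2 + ng + t) = 1) ∧
    c' ≤ c + 10 + 60 * i) 0 I.K (by simp) rfl (Nat.zero_le _) (hM.lt (by omega)) ?_ ?_ ?_ ?_
  · refine ⟨.setReg (by decide) (.setArr (by decide) (.refl _ _ _)), by simp, by simp, by simp, ?_⟩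
    simp
  · rintro i h' c' _ ⟨hF, _⟩
    have := (hrd _ hF).k
    simp [this]
  · rintro i h' c' _ hi ⟨hF, h1, h2, h3, h4⟩ hx
    have hng' := (hF.reg .ng (by decide)).trans hng
    simp [hx, hng', hM.w_ne]
    and_intros
    any_goals omega
    · exact .setReg (by decide) (.setArr (by decide) (.setArr (by decide) hF))
    · rw [Function.update_of_ne (by omega), Function.update_of_ne (by omega), h1]
    · intro t ht
      rw [Function.update_of_ne (by omega)]
      by_cases hti : t = i
      · simp [hti]
      · rw [Function.update_of_ne (by omega), h2 t (by omega)]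
    · intro t ht
      by_cases hti : t = i
      · simp [hti]
      · rw [Function.update_of_ne (by omega), Function.update_of_ne (by omega), h3 t (by omega)]
  rintro h1 c1 ⟨hF1, h11, h12, h13, h14⟩ -
  refine vc_forr hM (fun i h' c' => Frame R [.buf] h h' ∧ h'.arr .buf 0 = ng ∧
    (∀ t < I.K + (i - a), h'.arr .buf (2 + t) = if t < I.K then 0 else
        I.chips (h.arr .x) (I.vt (h.arr .q (a + t - I.K)))) ∧
    (∀ t < I.K + (i - a), h'.arr .buf (2 + ng + t) = if t < I.K then 1 else 0) ∧
    c' ≤ c + 30 + 60 * I.K + 2 * ∑ t ∈ Finset.Ico a i, I.load (h.arr .q t)) a b (by simp)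
    ((hF1.reg .st (by decide)).trans hst) hab.le (hM.lt (by have := hp.le; omega)) ?_ ?_ ?_ ?_
  · refine ⟨.setReg (by decide) hF1, h11, ?_, ?_, ?_⟩
    · intro t ht
      rw [if_pos (by omega)]
      exact h12 t (by omega)
    · intro t ht
      rw [if_pos (by omega)]
      exact h13 t (by omega)
    · simp
      omega
  · rintro i h' c' _ ⟨hF, _⟩
    have := (hF.reg .en (by decide)).trans hen
    simp [this]
  · rintro i h' c' hai hib ⟨hF, h1, h2, h3, h4⟩ hx
    have hq := hF.arr .q (by decide)
    have hxx := hF.arr .x (by decide)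
    have hqn := hp.q_lt i hai hib
    have hiN : i < M.N := by
      have := hp.le
      omega
    simp only [vc, Exp.ok, Exp.val, Exp.cost, hx, hq]
    refine ⟨⟨trivial, hiN⟩, ?_⟩
    have hF' : Frame R [.buf] h (h'.setReg .u (h.arr .q i)) := .setReg (by decide) hF
    refine I.vc_gather hM hN (hrd _ hF') (u0 := h.arr .q i) (by simp) hqn
      (by simpa [hxx] using hv _) ?_
    intro h'' c'' hF'' ha'' hc''
    have hFa : Frame R [.buf] h h'' := hF'.trans hF'' (by decide) (by decide)
    have hbuf : h''.arr .buf = h'.arr .buf := by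
      rw [hF''.arr .buf (by decide)]; simp
    have hk := (hrd _ hFa).k
    have hst' := (hFa.reg .st (by decide)).trans hst
    have hng' := (hFa.reg .ng (by decide)).trans hng
    have hi' : h''.reg .i = i := by rw [hF''.reg .i (by decide)]; simpa using hx
    simp [hxx] at ha''
    simp [hk, hst', hng', hi', hbuf, ha'']
    rw [show I.K + i - a = I.K + (i - a) by omega, show i + 1 - a = (i - a) + 1 by omega]
    and_intros
    any_goals omega
    · exact .setReg (by decide) (.setArr (by decide) (.setArr (by decide) hFa))
    · rw [Function.update_of_ne (by omega), Function.update_of_ne (by omega), h1]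
    · intro t ht
      rw [Function.update_of_ne (by omega)]
      by_cases hti : t = I.K + (i - a)
      · subst hti
        rw [Function.update_self, if_neg (by omega), show a + (I.K + (i - a)) - I.K = i by omega]
      · rw [Function.update_of_ne (by omega), h2 t (by omega)]
    · intro t ht
      by_cases hti : t = I.K + (i - a)
      · subst hti
        rw [Function.update_self, if_neg (by omega)]
      · rw [Function.update_of_ne (by omega), Function.update_of_ne (by omega), h3 t (by omega)]
    · rw [Finset.sum_Ico_succ_top hai]
      have : 100 ≤ I.load (h.arr .q i) := by unfold load; omega
      omega
  · rintro h' c' ⟨hF, h1, h2, h3, h4⟩ -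
    exact hQ _ _ hF h1 h2 h3 (by simp; omega)

end Inst

end Sandpile

/-! ### The edges of a piece -/

namespace Sandpile

open WordRAM Cmd

set_option linter.constructorNameAsVariable false

attribute [local simp] Cmd.vc Exp.ok Exp.val Exp.cost

attribute [local irreducible] Cmd.gather Cmd.trav Cmd.forr

namespace Inst

variable {V : Type u} {I : Inst V}

/-- The edges in `l`, with their ends labelled by `loc - 1`, are written from position `o` on. -/
def Emitted (I : Inst V) (loc : ℕ → ℕ) (o : ℕ) (l : List ℕ) (ep : ℕ) (buf : ℕ → ℕ) : Prop :=
  ep = o + 2 * l.length ∧ ∀ i < l.length, buf (o + 2 * i) = loc (I.src (l.getD i 0)) - 1 ∧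
    buf (o + 2 * i + 1) = loc (I.dst (l.getD i 0)) - 1

theorem Emitted.snoc {loc : ℕ → ℕ} {o : ℕ} {l : List ℕ} {ep : ℕ} {buf : ℕ → ℕ}
    (h : I.Emitted loc o l ep buf) (d : ℕ) : I.Emitted loc o (l ++ [d]) (ep + 2)
      (Function.update (Function.update buf ep (loc (I.src d) - 1)) (ep + 1)
        (loc (I.dst d) - 1)) := by
  obtain ⟨h1, h2⟩ := h
  refine ⟨by simp; omega, fun i hi => ?_⟩
  by_cases hi' : i = l.length
  · subst hi'
    rw [h1]
    simp
  · have hi'' : i < l.length := by simp at hi; omega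
    rw [List.getD_append _ _ _ _ hi'', Function.update_of_ne (by omega),
      Function.update_of_ne (by omega), Function.update_of_ne (by omega),
      Function.update_of_ne (by omega)]
    exact h2 i hi''

theorem Emitted.flatMap {loc : ℕ → ℕ} {o : ℕ} {l : List ℕ} {ep : ℕ} {buf : ℕ → ℕ}
    (h : I.Emitted loc o l ep buf) : (List.range (2 * l.length)).map (fun i => buf (o + i)) =
      l.flatMap fun d => [loc (I.src d) - 1, loc (I.dst d) - 1] := by
  refine List.ext_getElem (by rw [flatMap_pair_length]; simp) fun i h1 h2 => ?_
  simp only [List.length_map, List.length_range] at h1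
  obtain ⟨e1, e2⟩ := flatMap_pair_getD (fun d => loc (I.src d) - 1) (fun d => loc (I.dst d) - 1) l 0
    (i / 2) (by omega)
  obtain ⟨e3, e4⟩ := h.2 (i / 2) (by omega)
  rw [List.getD_eq_getElem _ _ (by omega)] at e3 e4
  rw [← List.getD_eq_getElem _ 0 h2]
  simp only [List.getElem_map, List.getElem_range]
  rcases Nat.mod_two_eq_zero_or_one i with hi | hi
  · rw [show o + i = o + 2 * (i / 2) by omega, e3, ← e1]
    congr 1
    omega
  · rw [show o + i = o + 2 * (i / 2) + 1 by omega, e4, ← e2]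
    congr 1
    omega

theorem vc_writeEdges {M : Mach} (hM : M.Valid) (hN : M.N = 2 + 2 * I.n + I.D) {bb : ℕ}
    {h : Store} {c : ℕ} {Q : Store → ℕ → Prop} (hr : I.Ready bb h) {W : Set V} {a b : ℕ}
    (hp : I.IsPiece W (h.arr .q) (h.arr .loc) a b) (hst : h.reg .st = a) (hen : h.reg .en = b)
    (hng : h.reg .ng = I.K + (b - a))
    (hQ : ∀ h' c' l, Frame [.ep, .j, .i, .u, .e, .d, .z] [.buf] h h' →
      l = IsPiece.pieceDarts I (h.arr .q) (h.arr .loc) a b →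
      (∀ i < 2 + 2 * (I.K + (b - a)), i ≠ 1 → h'.arr .buf i = h.arr .buf i) →
      h'.arr .buf 1 = l.length →
      I.Emitted (h.arr .loc) (2 + 2 * (I.K + (b - a))) l (h'.reg .ep) (h'.arr .buf) →
      c' ≤ c + 100 + 40 * (2 * l.length) + 2 * ∑ i ∈ Finset.Ico a b, I.load (h.arr .q i) →
        Q h' c') :
    vc M writeEdges Q h c := by
  have hal := hM.arr
  have hlit := hM.lit
  have hcl := hp.card_le
  have hab := hp.lt
  have hbn := hp.le
  have hKn := I.K_le
  have hlen := hp.pieceDarts_length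
  set q := h.arr .q with hqd
  set loc := h.arr .loc with hlocd
  -- At every moment the edges written so far form a prefix of the final list, whose length is
  -- known; this keeps all writes inside the array.
  have hpd : ∀ l, l <+: IsPiece.pieceDarts I q loc a b → 2 * l.length ≤ I.D := fun l hl => by
    have := hl.length_le
    omega
  have hil : (I.inner I.D).length ≤ (IsPiece.pieceDarts I q loc a b).length := by
    simp [IsPiece.pieceDarts]
  set ng := I.K + (b - a) with hngd
  set R : List Reg := [.ep, .j, .i, .u, .e, .d, .z] with hR
  have hrd : ∀ h', Frame R [.buf] h h' → I.Ready bb h' := fun h' hF =>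
    hr.frame hF (by decide) (by decide)
  unfold writeEdges
  simp only [vc, Exp.ok, Exp.val, Exp.cost, hng]
  refine ⟨⟨⟨by omega, trivial, by omega⟩, trivial, by omega⟩, ?_⟩
  refine vc_forr hM (fun j h' c' => Frame R [.buf] h h' ∧
    (∀ i < 2 + 2 * ng, i ≠ 1 → h'.arr .buf i = h.arr .buf i) ∧ h'.reg .ep = 2 + 2 * ng + j ∧
    (∀ i < j, h'.arr .buf (2 + 2 * ng + i) = h.arr .ppe i) ∧
    c' ≤ c + 10 + 40 * j) 0 (2 * (I.inner I.D).length) (by simp) rfl (Nat.zero_le _)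
      (hM.lt (by omega)) ?_ ?_ ?_ ?_
  · refine ⟨.setReg (by decide) (.setReg (by decide) (.refl _ _ _)), by simp, by simp; omega,
      by simp, ?_⟩
    simp
  · rintro i h' c' _ ⟨hF, _⟩
    have := (hrd _ hF).inner.1
    simp [this]
  · rintro j h' c' _ hj ⟨hF, h1, h2, h3, h4⟩ hx
    have hpe := hF.arr .ppe (by decide)
    simp [hx, h2, hM.w_ne, hpe]
    and_intros
    any_goals omega
    · exact .setReg (by decide) (.setReg (by decide) (.setArr (by decide) hF))
    · intro i hi hi1
      rw [Function.update_of_ne (by omega), h1 i hi hi1]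
    · intro i hi
      by_cases hij : i = j
      · simp [hij]
      · rw [Function.update_of_ne (by omega), h3 i (by omega)]
  rintro h1 c1 ⟨hF1, h11, h12, h13, h14⟩ -
  have hpp := hr.inner.2
  refine vc_forr hM (fun i h' c' => Frame R [.buf] h h' ∧
    (∀ i < 2 + 2 * ng, i ≠ 1 → h'.arr .buf i = h.arr .buf i) ∧
    I.Emitted loc (2 + 2 * ng) (IsPiece.pieceDarts I q loc a i) (h'.reg .ep) (h'.arr .buf) ∧
    c' ≤ c + 20 + 40 * (2 * (I.inner I.D).length) + 2 * ∑ t ∈ Finset.Ico a i, I.load (q t)) a b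
    (by simp) ((hF1.reg .st (by decide)).trans hst) hab.le (hM.lt (by omega)) ?_ ?_ ?_ ?_
  · refine ⟨.setReg (by decide) hF1, h11, ⟨?_, fun i hi => ?_⟩, ?_⟩
    · simp [IsPiece.pieceDarts, IsPiece.outer, h12]
    · simp only [IsPiece.pieceDarts, IsPiece.outer, Nat.sub_self, List.range'_zero,
        List.flatMap_nil, List.append_nil] at hi ⊢
      obtain ⟨e1, e2⟩ := hpp i hi
      have hm : (I.inner I.D).getD i 0 ∈ I.inner I.D := by
        rw [List.getD_eq_getElem _ _ hi]
        exact List.getElem_mem hi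
      obtain ⟨m1, m2, m3, _⟩ := I.mem_inner.1 hm
      rw [Store.setReg_arr, h13 _ (by omega), e1, add_assoc, h13 _ (by omega), e2,
        hp.loc_P _ (I.src_lt m1) m2, hp.loc_P _ (I.dst_lt m1) m3]
      simp
    · simp
      omega
  · rintro i h' c' _ ⟨hF, _⟩
    have := (hF.reg .en (by decide)).trans hen
    simp [this]
  · rintro i h' c' hai hib ⟨hF, g1, g2, g3⟩ hx
    have hq' := hF.arr .q (by decide)
    have hqn := hp.q_lt i hai hib
    simp only [vc, Exp.ok, Exp.val, Exp.cost, hx, hq']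
    refine ⟨⟨trivial, by omega⟩, ?_⟩
    rw [← hqd]
    have hpi : IsPiece.pieceDarts I q loc a (i + 1) = IsPiece.pieceDarts I q loc a i ++
        (I.darts (q i) I.D).filter fun d => loc (I.dst d) < loc (q i) := by
      simp [IsPiece.pieceDarts, IsPiece.outer_succ I q loc hai]
    have hpb : IsPiece.pieceDarts I q loc a (i + 1) <+: IsPiece.pieceDarts I q loc a b := by
      unfold IsPiece.pieceDarts
      exact (List.prefix_append_right_inj _).2 (IsPiece.outer_prefix I q loc (by omega) hib)
    refine I.vc_trav hM hN (fun l h'' c'' => Frame R [.buf] h h'' ∧ h''.reg .i = i ∧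
      h''.reg .u = q i ∧ (∀ i < 2 + 2 * ng, i ≠ 1 → h''.arr .buf i = h.arr .buf i) ∧
      I.Emitted loc (2 + 2 * ng) (IsPiece.pieceDarts I q loc a i ++
        l.filter fun d => loc (I.dst d) < loc (q i)) (h''.reg .ep) (h''.arr .buf) ∧
      c'' ≤ c' + 30 + 100 * l.length) hqn ?_ ?_ ?_ ?_ ?_ ?_ ?_ ?_
    · rw [Store.setReg_arr]; exact (hrd _ hF).darts.1
    · simp
    · rintro l h'' c'' ⟨hF', _⟩
      exact (hrd _ hF').darts.2.2.1
    · rintro l h'' c'' x ⟨a1, a2, a3, a4, a5, a6⟩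
      exact ⟨.setReg (by decide) a1, by simpa using a2, by simpa using a3, a4, by simpa using a5, a6⟩
    · rintro l h'' c'' x ⟨a1, a2, a3, a4, a5, a6⟩
      exact ⟨.setReg (by decide) a1, by simpa using a2, by simpa using a3, a4, by simpa using a5, a6⟩
    · refine ⟨.setReg (by decide) hF, by simpa using hx, by simp, g1, by simpa using g2, ?_⟩
      simp
    · rintro l d h'' c'' hd hsd hl ⟨a1, a2, a3, a4, a5, a6⟩ hxd
      have hr' := hrd _ a1
      have hdd := hr'.darts.2.2.2 d hd
      have hdn := I.dst_lt hd
      have hl' := a1.arr .loc (by decide)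
      have hsn := I.src_lt hd
      have hl1 := hr.loc _ hsn
      have hl2 := hr.loc _ hdn
      rw [← hlocd] at hl1 hl2
      have hpre : IsPiece.pieceDarts I q loc a i ++
          ((l ++ [d]).filter fun d => loc (I.dst d) < loc (q i)) <+:
          IsPiece.pieceDarts I q loc a b := by
        refine List.IsPrefix.trans ?_ hpb
        rw [hpi]
        exact (List.prefix_append_right_inj _).2 (hl.filter _)
      have hple := hpd _ hpre
      obtain ⟨b1, b2⟩ := a5
      rw [List.filter_append] at hple ⊢
      simp [hxd, hdd, a3, hl']
      rw [← hlocd]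
      refine ⟨by omega, by omega, fun hlt => ?_, fun hlt => ?_⟩
      · have hem := Emitted.snoc ⟨b1, b2⟩ d
        simp [hlt] at hple
        simp at b1
        simp [hlt, hM.w_ne]
        rw [← List.append_assoc, ← hsd] at *
        and_intros
        any_goals omega
        · repeat' first | exact a1 | refine Frame.setReg (by decide) ?_ |
            refine Frame.setArr (by decide) ?_
        · intro j hj hj1
          rw [Function.update_of_ne (by omega), Function.update_of_ne (by omega), a4 j hj hj1]
        · exact hem.1
        · exact hem.2
      · simp [Nat.not_lt.2 hlt]
        exact ⟨.setReg (by decide) a1, a2, a4, ⟨b1, b2⟩, by omega⟩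
    · rintro h'' c'' ⟨a1, a2, a3, a4, a5, a6⟩
      refine ⟨a2, .setReg (by decide) a1, a4, ?_, ?_⟩
      · rw [hpi]; simpa using a5
      · rw [Finset.sum_Ico_succ_top hai]
        have : I.load (q i) = 100 + 100 * (I.darts (q i) I.D).length := rfl
        omega
  · rintro h' c' ⟨hF, g1, g2, g3⟩ -
    have hng' := (hF.reg .ng (by decide)).trans hng
    obtain ⟨b1, b2⟩ := g2
    simp [hng', hM.w_ne, b1]
    refine ⟨by omega, by omega, hQ _ _ _ (.setArr (by decide) hF) rfl ?_ ?_ ⟨?_, ?_⟩ ?_⟩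
    · intro i hi hi1
      simp [hi1, g1 i hi hi1]
    · simp
      omega
    · simpa using b1
    · intro i hi
      simp only [Store.setArr_arr, if_true]
      rw [Function.update_of_ne (by omega), Function.update_of_ne (by omega)]
      exact b2 i hi
    · omega

end Inst

end Sandpile

/-! ### One call of the given algorithm -/

namespace Sandpile

open WordRAM Cmd

set_option linter.constructorNameAsVariable false

attribute [local simp] Cmd.vc Exp.ok Exp.val Exp.cost

attribute [local irreducible] Cmd.writeVertices Cmd.writeEdges Cmd.collect Cmd.forr

namespace Inst

variable {V : Type u} {I : Inst V}

theorem vc_collect {M : Mach} (hM : M.Valid) (hN : M.N = 2 + 2 * I.n + I.D) {bb : ℕ}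
    {h : Store} {c : ℕ} {Q : Store → ℕ → Prop} (hr : I.Ready bb h) {W : Set V} {a b : ℕ}
    (hp : I.IsPiece W (h.arr .q) (h.arr .loc) a b) (hst : h.reg .st = a) (hen : h.reg .en = b)
    (hout : h.arr .out 0 ≠ 0)
    (hlt : ∀ j, 1 ≤ j → j ≤ I.K → h.arr .h j + h.arr .out j < 2 ^ M.w)
    (hQ : ∀ h' c', Frame [.j, .i] [.h, .fin] h h' →
      (∀ j, 1 ≤ j → j ≤ I.K → h'.arr .h j = h.arr .h j + h.arr .out j) →
      (∀ i, a ≤ i → i < b → h'.arr .fin (h.arr .q i) = h.arr .out (1 + (I.K + i - a))) →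
      (∀ v, (∀ i, a ≤ i → i < b → h.arr .q i ≠ v) → h'.arr .fin v = h.arr .fin v) →
      c' ≤ c + 100 + 60 * (I.K + (b - a)) → Q h' c') :
    vc M collect Q h c := by
  have hal := hM.arr
  have hlit := hM.lit
  have hcl := hp.card_le
  have hab := hp.lt
  have hbn := hp.le
  have hKn := I.K_le
  have hrd : ∀ h', Frame [.j, .i] [.h, .fin] h h' → I.Ready bb h' := fun h' hF =>
    hr.frame hF (by decide) (by decide)
  unfold collect
  simp only [vc, Exp.ok, Exp.val, Exp.cost]
  refine ⟨⟨by omega, by omega⟩, fun _ => ?_, fun hz => absurd hz hout⟩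
  refine vc_forr hM (fun j h' c' => Frame [.j, .i] [.h] h h' ∧
    (∀ i, 1 ≤ i → i < j → h'.arr .h i = h.arr .h i + h.arr .out i) ∧
    (∀ i, j ≤ i → h'.arr .h i = h.arr .h i) ∧ c' ≤ c + 10 + 40 * j) 1 (I.K + 1)
    (by simp [hM.w_ne]) rfl (by omega) (hM.lt (by omega)) ?_ ?_ ?_ ?_
  · refine ⟨.setReg (by decide) (.refl _ _ _), fun i hi hi' => by omega, by simp, ?_⟩
    simp
  · rintro i h' c' _ ⟨hF, _⟩
    have := (hrd _ (hF.mono (by decide) (by decide))).k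
    simp [this, hM.w_ne]
    omega
  · rintro j h' c' hj1 hj ⟨hF, h1, h2, h3⟩ hx
    have ho := hF.arr .out (by decide)
    have := hlt j hj1 (by omega)
    simp [hx, ho, h2 j le_rfl]
    and_intros
    any_goals omega
    · exact .setReg (by decide) (.setArr (by decide) hF)
    · intro i hi hi'
      by_cases hij : i = j
      · simp [hij]
      · rw [Function.update_of_ne (by omega), h1 i hi (by omega)]
    · intro i hi
      rw [Function.update_of_ne (by omega), h2 i (by omega)]
  rintro h1 c1 ⟨hF1, h11, h12, h13⟩ -
  refine vc_forr hM (fun i h' c' => Frame [.j, .i] [.fin] h1 h' ∧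
    (∀ t, a ≤ t → t < i → h'.arr .fin (h.arr .q t) = h.arr .out (1 + (I.K + t - a))) ∧
    (∀ v, (∀ t, a ≤ t → t < i → h.arr .q t ≠ v) → h'.arr .fin v = h.arr .fin v) ∧
    c' ≤ c + 20 + 40 * (I.K + 1) + 60 * (i - a)) a b (by simp)
    ((hF1.reg .st (by decide)).trans hst) hab.le (hM.lt (by omega)) ?_ ?_ ?_ ?_
  · refine ⟨.setReg (by decide) (.refl _ _ _), fun i hi hi' => by omega, fun v _ => ?_, ?_⟩
    · simp [hF1.arr .fin (by decide)]
    · simp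
      omega
  · rintro i h' c' _ ⟨hF, _⟩
    have := (hF.reg .en (by decide)).trans ((hF1.reg .en (by decide)).trans hen)
    simp [this]
  · rintro i h' c' hai hib ⟨hF, g1, g2, g3⟩ hx
    have hF' : Frame [.j, .i] [.h, .fin] h h' :=
      (hF1.mono (by decide) (by decide)).trans hF (by decide) (by decide)
    have ho := hF'.arr .out (by decide)
    have hq := hF'.arr .q (by decide)
    have hk := (hrd _ hF').k
    have hst' := (hF'.reg .st (by decide)).trans hst
    have hqn := hp.q_lt i hai hib
    simp [hx, ho, hq, hk, hst', hM.w_ne]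
    and_intros
    any_goals omega
    · exact .setReg (by decide) (.setArr (by decide) hF)
    · intro t ht ht'
      by_cases hti : t = i
      · simp [hti]
      · rw [Function.update_of_ne, g1 t ht (by omega)]
        intro he
        have e1 := hp.loc_q t ht (by omega)
        have e2 := hp.loc_q i hai hib
        rw [he] at e1
        omega
    · intro v hv
      rw [Function.update_of_ne fun h => hv i hai (by omega) h.symm]
      exact g2 v fun t ht ht' => hv t ht (by omega)
  · rintro h' c' ⟨hF, g1, g2, g3⟩ -
    refine hQ _ _ ((hF1.mono (by decide) (by decide)).trans hF (by decide) (by decide)) ?_ g1 g2 ?_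
    · intro j hj hj'
      rw [hF.arr .h (by decide)]
      exact h11 j hj (by omega)
    · simp
      omega

/-- The program `A` solves all pieces with at most `B` chips within the given bounds. -/
def SolvesPieces (I : Inst V) (A : Prog) (w B : ℕ)
    (tf : (I.G.induce (I.Pᶜ : Set V)).ConnectedComponent → ℕ) (mb : ℕ) : Prop :=
  ∀ g (τ : piece I.G I.P g → ℕ), totalChips τ ≤ B →
    ∀ (n : ℕ) (e : Fin n ≃ piece I.G I.P g) (es : List (piece I.G I.P g × piece I.G I.P g)),
      IsEdgeListing (I.G.induce (piece I.G I.P g)) es →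
      ∃ (out : List ℕ) (t m : ℕ), Returns w A (encode e es τ {v | (v : V) ∈ I.P}) out t m ∧
        IsAnswer (I.G.induce (piece I.G I.P g)) {v | (v : V) ∈ I.P} τ e out ∧ t ≤ tf g ∧ m ≤ mb

/-- Time includes the reading of the input and memory includes its cells. Through this the bounds
for the given algorithm pay for all linear overhead. -/
theorem length_le_of_returns {w : ℕ} {p : Prog} {inp out : List ℕ} {t m : ℕ}
    (h : Returns w p inp out t m) : inp.length ≤ t ∧ inp.length ≤ m := by
  obtain ⟨s, k, _, _, rfl, rfl⟩ := h
  unfold procTime procMem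
  omega

theorem IsPiece.encode_length {W : Set V} {q loc : ℕ → ℕ} {a b : ℕ} (hp : I.IsPiece W q loc a b)
    (τ : W → ℕ) : (encode hp.equiv hp.edges τ {v | (v : V) ∈ I.P}).length =
      2 + 2 * (I.K + (b - a)) + 2 * (IsPiece.pieceDarts I q loc a b).length := by
  rw [hp.encode_eq]
  simp only [List.length_append, List.length_ofFn, List.length_map, List.length_range,
    flatMap_pair_length, List.length_cons, List.length_nil]
  omega

variable [Fintype V]

/-- What a piece with vertices `q a, …, q (b - 1)` contributes. -/
structure Solved (I : Inst V) (x q : ℕ → ℕ) (a b : ℕ) (B : ℕ) (h h' : Store) (F : V → ℕ) :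
    Prop where
  supp : ∀ v, (∀ i, a ≤ i → i < b → I.vt (q i) ≠ v) → F v = 0
  h_eq : ∀ j, 1 ≤ j → j ≤ I.K → h'.arr .h j = h.arr .h j + nbrSum I.G F (I.pv j)
  le : ∀ j, 1 ≤ j → j ≤ I.K → nbrSum I.G F (I.pv j) ≤ B
  fin : ∀ i, a ≤ i → i < b → h'.arr .fin (q i) + deg I.G (I.vt (q i)) * F (I.vt (q i)) =
    I.chips x (I.vt (q i)) + nbrSum I.G F (I.vt (q i))
  fin_le : ∀ i, a ≤ i → i < b → h'.arr .fin (q i) ≤ B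
  old : ∀ v, (∀ i, a ≤ i → i < b → q i ≠ v) → h'.arr .fin v = h.arr .fin v
  least : IsLeast {F' | IsSuper I.G {v | ∃ i, a ≤ i ∧ i < b ∧ I.vt (q i) = v} (I.chips x) F'} F

/-- In the successful case the firing numbers `F` of the component are not stored; only their
effects are, namely the chips received by the removed vertices (in `h`) and the final chips of the
component (in `fin`). -/
theorem vc_onePiece {M : Mach} (hM : M.Valid) (hN : M.N = 2 + 2 * I.n + I.D) {bb B : ℕ}
    {A : Prog} {tf : (I.G.induce (I.Pᶜ : Set V)).ConnectedComponent → ℕ}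
    (hA : I.SolvesPieces A M.w B tf M.b)
    {h : Store} {c : ℕ} {Q : Store → ℕ → Prop} (hr : I.Ready bb h) (hB : B < 2 ^ M.w)
    {cc a b : ℕ} (hcc : h.reg .cc = cc) (hcn : cc < h.reg .nc)
    (ha : h.arr .start cc = a) (hb : h.arr .start (cc + 1) = b)
    {g : (I.G.induce (I.Pᶜ : Set V)).ConnectedComponent}
    (hp : I.IsPiece (piece I.G I.P g) (h.arr .q) (h.arr .loc) a b)
    (hv : ∑ v, I.chips (h.arr .x) v ≤ B)
    (hlt : ∀ j, 1 ≤ j → j ≤ I.K → h.arr .h j + B < 2 ^ M.w)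
    (hQ : ∀ h' c', Frame [.st, .en, .ng, .j, .i, .u, .a, .e, .d, .z, .ep, .len, .ok]
        [.buf, .out, .h, .fin] h h' →
      ((h'.reg .ok = h.reg .ok ∧ ∃ F, I.Solved (h.arr .x) (h.arr .q) a b B h h' F) ∨
        (h'.reg .ok = 0 ∧ (∀ j, h'.arr .h j = h.arr .h j) ∧
          ¬ ∃ F, IsSuper I.G I.Pᶜ (I.chips (h.arr .x)) F)) →
      c' ≤ c + 1000 * tf g + 4 * ∑ i ∈ Finset.Ico a b, I.load (h.arr .q i) → Q h' c') :
    vc M (onePiece A) Q h c := by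
  classical
  have : Fintype (piece I.G I.P g) := Fintype.ofFinite _
  have hal := hM.arr
  have hlit := hM.lit
  have hcl := hp.card_le
  have hab := hp.lt
  have hbn := hp.le
  have hKn := I.K_le
  have hlen := hp.pieceDarts_length
  have hnc := hr.segs.count_le.trans hr.segs.le_n
  set W := piece I.G I.P g with hW
  set x := h.arr .x with hxd
  set q := h.arr .q with hqd
  set loc := h.arr .loc with hlocd
  have hvB : ∀ v, I.chips x v ≤ B := fun v =>
    (Finset.single_le_sum (fun _ _ => Nat.zero_le _) (Finset.mem_univ v)).trans hv
  unfold onePiece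
  simp [hcc, hM.w_ne, ha, hb, hr.k]
  refine ⟨by omega, by omega, by omega, ?_⟩
  have e0 : I.K + b - a = I.K + (b - a) := by omega
  set h1 := ((h.setReg .st a).setReg .en b).setReg .ng (I.K + b - a) with hh1
  have F1 : Frame [.st, .en, .ng] [] h h1 :=
    .setReg (by decide) (.setReg (by decide) (.setReg (by decide) (.refl _ _ _)))
  have hr1 : I.Ready bb h1 := hr.frame F1 (by decide) (by decide)
  refine vc_writeVertices hM hN hr1 hp (by simp [hh1]) (by simp [hh1]) (by simp [hh1, e0])
    (fun v => (hvB v).trans_lt hB) ?_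
  intro h2 c2 F2 b0 b1 b2 hc2
  simp only [hh1, Store.setReg_arr] at b1 hc2
  rw [← hxd, ← hqd] at b1
  rw [← hqd] at hc2
  have hr2 : I.Ready bb h2 := hr1.frame F2 (by decide) (by decide)
  have hq2 : h2.arr .q = q := F2.arr .q (by decide)
  have hl2 : h2.arr .loc = loc := F2.arr .loc (by decide)
  refine vc_writeEdges hM hN hr2 (W := W) (a := a) (b := b) (by rw [hq2, hl2]; exact hp) ?_ ?_ ?_ ?_
  · rw [F2.reg .st (by decide)]; simp [hh1]
  · rw [F2.reg .en (by decide)]; simp [hh1]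
  · rw [F2.reg .ng (by decide)]; simp [hh1, e0]
  intro h3 c3 l F3 hl d1 d2 d3 hc3
  rw [hq2, hl2] at hl
  rw [← hl] at hlen
  rw [hl2] at d3
  rw [hq2] at hc3
  have hep := d3.1
  -- the call
  set τ : W → ℕ := fun v => if (v : V) ∈ I.P then 0 else I.chips x v with hτd
  have hτ : ∀ v : W, (v : V) ∉ I.P → τ v = I.chips x v := fun v hv => by simp [hτd, hv]
  have hτ0 : ∀ v : W, (v : V) ∈ I.P → τ v = 0 := fun v hv => by simp [hτd, hv]
  have hτB : ∑ v, τ v ≤ B := (sum_induce_le hτ hτ0).trans hv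
  obtain ⟨out, t, m, hret, hans, htf, hmb⟩ := hA g τ (by rwa [totalChips_eq_sum]) _ hp.equiv
    hp.edges hp.edges_isListing
  have hil := (length_le_of_returns hret).1
  rw [hp.encode_length, ← hl] at hil
  have henc : (List.range (h3.reg .ep)).map (h3.arr .buf)
      = encode hp.equiv hp.edges τ {v | (v : V) ∈ I.P} := by
    rw [hp.encode_eq, ← hl, ← d3.flatMap, hep, List.range_add, List.map_append, List.map_map]
    congr 1
    rw [show 2 + 2 * (I.K + (b - a)) = 2 + (I.K + (b - a)) + (I.K + (b - a)) by omega,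
      List.range_add, List.range_add, List.map_append, List.map_append, List.map_map, List.map_map]
    congr 1
    · congr 1
      · simp only [List.range_succ, List.range_zero, List.nil_append, List.map_cons,
          List.map_nil, d2, List.cons_append]
        rw [d1 0 (by omega) (by omega), b0]
      · refine List.ext_getElem (by simp) fun i h1 h2 => ?_
        simp only [List.length_map, List.length_range] at h1
        simp only [List.getElem_map, List.getElem_range, Function.comp_apply, List.getElem_ofFn]
        rw [d1 _ (by omega) (by omega), b1 i h1]
        simp only [hτd, hp.equiv_apply, IsPiece.vtx]
        by_cases hi : i < I.K
        · simp [hi, I.pv_mem (show 1 ≤ i + 1 by omega) hi]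
        · simp [hi, hp.q_mem (a + i - I.K) (by omega) (by omega)]
    · refine List.ext_getElem (by simp) fun i h1 h2 => ?_
      simp only [List.length_map, List.length_range] at h1
      simp only [List.getElem_map, List.getElem_range, Function.comp_apply]
      rw [d1 _ (by omega) (by omega), b2 i h1]
  have F13 : Frame [.ep, .j, .i, .u, .a, .e, .d, .z] [.buf] h1 h3 :=
    (F2.mono (by decide) (by decide)).trans F3 (by decide) (by decide)
  have F03 : Frame [.st, .en, .ng, .ep, .j, .i, .u, .a, .e, .d, .z] [.buf] h h3 :=
    (F1.mono (by decide) (by decide)).trans F13 (by decide) (by decide)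
  have hload : ∀ i, 100 ≤ I.load (q i) := fun i => by unfold load; omega
  -- The answer has at most one word per vertex and one more, and no entry exceeds the number of
  -- chips of the piece, so it can be stored.
  have hout : out.length ≤ M.N ∧ ∀ v ∈ out, v < 2 ^ M.w := by
    rcases hans with ⟨ρ, hρ, rfl⟩ | ⟨_, rfl⟩
    · obtain ⟨F, _, _, _, _, hsum⟩ := exists_odometer_induce (σ := I.chips x) hp.closed hτ hτ0 hρ
      refine ⟨by simp; omega, fun v hv => ?_⟩
      rw [List.mem_cons, List.mem_ofFn] at hv
      rcases hv with rfl | ⟨i, rfl⟩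
      · omega
      · exact ((hsum _).trans hv).trans_lt hB
    · exact ⟨by simp; omega, by simp⟩
  refine ⟨out, t, m, by rw [henc]; exact hret, by omega, hout.1, hout.2, hmb, ?_⟩
  set h4 := ((h3.setReg .len (h3.reg .ep)).setArr .out fun i => if i < out.length then out[i]?.getD 0
    else h3.arr .out i).setReg .len out.length with hh4
  have F34 : Frame [.len] [.out] h3 h4 := .setReg (by decide) (.setArr (by decide)
    (.setReg (by decide) (.refl _ _ _)))
  have F04 : Frame [.st, .en, .ng, .ep, .j, .i, .u, .a, .e, .d, .z, .len] [.buf, .out] h h4 :=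
    (F03.mono (by decide) (by decide)).trans F34 (by decide) (by decide)
  have hr4 : I.Ready bb h4 := hr.frame F04 (by decide) (by decide)
  have hq4 : h4.arr .q = q := F04.arr .q (by decide)
  have hl4 : h4.arr .loc = loc := F04.arr .loc (by decide)
  have hh4h : h4.arr .h = h.arr .h := F04.arr .h (by decide)
  have hf4 : h4.arr .fin = h.arr .fin := F04.arr .fin (by decide)
  have ho4 : ∀ i < out.length, h4.arr .out i = out.getD i 0 := by
    intro i hi
    simp [hh4, hi]
  rcases hans with ⟨ρ, hρ, hoe⟩ | ⟨hnt, hoe⟩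
  · obtain ⟨F, s1, s2, s3, s4, s5⟩ :=
      exists_odometer_induce (σ := I.chips x) hp.closed hτ hτ0 hρ
    have hWP : (W \ I.P) = {v | ∃ i, a ≤ i ∧ i < b ∧ I.vt (q i) = v} := by
      ext v
      rw [Set.mem_sdiff, hp.mem]
      constructor
      · rintro ⟨h | h, h'⟩
        · exact absurd h h'
        · exact h
      · rintro ⟨i, h1, h2, rfl⟩
        exact ⟨Or.inr ⟨i, h1, h2, rfl⟩, hp.q_mem i h1 h2⟩
    have hρB : ∀ v, ρ v ≤ B := fun v => (s5 v).trans hv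
    have hol : out.length = 1 + (I.K + (b - a)) := by rw [hoe]; simp; omega
    have hor : ∀ i (hi : i < I.K + (b - a)), h4.arr .out (1 + i) = ρ (hp.equiv ⟨i, hi⟩) := by
      intro i hi
      rw [ho4 _ (by omega), hoe, Nat.add_comm 1 i, List.getD_cons_succ]
      simp [hi]
    have hoh : ∀ j, 1 ≤ j → j ≤ I.K → h4.arr .out j = nbrSum I.G F (I.pv j) := by
      intro j hj hjK
      have := hor (j - 1) (by omega)
      have e : (hp.equiv ⟨j - 1, by omega⟩ : V) = I.pv j := by
        rw [hp.equiv_apply, IsPiece.vtx, if_pos (by simp only; omega)]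
        congr 1
        simp only
        omega
      rw [show 1 + (j - 1) = j by omega, s2 _ (by rw [e]; exact I.pv_mem hj hjK), e] at this
      exact this
    have hoB : ∀ j, 1 ≤ j → j ≤ I.K → h4.arr .out j ≤ B := by
      intro j hj hjK
      have := hor (j - 1) (by omega)
      rw [show 1 + (j - 1) = j by omega] at this
      rw [this]
      exact hρB _
    refine vc_collect hM hN hr4 (W := W) (a := a) (b := b) (by rw [hq4, hl4]; exact hp) ?_ ?_ ?_ ?_
      ?_
    · rw [F34.reg .st (by decide), F13.reg .st (by decide)]; simp [hh1]
    · rw [F34.reg .en (by decide), F13.reg .en (by decide)]; simp [hh1]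
    · rw [ho4 0 (by omega), hoe]; simp
    · intro j hj hjK
      rw [hh4h]
      have := hoB j hj hjK
      have := hlt j hj hjK
      omega
    intro h5 c5 F5 k1 k2 k3 hc5
    rw [hq4] at k2 k3
    have kfin : ∀ i (_ : a ≤ i) (_ : i < b), ∃ v : W, (v : V) = I.vt (q i) ∧
        h5.arr .fin (q i) = ρ v := by
      intro i hi hi'
      refine ⟨hp.equiv ⟨I.K + i - a, by omega⟩, ?_, ?_⟩
      · rw [hp.equiv_apply, IsPiece.vtx, if_neg (by simp only; omega)]
        congr 2
        simp only
        omega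
      · rw [k2 i hi hi', hor]
    refine hQ _ _ ((F04.mono (by decide) (by decide)).trans F5 (by decide) (by decide))
      (Or.inl ⟨?_, F, ?_⟩) ?_
    · rw [F5.reg .ok (by decide), F04.reg .ok (by decide)]
    · constructor
      · intro v hv
        refine s1 v ?_
        rw [hWP]
        rintro ⟨i, e1, e2, e3⟩
        exact hv i e1 e2 e3
      · intro j hj hjK
        rw [k1 j hj hjK, hh4h, hoh j hj hjK]
      · intro j hj hjK
        rw [← hoh j hj hjK]
        exact hoB j hj hjK
      · intro i hi hi'
        obtain ⟨v, e1, e2⟩ := kfin i hi hi'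
        rw [e2, ← e1]
        exact s3 v (by rw [e1]; exact hp.q_mem i hi hi')
      · intro i hi hi'
        obtain ⟨v, e1, e2⟩ := kfin i hi hi'
        rw [e2]
        exact hρB v
      · intro v hv
        rw [k3 v hv, hf4]
      · rw [← hWP]
        exact s4
    · omega
  · unfold collect
    simp only [vc, Exp.ok, Exp.val, Exp.cost]
    have ho0 : h4.arr .out 0 = 0 := by rw [ho4 0 (by rw [hoe]; simp), hoe]; simp
    refine ⟨⟨by omega, by omega⟩, fun hz => absurd ho0 hz, fun _ => ⟨by omega, ?_⟩⟩
    refine hQ _ _ (.setReg (by decide) (F04.mono (by decide) (by decide))) (Or.inr ⟨by simp, ?_, ?_⟩)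
      ?_
    · simp [hh4h]
    -- A function that stabilizes everything outside the removed set would in particular make this
    -- piece terminate.
    · rintro ⟨F, hF⟩
      exact hnt (terminates_induce (σ := I.chips x) hp.closed hτ (hF.mono fun v hv => hv.2))
    · omega

end Inst

end Sandpile

/-! ### All pieces for fixed firing numbers of the removed vertices -/

namespace Sandpile

open WordRAM Cmd

set_option linter.constructorNameAsVariable false

attribute [local simp] Cmd.vc Exp.ok Exp.val Exp.cost

attribute [local irreducible] Cmd.gather Cmd.onePiece Cmd.forr

namespace Inst

variable {V : Type u} {I : Inst V}

/-- The components in the order of their segments of the queue. -/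
def Comps (I : Inst V) (gs : ℕ → (I.G.induce (I.Pᶜ : Set V)).ConnectedComponent) (h : Store) :
    Prop :=
  ∀ c < h.reg .nc, ∀ v < I.n, (∃ i, h.arr .start c ≤ i ∧ i < h.arr .start (c + 1) ∧ h.arr .q i = v) ↔
      ∃ hv : I.vt v ∈ I.Pᶜ, (I.G.induce I.Pᶜ).connectedComponentMk ⟨I.vt v, hv⟩ = gs c

theorem Comps.frame {gs : ℕ → (I.G.induce (I.Pᶜ : Set V)).ConnectedComponent} {h h' : Store}
    {R : List Reg} {A : List Arr} (hg : I.Comps gs h) (hF : Frame R A h h') (hR : Reg.nc ∉ R)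
    (hA : Arr.start ∉ A) (hA' : Arr.q ∉ A) : I.Comps gs h' := by
  unfold Comps
  rw [hF.reg _ hR, hF.arr _ hA, hF.arr _ hA']
  exact hg

theorem notMem_P_iff {v : V} : v ∉ I.P ↔ ∀ i, 1 ≤ i → i < I.K + 1 → v ≠ I.pv i := by
  constructor
  · rintro hv i hi hiK rfl
    exact hv (I.pv_mem hi (by omega))
  · intro h hv
    obtain ⟨j, hj, hjK, rfl⟩ := I.exists_pv hv
    exact h j hj (by omega) rfl

variable [Fintype V]

/-- The pieces from the first `m` positions of the queue `q` are stabilized. -/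
structure Partial (I : Inst V) (x q : ℕ → ℕ) (m B : ℕ) (h : Store) (F : V → ℕ) : Prop where
  supp : ∀ v, (∀ i < m, I.vt (q i) ≠ v) → F v = 0
  h_eq : ∀ j, 1 ≤ j → j ≤ I.K → h.arr .h j = I.chips x (I.pv j) + nbrSum I.G F (I.pv j)
  fin : ∀ i < m, h.arr .fin (q i) + deg I.G (I.vt (q i)) * F (I.vt (q i)) =
    I.chips x (I.vt (q i)) + nbrSum I.G F (I.vt (q i))
  fin_le : ∀ i < m, h.arr .fin (q i) ≤ B
  least : IsLeast {F' | IsSuper I.G {v | ∃ i < m, I.vt (q i) = v} (I.chips x) F'} F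

/-- Different components are not adjacent. The new firing numbers change nothing at the vertices
treated before, and the least functions combine by `isLeast_isSuper_union`. -/
theorem Partial.step {x q : ℕ → ℕ} {a b B L : ℕ} {h h' : Store} {F F' : V → ℕ}
    (hF : I.Partial x q a B h F) (hF' : I.Solved x q a b B h h' F')
    (hinj : ∀ i < L, ∀ j < L, q i = q j → i = j) (hn : ∀ i < L, q i < I.n) (hab : a ≤ b)
    (hb : b ≤ L)
    (hadj : ∀ i < a, ∀ j, a ≤ j → j < b → ¬ I.G.Adj (I.vt (q i)) (I.vt (q j))) :
    I.Partial x q b B h' (F + F') := by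
  have hne : ∀ i < a, ∀ j, a ≤ j → j < b → I.vt (q i) ≠ I.vt (q j) := by
    intro i hi j hj hj' he
    have := hinj i (by omega) j (by omega) (I.vt_inj (hn i (by omega)) (hn j (by omega)) he)
    omega
  have e1 : ∀ i < a, F' (I.vt (q i)) = 0 ∧ nbrSum I.G F' (I.vt (q i)) = 0 := by
    intro i hi
    refine ⟨hF'.supp _ fun j hj hj' => (hne i hi j hj hj').symm, nbrSum_eq_zero fun w hw => ?_⟩
    refine hF'.supp _ fun j hj hj' he => ?_
    subst he
    exact hadj i hi j hj hj' hw
  have e2 : ∀ j, a ≤ j → j < b → F (I.vt (q j)) = 0 ∧ nbrSum I.G F (I.vt (q j)) = 0 := by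
    intro j hj hj'
    refine ⟨hF.supp _ fun i hi => hne i hi j hj hj', nbrSum_eq_zero fun w hw => ?_⟩
    refine hF.supp _ fun i hi he => ?_
    subst he
    exact hadj i hi j hj hj' hw.symm
  constructor
  · intro v hv
    rw [Pi.add_apply, hF.supp v fun i hi => hv i (by omega), hF'.supp v fun i _ hi => hv i hi]
  · intro j hj hjK
    rw [hF'.h_eq j hj hjK, hF.h_eq j hj hjK, nbrSum_add]
    omega
  · intro i hi
    rw [nbrSum_add, Pi.add_apply]
    by_cases hia : i < a
    · rw [(e1 i hia).1, (e1 i hia).2, hF'.old, add_zero, add_zero, hF.fin i hia]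
      intro j hj hj' he
      exact hne i hia j hj hj' (by rw [he])
    · rw [(e2 i (by omega) hi).1, (e2 i (by omega) hi).2, zero_add, zero_add,
        hF'.fin i (by omega) hi]
  · intro i hi
    by_cases hia : i < a
    · rw [hF'.old]
      · exact hF.fin_le i hia
      · intro j hj hj' he
        exact hne i hia j hj hj' (by rw [he])
    · exact hF'.fin_le i (by omega) hi
  · have hset : {v | ∃ i < b, I.vt (q i) = v} =
        {v | ∃ i < a, I.vt (q i) = v} ∪ {v | ∃ i, a ≤ i ∧ i < b ∧ I.vt (q i) = v} := by
      ext v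
      constructor
      · rintro ⟨i, hi, he⟩
        by_cases hia : i < a
        · exact Or.inl ⟨i, hia, he⟩
        · exact Or.inr ⟨i, by omega, hi, he⟩
      · rintro (⟨i, hi, he⟩ | ⟨i, hi, hi', he⟩)
        · exact ⟨i, by omega, he⟩
        · exact ⟨i, hi', he⟩
    rw [hset]
    refine isLeast_isSuper_union ?_ ?_ hF.least hF'.least ?_ ?_
    · rw [Set.disjoint_left]
      rintro v ⟨i, hi, rfl⟩ ⟨j, hj, hj', he⟩
      exact hne i hi j hj hj' he.symm
    · rintro v ⟨i, hi, rfl⟩ w ⟨j, hj, hj', rfl⟩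
      exact hadj i hi j hj hj'
    · intro v hv
      exact hF.supp v fun i hi he => hv ⟨i, hi, he⟩
    · intro v hv
      exact hF'.supp v fun i hi hi' he => hv ⟨i, hi, hi', he⟩

/-- The contents after the stabilization of all pieces. -/
structure Leaf (I : Inst V) (x : ℕ → ℕ) (h : Store) (u : V → ℕ) : Prop where
  least : ∀ X, IsLeast (levelSet I.G I.σ I.pv I.K X (I.K + 1) x) u
  h_eq : ∀ j, 1 ≤ j → j ≤ I.K → h.arr .h j = I.σ (I.pv j) + nbrSum I.G u (I.pv j)
  fin : ∀ v < I.n, I.vt v ∉ I.P → h.arr .fin v + deg I.G (I.vt v) * u (I.vt v) =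
    I.σ (I.vt v) + nbrSum I.G u (I.vt v)

/-- At the last level all numbers on the removed set are prescribed, so subtracting them turns
candidates into functions stabilizing the rest. No number is left for the cap to bound, hence every
`X` is allowed. -/
theorem Partial.leaf {x q : ℕ → ℕ} {B L : ℕ} {h : Store} {F : V → ℕ}
    (hF : I.Partial x q L B h F) (hP : ∀ i < L, I.vt (q i) ∉ I.P)
    (hall : ∀ v < I.n, I.vt v ∉ I.P → ∃ i < L, q i = v) :
    I.Leaf x h (I.ext x + F) := by
  have hset : {v | ∃ i < L, I.vt (q i) = v} = I.Pᶜ := by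
    ext v
    constructor
    · rintro ⟨i, hi, rfl⟩
      exact hP i hi
    · intro hv
      obtain ⟨i, hi, he⟩ := hall _ (I.ix_lt v) (by rw [I.vt_ix]; exact hv)
      exact ⟨i, hi, by rw [he, I.vt_ix]⟩
  have hleast := hF.least
  rw [hset] at hleast
  have hF0 : ∀ v ∈ I.P, F v = 0 := fun v hv => hF.supp v fun i hi he => hP i hi (he ▸ hv)
  refine ⟨fun X => ⟨⟨fun i hi hiK => ?_, fun v hv => ?_, fun i hi hi' => by omega⟩, ?_⟩, ?_, ?_⟩
  · rw [Pi.add_apply, I.ext_pv x hi (by omega), hF0 _ (I.pv_mem hi (by omega)), add_zero]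
  · have hv := notMem_P_iff.2 hv
    have := hleast.1 v hv
    rw [nbrSum_add, Pi.add_apply, I.ext_of_notMem x hv, zero_add, ← add_assoc]
    exact this
  · intro u hu
    set F' : V → ℕ := fun v => u v - I.ext x v with hF'
    have he : I.ext x + F' = u := by
      funext v
      by_cases hv : v ∈ I.P
      · obtain ⟨j, hj, hjK, rfl⟩ := I.exists_pv hv
        have := hu.1 j hj (by omega)
        simp [hF', I.ext_pv x hj hjK, this]
      · simp [hF', I.ext_of_notMem x hv]
    have hsup : IsSuper I.G I.Pᶜ (I.chips x) F' := by
      intro v hv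
      have := hu.2.1 v (notMem_P_iff.1 hv)
      rw [← he, nbrSum_add, Pi.add_apply, I.ext_of_notMem x hv, zero_add, ← add_assoc] at this
      exact this
    rw [← he]
    exact add_le_add_right (hleast.2 hsup) _
  · intro j hj hjK
    rw [hF.h_eq j hj hjK, nbrSum_add, chips, add_assoc]
  · intro v hv hvP
    obtain ⟨i, hi, rfl⟩ := hall v hv hvP
    rw [nbrSum_add, Pi.add_apply, I.ext_of_notMem x hvP, zero_add, hF.fin i hi, chips, add_assoc]

/-- The registers used by `leaf`. -/
def leafRegs : List Reg := [.ok, .cc, .st, .en, .ng, .j, .i, .u, .a, .e, .d, .z, .ep, .len]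

theorem vc_leaf {M : Mach} (hM : M.Valid) (hN : M.N = 2 + 2 * I.n + I.D) {bb B : ℕ}
    {A : Prog} {tf : (I.G.induce (I.Pᶜ : Set V)).ConnectedComponent → ℕ}
    (hA : I.SolvesPieces A M.w B tf M.b) {gs : ℕ → (I.G.induce (I.Pᶜ : Set V)).ConnectedComponent}
    {h : Store} {c : ℕ} {Q : Store → ℕ → Prop} (hr : I.Ready bb h) (hg : I.Comps gs h)
    (hB : (I.n + 2) * B < 2 ^ M.w) (hv : ∑ v, I.chips (h.arr .x) v ≤ B)
    (hQ : ∀ h' c', Frame leafRegs [.buf, .out, .h, .fin] h h' →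
      (∀ j, 1 ≤ j → j ≤ I.K → h'.arr .h j < 2 ^ M.w) →
      ((h'.reg .ok = 1 ∧ ∃ u, I.Leaf (h.arr .x) h' u) ∨
        (h'.reg .ok = 0 ∧ ¬ ∃ F, IsSuper I.G I.Pᶜ (I.chips (h.arr .x)) F)) →
      c' ≤ c + 1000 * ∑ t ∈ Finset.range (h.reg .nc), tf (gs t) + 1000 * (I.n + I.D + 1) → Q h' c') :
    vc M (leaf A) Q h c := by
  have hal := hM.arr
  have hlit := hM.lit
  have hKn := I.K_le
  have hs := hr.segs
  have hncL := hs.count_le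
  have hLn := hs.le_n
  have hB1 : B < 2 ^ M.w := lt_of_le_of_lt (Nat.le_mul_of_pos_left _ (by omega)) hB
  have hvB : ∀ v, I.chips (h.arr .x) v ≤ B := fun v =>
    (Finset.single_le_sum (fun _ _ => Nat.zero_le _) (Finset.mem_univ v)).trans hv
  have hrd : ∀ h', Frame leafRegs [.buf, .out, .h, .fin] h h' → I.Ready bb h' := fun h' hF =>
    hr.frame hF (by decide) (by decide)
  unfold leaf
  simp [hM.w_ne]
  refine vc_forr hM (fun j h' c' => Frame leafRegs [.buf, .out, .h, .fin] h h' ∧ h'.reg .ok = 1 ∧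
    (∀ i, 1 ≤ i → i < j → h'.arr .h i = I.chips (h.arr .x) (I.pv i)) ∧
    c' ≤ c + 10 + 40 * j + ∑ i ∈ Finset.Ico 1 j, I.load (I.pnum i)) 1 (I.K + 1)
    (by simp [hM.w_ne]) rfl (by omega) (hM.lt (by omega)) ?_ ?_ ?_ ?_
  · exact ⟨.setReg (by decide) (.setReg (by decide) (.refl _ _ _)), by simp,
      fun i hi hi' => by omega, by simp⟩
  · rintro i h' c' _ ⟨hF, _⟩
    have := (hrd _ hF).k
    simp [this, hM.w_ne]
    omega
  · rintro j h' c' hj hjK ⟨hF, h1, h2, h3⟩ hx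
    have hpl := (hrd _ hF).pl j hj (by omega)
    obtain ⟨p1, p2, p3⟩ := I.pnum_spec hj (show j ≤ I.K by omega)
    have hxx := hF.arr .x (by decide)
    simp [hx, hpl]
    refine ⟨by omega, ?_⟩
    have hF' : Frame leafRegs [.buf, .out, .h, .fin] h (h'.setReg .u (I.pnum j)) :=
      .setReg (by decide) hF
    refine I.vc_gather hM hN (hrd _ hF') (u0 := I.pnum j) (by simp) p1
      (by rw [Store.setReg_arr, hxx]; exact (hvB _).trans_lt hB1) ?_
    intro h'' c'' F'' ha hc
    rw [Store.setReg_arr, hxx] at ha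
    have hF'' := hF'.trans F'' (by decide) (by decide)
    have hj'' : h''.reg .j = j := by rw [F''.reg .j (by decide)]; simpa using hx
    have hh'' : h''.arr .h = h'.arr .h := by rw [F''.arr .h (by decide)]; simp
    simp [hj'', ha, hh'']
    refine ⟨by omega, .setReg (by decide) (.setArr (by decide) hF''), ?_, ?_, ?_⟩
    · rw [F''.reg .ok (by decide)]; simpa using h1
    · intro i hi hi'
      by_cases hij : i = j
      · simp [hij, pv]
      · rw [Function.update_of_ne hij, h2 i hi (by omega)]
    · rw [Finset.sum_Ico_succ_top hj]
      omega
  rintro h1 c1 ⟨F1, h11, h12, h13⟩ -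
  have hsum1 : ∑ i ∈ Finset.Ico 1 (I.K + 1), I.load (I.pnum i) ≤ 100 * I.n + 100 * I.D := by
    rw [Finset.sum_Ico_eq_sum_range]
    refine I.sum_load_le (q := fun i => I.pnum (1 + i)) (fun i hi => ?_) fun i hi j hj he => ?_
    · exact (I.pnum_spec (by omega) (by omega)).1
    · have e1 := (I.pnum_spec (show 1 ≤ 1 + i by omega) (by omega)).2.2
      have e2 := (I.pnum_spec (show 1 ≤ 1 + j by omega) (by omega)).2.2
      rw [he] at e1
      omega
  have hsum2 := I.sum_load_le (fun i hi => (hs.mem i hi).1) hs.inj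
  set q := h.arr .q with hq
  set s := h.arr .start with hsd
  set x := h.arr .x with hxd
  -- Each piece raises an entry of `h` by at most `B`, which explains the bound `(1 + cc) * B`. Once
  -- `ok` is `0` it stays so, and the remaining pieces are still processed.
  refine vc_forr hM (fun cc h' c' => Frame leafRegs [.buf, .out, .h, .fin] h h' ∧
    (∀ j, 1 ≤ j → j ≤ I.K → h'.arr .h j ≤ (1 + cc) * B) ∧
    ((h'.reg .ok = 1 ∧ ∃ F, I.Partial x q (s cc) B h' F) ∨
      (h'.reg .ok = 0 ∧ ¬ ∃ F, IsSuper I.G I.Pᶜ (I.chips x) F)) ∧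
    c' ≤ c + 200 + 40 * I.K + 100 * I.n + 100 * I.D + 10 * cc +
      1000 * ∑ t ∈ Finset.range cc, tf (gs t) + 4 * ∑ i ∈ Finset.range (s cc), I.load (q i)) 0
    (h.reg .nc) (by simp) rfl (Nat.zero_le _) (hM.lt (by omega)) ?_ ?_ ?_ ?_
  · refine ⟨.setReg (by decide) F1, ?_, Or.inl ⟨by simpa using h11, 0, ?_⟩, ?_⟩
    · intro j hj hjK
      rw [Store.setReg_arr, h12 j hj (by omega)]
      simpa using hvB _
    · constructor
      · intro v _; rfl
      · intro j hj hjK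
        rw [Store.setReg_arr, h12 j hj (by omega), nbrSum_eq_zero]
        · rfl
        · intro _ _; rfl
      · intro i hi; rw [hs.zero] at hi; omega
      · intro i hi; rw [hs.zero] at hi; omega
      · refine ⟨?_, fun F _ v => Nat.zero_le _⟩
        rintro v ⟨i, hi, _⟩
        rw [hs.zero] at hi
        omega
    · rw [hs.zero]
      simp only [Finset.range_zero, Finset.sum_empty, Exp.cost]
      omega
  · rintro i h' c' _ ⟨hF, _⟩
    simp [hF.reg .nc (by decide)]
  · rintro cc h' c' _ hcc ⟨hF, g1, g2, g3⟩ hx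
    have hq' : h'.arr .q = q := hF.arr .q (by decide)
    have hl' : h'.arr .loc = h.arr .loc := hF.arr .loc (by decide)
    have hs' : h'.arr .start = s := hF.arr .start (by decide)
    have hx' : h'.arr .x = x := hF.arr .x (by decide)
    have hnc' : h'.reg .nc = h.reg .nc := hF.reg .nc (by decide)
    have hp := hs.isPiece hcc (hg cc hcc)
    have hsl := hs.le_last (show cc + 1 ≤ h.reg .nc from hcc)
    have hmul : (1 + cc) * B + B ≤ (I.n + 2) * B := by
      rw [← Nat.succ_mul]
      exact Nat.mul_le_mul_right _ (by omega)
    refine vc_onePiece hM hN hA (hrd _ hF) hB1 hx (by omega) (congrFun hs' _) (congrFun hs' _)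
      (g := gs cc) (by rw [hq', hl']; exact hp) (by rw [hx']; exact hv) ?_ ?_
    · intro j hj hjK
      have := g1 j hj hjK
      omega
    intro h'' c'' F'' hres hc
    rw [hq', hx'] at hres
    rw [hq'] at hc
    have hok : ∀ j, 1 ≤ j → j ≤ I.K → h''.arr .h j ≤ h'.arr .h j + B := by
      intro j hj hjK
      rcases hres with ⟨_, F, hF⟩ | ⟨_, he, _⟩
      · rw [hF.h_eq j hj hjK]
        have := hF.le j hj hjK
        omega
      · rw [he]
        omega
    refine ⟨(F''.reg .cc (by decide)).trans hx, .setReg (by decide)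
      (hF.trans F'' (by decide) (by decide)), ?_, ?_, ?_⟩
    · intro j hj hjK
      have e1 := hok j hj hjK
      have e2 := g1 j hj hjK
      rw [Store.setReg_arr, show 1 + (cc + 1) = (1 + cc) + 1 by omega, Nat.succ_mul]
      omega
    · simp only [Store.setReg_reg, reduceCtorEq, if_false]
      rcases g2 with ⟨ok1, F, hF1⟩ | ⟨ok0, hno⟩
      · rcases hres with ⟨ok2, F', hF2⟩ | ⟨ok0, _, hno⟩
        · left
          have hst := hF1.step hF2 (L := h.reg .qt) hs.inj (fun i hi => (hs.mem i hi).1) hp.lt.le hsl ?_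
          · refine ⟨ok2.trans ok1, F + F', ?_⟩
            obtain ⟨a1, a2, a3, a4, a5⟩ := hst
            exact ⟨a1, a2, a3, a4, a5⟩
          · intro i hi j hj hj' hadj
            have h1 := hp.closed _ (hp.q_memW hj hj') (hp.q_mem j hj hj') _ hadj.symm
            have hib : i < h.reg .qt := by omega
            rcases (hp.mem _).1 h1 with h2 | ⟨i', hi1, hi2, he⟩
            · exact (hs.mem i hib).2.1 h2
            · have := hs.inj i' (by omega) i hib (I.vt_inj (hs.mem i' (by omega)).1 (hs.mem i hib).1 he)
              omega
        · exact Or.inr ⟨ok0, hno⟩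
      · rcases hres with ⟨ok2, _⟩ | ⟨ok2, _⟩
        · exact Or.inr ⟨ok2.trans ok0, hno⟩
        · exact Or.inr ⟨ok2, hno⟩
    · rw [Finset.sum_range_succ, ← Finset.sum_range_add_sum_Ico _ hp.lt.le]
      simp only [Exp.cost] at hc
      omega
  · rintro h' c' ⟨hF, g1, g2, g3⟩ hx
    refine hQ _ _ hF ?_ ?_ ?_
    · intro j hj hjK
      have hmul : (1 + h.reg .nc) * B ≤ (I.n + 2) * B := Nat.mul_le_mul_right _ (by omega)
      have := g1 j hj hjK
      omega
    · rcases g2 with ⟨ok1, F, hF1⟩ | hno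
      · refine Or.inl ⟨ok1, _, Partial.leaf (L := h.reg .qt) (B := B) (q := q) (F := F) ?_
          (fun i hi => (hs.mem i hi).2.1) fun v hv hP => hs.vis v hv hP (hr.loc v hv)⟩
        rw [← hs.last]
        exact hF1
      · exact Or.inr hno
    · rw [hs.last] at g3
      simp
      omega

end Inst

end Sandpile

/-! ### The invariant of the nested search and the ascent to an unfinished level -/

namespace Sandpile

open WordRAM Cmd

set_option linter.constructorNameAsVariable false

attribute [local simp] Cmd.vc Exp.ok Exp.val Exp.cost

attribute [local irreducible] Cmd.leaf Cmd.reset Cmd.need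

/-- The value of the digits `r 1, …, r k` in base `b + 2`. -/
def digits (b : ℕ) (r : ℕ → ℕ) : ℕ → ℕ
  | 0 => 0
  | k + 1 => digits b r k * (b + 2) + r (k + 1)

/-- All digits maximal: the search starts at this value, and adding the final evaluation gives `(b +
2) ^ k` rounds. -/
theorem digits_full {b k : ℕ} {r : ℕ → ℕ} (h : ∀ j, 1 ≤ j → j ≤ k → r j = b + 1) :
    digits b r k + 1 = (b + 2) ^ k := by
  induction k with
  | zero => rfl
  | succ k ih =>
    rw [digits, h _ (by omega) le_rfl, pow_succ, ← ih fun j hj hjk => h j hj (by omega)]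
    ring

theorem digits_congr {b k : ℕ} {r r' : ℕ → ℕ} (h : ∀ j, 1 ≤ j → j ≤ k → r j = r' j) :
    digits b r k = digits b r' k := by
  induction k with
  | zero => rfl
  | succ k ih =>
    rw [digits, digits, h _ (by omega) le_rfl, ih fun j hj hjk => h j hj (by omega)]

/-- Subtraction of one with borrowing. One step at level `j` lowers its digit and resets the
exhausted deeper levels from `0` to the largest digit. -/
theorem digits_pred {b k j : ℕ} {r r' : ℕ → ℕ} (hj : 1 ≤ j) (hjk : j ≤ k)
    (hlt : ∀ i, 1 ≤ i → i < j → r' i = r i) (hr : r' j + 1 = r j)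
    (hgt : ∀ i, j < i → i ≤ k → r i = 0 ∧ r' i = b + 1) :
    digits b r' k + 1 = digits b r k := by
  induction k with
  | zero => omega
  | succ k ih =>
    rw [digits, digits]
    rcases Nat.eq_or_lt_of_le hjk with rfl | h
    · rw [digits_congr fun i hi hik => hlt i hi (by omega), ← hr]
      omega
    · obtain ⟨h1, h2⟩ := hgt (k + 1) h le_rfl
      rw [h1, h2, ← ih (by omega) fun i hi hik => hgt i hi (by omega)]
      ring

namespace Inst

variable {V : Type u} {I : Inst V} [Fintype V]

/-- The state of the nested search: at level `j` the sought number lies in the interval of length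
`2 ^ r j` from `cnt j` on. -/
structure Search (I : Inst V) (b : ℕ) (r : ℕ → ℕ) (h : Store) : Prop where
  sent : h.arr .pwr 0 = 1
  pwr : ∀ j, 1 ≤ j → j ≤ I.K → h.arr .pwr j = 2 ^ r j / 2
  x : ∀ j, 1 ≤ j → j ≤ I.K → h.arr .x j =
    if r j = 0 then h.arr .cnt j else h.arr .cnt j + h.arr .pwr j - 1
  le : ∀ j, 1 ≤ j → j ≤ I.K → h.arr .cnt j + 2 ^ r j ≤ 2 ^ (b + 1)
  inv : ∀ j, 1 ≤ j → j ≤ I.K → ∀ m,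
    IsLeast (levelSet I.G I.σ I.pv I.K (2 ^ (b + 1)) j (h.arr .x)) m →
    h.arr .cnt j ≤ m (I.pv j) ∧ m (I.pv j) < h.arr .cnt j + 2 ^ r j

theorem two_pow_div_two {r : ℕ} (hr : r ≠ 0) : 2 ^ r / 2 = 2 ^ (r - 1) := by
  obtain ⟨s, rfl⟩ := Nat.exists_eq_succ_of_ne_zero hr
  simp [pow_succ]

theorem two_mul_two_pow {r : ℕ} (hr : r ≠ 0) : 2 ^ r = 2 * 2 ^ (r - 1) := by
  obtain ⟨s, rfl⟩ := Nat.exists_eq_succ_of_ne_zero hr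
  simp [pow_succ, mul_comm]

theorem Search.pwr_eq_zero {b : ℕ} {r : ℕ → ℕ} {h : Store} (hs : I.Search b r h) {j : ℕ}
    (hj : 1 ≤ j) (hjK : j ≤ I.K) : h.arr .pwr j = 0 ↔ r j = 0 := by
  rw [hs.pwr j hj hjK]
  by_cases h0 : r j = 0
  · simp [h0]
  · rw [two_pow_div_two h0]
    simp [h0]

theorem Search.x_lt {b : ℕ} {r : ℕ → ℕ} {h : Store} (hs : I.Search b r h) {j : ℕ}
    (hj : 1 ≤ j) (hjK : j ≤ I.K) : h.arr .x j < 2 ^ (b + 1) := by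
  have h1 := hs.x j hj hjK
  have h2 := hs.le j hj hjK
  have h3 := hs.pwr j hj hjK
  have h4 : 0 < 2 ^ r j := by positivity
  split_ifs at h1 <;> omega

theorem Search.frame {b : ℕ} {r : ℕ → ℕ} {h h' : Store} {R : List Reg} {A : List Arr}
    (hs : I.Search b r h) (hF : Frame R A h h') (hA : ∀ a ∈ [Arr.cnt, .pwr, .x], a ∉ A) :
    I.Search b r h' := by
  obtain ⟨h1, h2, h3, h4, h5⟩ := hs
  have e1 := hF.arr _ (hA .cnt (by decide))
  have e2 := hF.arr _ (hA .pwr (by decide))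
  have e3 := hF.arr _ (hA .x (by decide))
  constructor <;> simp only [e1, e2, e3] <;> assumption

/-- Levels whose search is at its start satisfy the invariant. -/
theorem Search.of_fresh {b : ℕ} {h : Store} (hf : I.Fresh b 1 h) :
    I.Search b (fun _ => b + 1) h := by
  refine ⟨hf.sent, fun j hj hjK => ?_, fun j hj hjK => ?_, fun j hj hjK => ?_,
    fun j hj hjK m hm => ?_⟩
  · rw [hf.pwr j hj hjK, two_pow_div_two (by omega), Nat.add_sub_cancel]
  · rw [hf.pwr j hj hjK, hf.cnt j hj hjK, hf.x j hj hjK]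
    simp
  · rw [hf.cnt j hj hjK, zero_add]
  · rw [hf.cnt j hj hjK, zero_add]
    exact ⟨Nat.zero_le _, hm.1.2.2 j le_rfl hjK⟩

/-- The violations of the prescribed values at the levels above `j` decide whether the search
problem at level `j + 1` has a solution. -/
theorem Search.climb {b : ℕ} {r : ℕ → ℕ} {h : Store} {u : V → ℕ} (hs : I.Search b r h)
    (hu : IsLeast (levelSet I.G I.σ I.pv I.K (2 ^ (b + 1)) (I.K + 1) (h.arr .x)) u) {j : ℕ}
    (hjK : j ≤ I.K) (hr : ∀ i, j < i → i ≤ I.K → r i = 0) :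
    ((levelSet I.G I.σ I.pv I.K (2 ^ (b + 1)) (j + 1) (h.arr .x)).Nonempty →
      IsLeast (levelSet I.G I.σ I.pv I.K (2 ^ (b + 1)) (j + 1) (h.arr .x)) u) ∧
    (u ∈ levelSet I.G I.σ I.pv I.K (2 ^ (b + 1)) (j + 1) (h.arr .x) ↔
      ∀ i, j < i → i ≤ I.K → IsSat I.G I.σ u (I.pv i)) := by
  induction hd : I.K - j generalizing j with
  | zero =>
    obtain rfl : j = I.K := by omega
    exact ⟨fun _ => hu, fun _ i hi hi' => by omega, fun _ => hu.1⟩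
  | succ d ih =>
    obtain ⟨ih1, ih2⟩ := ih (j := j + 1) (by omega) (fun i hi hi' => hr i (by omega) hi')
      (by omega)
    have hpv : ∀ i j, 1 ≤ i → i < j → j ≤ I.K → I.pv i ≠ I.pv j := fun i j hi hij hj =>
      I.pv_ne hi hij hj
    have hr0 := hr (j + 1) (by omega) (by omega)
    -- At a finished level the interval has length one, so the guess is the optimal value.
    have hx : ∀ m, IsLeast (levelSet I.G I.σ I.pv I.K (2 ^ (b + 1)) (j + 1) (h.arr .x)) m →
        m (I.pv (j + 1)) = h.arr .x (j + 1) := by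
      intro m hm
      have h1 := hs.inv (j + 1) (by omega) (by omega) m hm
      have h2 := hs.x (j + 1) (by omega) (by omega)
      rw [if_pos hr0] at h2
      rw [hr0, pow_zero] at h1
      omega
    have hdes := levelSet_descend (by omega) (show j + 1 ≤ I.K by omega) hpv ih1 hx
    refine ⟨hdes, fun hmem i hi hi' => ?_, fun hsat => ?_⟩
    · have hl := hdes ⟨u, hmem⟩
      rcases Nat.eq_or_lt_of_le (Nat.succ_le_of_lt hi) with rfl | h'
      · exact hmem.2.1 _ fun i hi hij => (hpv i _ hi hij (by omega)).symm
      · exact ih2.1 (levelSet_succ_of_eq hmem (hx u hl)) i h' hi'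
    · exact levelSet_of_succ (hs.x_lt (by omega) (by omega)) (by omega)
        (ih2.2 fun i hi hi' => hsat i (by omega) hi') (hsat _ (by omega) (by omega))

/-- The words are long enough for the numbers that occur in the search. -/
structure Bounds (I : Inst V) (M : Mach) (b B : ℕ) : Prop where
  pow : I.n * 2 ^ (b + 1) < 2 ^ M.w
  mul : (I.n + 2) * B < 2 ^ M.w
  chips : ∀ x : ℕ → ℕ, (∀ j, 1 ≤ j → j ≤ I.K → x j < 2 ^ (b + 1)) → ∑ v, I.chips x v ≤ B

theorem Bounds.pow_lt {M : Mach} {b B : ℕ} (hb : I.Bounds M b B) : 2 ^ (b + 1) < 2 ^ M.w :=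
  lt_of_le_of_lt (Nat.le_mul_of_pos_left _ I.npos) hb.pow

theorem card_eq (I : Inst V) : Fintype.card V = I.n := by
  rw [← Fintype.card_fin I.n, Fintype.card_congr I.e]

theorem Bounds.need_lt {M : Mach} {b B x : ℕ} (hb : I.Bounds M b B) (hx : x < 2 ^ (b + 1)) (v : V) :
    deg I.G v * (x + 1) < 2 ^ M.w := by
  have h1 := deg_lt_card I.G v
  rw [card_eq] at h1
  exact lt_of_le_of_lt (Nat.mul_le_mul h1.le hx) hb.pow

theorem need_spec {M : Mach} (hM : M.Valid) (hN : M.N = 2 + 2 * I.n + I.D) {b B : ℕ} {h : Store}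
    (hb : I.Bounds M b B) (hr : I.Ready b h) {j : ℕ} (hj : h.reg .j = j) (hj1 : 1 ≤ j)
    (hjK : j ≤ I.K) (hx : h.arr .x j < 2 ^ (b + 1)) :
    need.ok M h ∧ need.val h = deg I.G (I.pv j) * (h.arr .x j + 1) := by
  have hKn := I.K_le
  have h1 := hb.pow_lt
  have h2 := hb.need_lt hx (I.pv j)
  obtain ⟨p1, p2, p3⟩ := I.pnum_spec hj1 hjK
  have hd := hr.darts.2.1 _ p1
  rw [← I.deg_eq p1] at hd
  change h.arr .deg (I.pnum j) = deg I.G (I.pv j) at hd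
  unfold need
  simp [hj, hr.pl j hj1 hjK, hd, hM.w_ne, h2]
  omega

theorem need_cost : need.cost = 17 := by
  unfold need
  rfl

/-- The flag `feas` remembers whether a finished level on the way was violated, which by
`Search.climb` tells whether the level below the one reached has a solution under the cap. -/
theorem vc_climb {M : Mach} (hM : M.Valid) (hN : M.N = 2 + 2 * I.n + I.D) {b B : ℕ} {r : ℕ → ℕ}
    {h : Store} {c : ℕ} {Q : Store → ℕ → Prop} (hb : I.Bounds M b B) (hr : I.Ready b h)
    (hs : I.Search b r h)
    (hQ : ∀ h' c' j, Frame [.feas, .j] [] h h' → h'.reg .j = j → j ≤ I.K → (1 ≤ j → r j ≠ 0) →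
      (∀ i, j < i → i ≤ I.K → r i = 0) →
      (h'.reg .feas = 1 ∧ (∀ i, j < i → i ≤ I.K →
          h.arr .h i < deg I.G (I.pv i) * (h.arr .x i + 1)) ∨
        h'.reg .feas = 0 ∧ ¬ (∀ i, j < i → i ≤ I.K →
          h.arr .h i < deg I.G (I.pv i) * (h.arr .x i + 1))) →
      c' ≤ c + 60 * (I.K + 1) → Q h' c') :
    vc M climb Q h c := by
  have hKn := I.K_le
  have hlit := hM.lit
  unfold climb
  simp only [vc]
  simp [hM.w_ne, hr.k]
  refine vc_whl hM (fun h' c' => ∃ j, Frame [.feas, .j] [] h h' ∧ h'.reg .j = j ∧ j ≤ I.K ∧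
      (∀ i, j < i → i ≤ I.K → r i = 0) ∧
      (h'.reg .feas = 1 ∧ (∀ i, j < i → i ≤ I.K →
          h.arr .h i < deg I.G (I.pv i) * (h.arr .x i + 1)) ∨
        h'.reg .feas = 0 ∧ ¬ (∀ i, j < i → i ≤ I.K →
          h.arr .h i < deg I.G (I.pv i) * (h.arr .x i + 1))) ∧
      c' + 50 * j ≤ c + 10 + 50 * I.K) (fun h => h.reg .j) ?_ ?_
  · rintro h' c' ⟨j, hF, h1, h2, h3, h4, h5⟩
    have hp : h'.arr .pwr = h.arr .pwr := hF.arr _ (by decide)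
    have hh : h'.arr .h = h.arr .h := hF.arr _ (by decide)
    have hx : h'.arr .x = h.arr .x := hF.arr _ (by decide)
    refine ⟨?_, ?_, ?_⟩
    · simp [h1]
      omega
    · intro hz
      refine hQ _ _ j hF h1 h2 (fun hj => ?_) h3 h4 ?_
      · rw [Ne, ← hs.pwr_eq_zero hj h2, ← hp]
        simpa [h1] using hz
      · simp
        omega
    · intro hz
      have hz : h.arr .pwr j = 0 := by
        rw [← hp]
        simpa [h1] using hz
      -- The entry `1` of `pwr` at the fictitious level `0` is a sentinel that stops the ascent
      -- there.
      have hj : 1 ≤ j := by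
        by_contra hcon
        obtain rfl : j = 0 := by omega
        rw [hs.sent] at hz
        omega
      obtain ⟨n1, n2⟩ := need_spec (h := h') hM hN hb (hr.frame hF (by decide) (by decide)) h1 hj h2
        (by rw [hx]; exact hs.x_lt hj h2)
      rw [hx] at n2
      have hsplit : (∀ i, j - 1 < i → i ≤ I.K →
          h.arr .h i < deg I.G (I.pv i) * (h.arr .x i + 1)) ↔
          h.arr .h j < deg I.G (I.pv j) * (h.arr .x j + 1) ∧ (∀ i, j < i → i ≤ I.K →
          h.arr .h i < deg I.G (I.pv i) * (h.arr .x i + 1)) := by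
        constructor
        · intro hall
          exact ⟨hall j (by omega) h2, fun i hi hi' => hall i (by omega) hi'⟩
        · rintro ⟨ha, hb⟩ i hi hi'
          rcases Nat.eq_or_lt_of_le (show j ≤ i by omega) with rfl | hlt
          · exact ha
          · exact hb i hlt hi'
      have hr3 : ∀ i, j - 1 < i → i ≤ I.K → r i = 0 := by
        intro i hi hi'
        rcases Nat.eq_or_lt_of_le (show j ≤ i by omega) with rfl | hlt
        · exact (hs.pwr_eq_zero hj h2).1 hz
        · exact h3 i hlt hi'
      simp only [vc, Exp.ok, Exp.val, Exp.cost, n1, n2, h1, hh, need_cost]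
      refine ⟨⟨⟨trivial, by omega⟩, trivial⟩, fun hlt => ?_, fun hlt => ?_⟩
      · have hlt : h.arr .h j < deg I.G (I.pv j) * (h.arr .x j + 1) := by simpa using hlt
        refine ⟨⟨trivial, by omega, hj⟩, ⟨j - 1, .setReg (by decide) hF,
          by simp, by omega, hr3, ?_, ?_⟩, by simp; omega⟩
        · rw [hsplit]
          simpa [hlt] using h4
        · omega
      · have hlt : ¬ h.arr .h j < deg I.G (I.pv j) * (h.arr .x j + 1) := by simpa using hlt
        refine ⟨by omega, ⟨trivial, by omega, by simp; omega⟩, ⟨j - 1,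
          .setReg (by decide) (.setReg (by decide) hF),
          by simp [h1], by omega, hr3, ?_, ?_⟩, by simp [h1]; omega⟩
        · rw [hsplit]
          right
          exact ⟨by simp, fun hc => hlt hc.1⟩
        · omega
  · refine ⟨I.K, .setReg (by decide) (.setReg (by decide) (.refl _ _ _)), by simp, le_rfl,
      fun i hi hi' => by omega, Or.inl ⟨by simp, fun i hi hi' => by omega⟩, by omega⟩

end Inst

end Sandpile

/-! ### One halving step of the search -/

namespace Sandpile

open WordRAM Cmd

set_option linter.constructorNameAsVariable false

attribute [local simp] Cmd.vc Exp.ok Exp.val Exp.cost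

attribute [local irreducible] Cmd.leaf Cmd.reset Cmd.need Cmd.climb

namespace Inst

variable {V : Type u} {I : Inst V} [Fintype V]

/-- The intervals after one step of the search at level `j`. -/
def nextLen (b : ℕ) (r : ℕ → ℕ) (j i : ℕ) : ℕ :=
  if i < j then r i else if i = j then r j - 1 else b + 1

/-- The part of a step common to both outcomes of the comparison: `v` is the left end of the half
that has been chosen. -/
theorem vc_halve {M : Mach} (hM : M.Valid) (hN : M.N = 2 + 2 * I.n + I.D) {b : ℕ} {r : ℕ → ℕ}
    {h h1 : Store} {c : ℕ} {Q : Store → ℕ → Prop} (hr : I.Ready b h) (hs : I.Search b r h)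
    {j v : ℕ} (hj : 1 ≤ j) (hjK : j ≤ I.K) (h1j : h1.reg .j = j) (hrj : r j ≠ 0)
    (hpow : 2 ^ (b + 1) < 2 ^ M.w)
    (hF : Frame [] [.cnt] h h1) (hcnt : h1.arr .cnt = Function.update (h.arr .cnt) j v)
    (hv : v + 2 ^ (r j - 1) ≤ 2 ^ (b + 1))
    (hm : ∀ m, IsLeast (levelSet I.G I.σ I.pv I.K (2 ^ (b + 1)) j (h.arr .x)) m →
      v ≤ m (I.pv j) ∧ m (I.pv j) < v + 2 ^ (r j - 1))
    (hQ : ∀ h' c', Frame [.i] [.cnt, .pwr, .x] h h' → I.Search b (nextLen b r j) h' →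
      c' ≤ c + 40 * (I.K + 1) + 60 → Q h' c') :
    vc M (put .pwr (.v .j) (.div (.get .pwr (.v .j)) (.c 2)) ;;
      ite (.get .pwr (.v .j)) (put .x (.v .j) (.sub (.add (.get .cnt (.v .j)) (.get .pwr (.v .j))) (.c 1)))
        (put .x (.v .j) (.get .cnt (.v .j))) ;;
      reset (.add (.v .j) (.c 1))) Q h1 c := by
  have hKn := I.K_le
  have hlit := hM.lit
  have hal := hM.arr
  have hpos : 0 < 2 ^ (r j - 1) := by positivity
  have hp1 : h1.arr .pwr = h.arr .pwr := hF.arr _ (by decide)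
  have hx1 : h1.arr .x = h.arr .x := hF.arr _ (by decide)
  have hpw := hs.pwr j hj hjK
  rw [two_pow_div_two hrj] at hpw
  -- The next guess is the last value of the lower half of the new interval, or the only value if a
  -- single one is left.
  have key : ∀ xv c2, xv = (if r j - 1 = 0 then v else v + 2 ^ (r j - 1) / 2 - 1) → c2 ≤ c + 40 →
      vc M (reset (.add (.v .j) (.c 1))) Q ((h1.setArr .pwr (Function.update (h.arr .pwr) j
        (2 ^ (r j - 1) / 2))).setArr .x (Function.update (h.arr .x) j xv)) c2 := by
    intro xv c2 hxv hc2
    have hF2 : Frame [.i] [.cnt, .pwr, .x] h ((h1.setArr .pwr (Function.update (h.arr .pwr) j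
        (2 ^ (r j - 1) / 2))).setArr .x (Function.update (h.arr .x) j xv)) :=
      .setArr (by decide) (.setArr (by decide) (hF.mono (by decide) (by decide)))
    refine vc_reset hM (K := I.K) (half := 2 ^ b) (a := j + 1) ?_ (by omega) ?_ (by positivity) ?_ ?_
      (by omega) ?_
    · rw [hF2.reg .k (by decide), hr.k]
    · rw [hF2.reg .half (by decide), hr.half]
    · simp [h1j, hM.w_ne]
      omega
    · simp [h1j]
    intro h' c' F' hin hout hc'
    simp [hcnt, Function.update_apply] at hout
    have hx' : ∀ i, i < j → h'.arr .x i = h.arr .x i := by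
      intro i hi
      rw [(hout i (by omega)).2.2, if_neg (by omega)]
    -- The level sets up to `j` depend only on guesses before `j`, which are unchanged. The deeper
    -- levels restart with the full range, where the cap alone gives the invariant.
    have hlev : ∀ i, i ≤ j → levelSet I.G I.σ I.pv I.K (2 ^ (b + 1)) i (h'.arr .x) =
        levelSet I.G I.σ I.pv I.K (2 ^ (b + 1)) i (h.arr .x) :=
      fun i hi => levelSet_congr fun i' _ hi' => hx' i' (by omega)
    refine hQ _ _ (hF2.trans F' (by decide) (by decide)) ⟨?_, ?_, ?_, ?_, ?_⟩ ?_
    · rw [(hout 0 (by omega)).2.1, if_neg (by omega), hs.sent]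
    · intro i hi hiK
      unfold nextLen
      split_ifs with h3 h4
      · rw [(hout i (by omega)).2.1, if_neg (by omega), hs.pwr i hi hiK]
      · rw [(hout i (by omega)).2.1, if_pos h4]
      · rw [(hin i (by omega) hiK).2.1, two_pow_div_two (by omega), Nat.add_sub_cancel]
    · intro i hi hiK
      unfold nextLen
      by_cases h3 : i < j
      · simp only [if_pos h3]
        obtain ⟨e1, e2, e3⟩ := hout i (by omega)
        rw [e1, e2, e3]
        simp only [show i ≠ j by omega, if_false]
        exact hs.x i hi hiK
      · by_cases h4 : i = j
        · subst h4
          obtain ⟨e1, e2, e3⟩ := hout i (by omega)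
          rw [e1, e2, e3]
          simpa using hxv
        · obtain ⟨e1, e2, e3⟩ := hin i (by omega) hiK
          rw [e1, e2, e3]
          simp [h3, h4]
    · intro i hi hiK
      unfold nextLen
      split_ifs with h3 h4
      · rw [(hout i (by omega)).1, if_neg (by omega)]
        exact hs.le i hi hiK
      · rw [(hout i (by omega)).1, if_pos h4]
        exact hv
      · rw [(hin i (by omega) hiK).1, zero_add]
    · intro i hi hiK m hmi
      unfold nextLen
      split_ifs with h3 h4
      · rw [hlev i (by omega)] at hmi
        rw [(hout i (by omega)).1, if_neg (by omega)]
        exact hs.inv i hi hiK m hmi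
      · subst h4
        rw [hlev i le_rfl] at hmi
        rw [(hout i (by omega)).1, if_pos rfl]
        exact hm m hmi
      · rw [(hin i (by omega) hiK).1, zero_add]
        exact ⟨Nat.zero_le _, hmi.1.2.2 i le_rfl hiK⟩
    · simp at hc'
      omega
  have hdiv : 2 ^ (r j - 1) / 2 = 0 ↔ r j - 1 = 0 := by
    by_cases h0 : r j - 1 = 0
    · simp [h0]
    · rw [two_pow_div_two h0]
      simp [h0]
  simp only [vc, Exp.ok, Exp.val, Exp.cost, h1j, hp1, hx1, hpw, Store.setArr_arr, Store.setArr_reg,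
    Function.update_self, if_true, reduceCtorEq, if_false, hcnt]
  refine ⟨trivial, ⟨⟨trivial, by omega⟩, by omega⟩, by omega, ⟨trivial, by omega⟩, fun hne => ?_,
    fun he => ?_⟩
  · have hr1 : r j - 1 ≠ 0 := fun h => hne (hdiv.2 h)
    refine ⟨trivial, ⟨⟨⟨trivial, by omega⟩, ⟨trivial, by omega⟩, by omega⟩, by omega, by omega⟩,
      by omega, ?_⟩
    exact key _ _ (by rw [if_neg hr1]) (by omega)
  · have hr1 : r j - 1 = 0 := hdiv.1 he
    refine ⟨trivial, ⟨trivial, by omega⟩, by omega, ?_⟩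
    exact key _ _ (by rw [if_pos hr1]) (by omega)

/-- The guess is the last value of the lower half of the interval, so the comparison with the
optimum decides which half contains the optimum. -/
theorem vc_advance {M : Mach} (hM : M.Valid) (hN : M.N = 2 + 2 * I.n + I.D) {b B : ℕ} {r : ℕ → ℕ}
    {h : Store} {c : ℕ} {Q : Store → ℕ → Prop} (hb : I.Bounds M b B) (hr : I.Ready b h)
    (hs : I.Search b r h) {j : ℕ} (hj : 1 ≤ j) (hjK : j ≤ I.K) (h1j : h.reg .j = j)
    (hrj : r j ≠ 0)
    (hm : ∀ m, IsLeast (levelSet I.G I.σ I.pv I.K (2 ^ (b + 1)) j (h.arr .x)) m →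
      (h.arr .x j < m (I.pv j) ↔ h.reg .feas ≠ 0 ∧
        ¬ h.arr .h j < deg I.G (I.pv j) * (h.arr .x j + 1)))
    (hQ : ∀ h' c', Frame [.i] [.cnt, .pwr, .x] h h' → I.Search b (nextLen b r j) h' →
      c' ≤ c + 40 * (I.K + 1) + 140 → Q h' c') :
    vc M advance Q h c := by
  have hKn := I.K_le
  have hlit := hM.lit
  have hpow := hb.pow_lt
  have hpos : 0 < 2 ^ (r j - 1) := by positivity
  have hpw := hs.pwr j hj hjK
  rw [two_pow_div_two hrj] at hpw
  have hle := hs.le j hj hjK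
  have hxj := hs.x j hj hjK
  rw [if_neg hrj, hpw] at hxj
  rw [two_mul_two_pow hrj] at hle
  have hinv := hs.inv j hj hjK
  rw [two_mul_two_pow hrj] at hinv
  obtain ⟨n1, n2⟩ := need_spec hM hN hb hr h1j hj hjK (hs.x_lt hj hjK)
  have stay : ∀ c', c' ≤ c + 40 → ¬ (h.reg .feas ≠ 0 ∧
      ¬ h.arr .h j < deg I.G (I.pv j) * (h.arr .x j + 1)) →
      vc M (put .pwr (.v .j) (.div (.get .pwr (.v .j)) (.c 2)) ;;
      ite (.get .pwr (.v .j)) (put .x (.v .j) (.sub (.add (.get .cnt (.v .j)) (.get .pwr (.v .j))) (.c 1)))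
        (put .x (.v .j) (.get .cnt (.v .j))) ;;
      reset (.add (.v .j) (.c 1))) Q h c' := by
    intro c' hc' hno
    refine vc_halve hM hN hr hs (v := h.arr .cnt j) hj hjK h1j hrj hpow (.refl _ _ _) (by simp)
      (by omega) (fun m hmj => ?_) fun h' c'' F' S' hc'' => hQ _ _ F' S' (by omega)
    have h1 := hinv m hmj
    rw [← hm m hmj] at hno
    omega
  unfold advance
  simp only [vc, Exp.ok, Exp.val, Exp.cost, n1, n2, h1j, need_cost]
  refine ⟨trivial, fun hf => ⟨⟨⟨trivial, by omega⟩, trivial⟩, fun hlt => ?_, fun hlt => ?_⟩,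
    fun hf => ?_⟩
  · have hlt : h.arr .h j < deg I.G (I.pv j) * (h.arr .x j + 1) := by simpa using hlt
    have := stay (c + (1 + 1) + (1 + 4 + 17 + 1 + 1) + 1) (by omega) fun hc => hc.2 hlt
    simpa only [vc, Exp.ok, Exp.val, Exp.cost, h1j] using this
  · have hlt : ¬ h.arr .h j < deg I.G (I.pv j) * (h.arr .x j + 1) := by simpa using hlt
    refine ⟨trivial, ⟨⟨trivial, by omega⟩, ⟨trivial, by omega⟩, by omega⟩, by omega, ?_⟩
    rw [hpw]
    have := vc_halve (Q := Q) (c := c + (1 + 1) + (1 + 4 + 17 + 1 + 1) + (1 + (1 + 4 + (1 + 4) + 1) + 4)) hM hN hr hs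
      (v := h.arr .cnt j + 2 ^ (r j - 1)) hj hjK (h1 := h.setArr .cnt (Function.update (h.arr .cnt) j
        (h.arr .cnt j + 2 ^ (r j - 1)))) h1j hrj hpow
      (.setArr (by decide) (.refl _ _ _)) (by simp) (by omega) (fun m hmj => ?_)
      fun h' c'' F' S' hc'' => hQ h' c'' F' S' (by omega)
    · simpa only [vc, Exp.ok, Exp.val, Exp.cost, h1j] using this
    · have h1 := hinv m hmj
      have := (hm m hmj).2 ⟨hf, hlt⟩
      omega
  · have := stay (c + (1 + 1) + 1) (by omega) fun hc => hc.1 hf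
    simpa only [vc, Exp.ok, Exp.val, Exp.cost, h1j] using this

end Inst

end Sandpile

/-! ### The main loop: correctness and number of rounds -/

namespace Sandpile

open WordRAM Cmd

set_option linter.constructorNameAsVariable false

attribute [local simp] Cmd.vc Exp.ok Exp.val Exp.cost

attribute [local irreducible] Cmd.leaf Cmd.advance Cmd.climb

namespace Inst

variable {V : Type u} {I : Inst V} [Fintype V]

/-- The result of the nested search: the firing numbers, or the absence of any. -/
def Result (I : Inst V) (h : Store) : Prop :=
  (h.reg .feas = 1 ∧ ∃ u, I.Leaf (h.arr .x) h u ∧ IsLeast {u | IsSuper I.G Set.univ I.σ u} u) ∨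
    (h.reg .feas = 0 ∧ ¬ ∃ u, IsSuper I.G Set.univ I.σ u)

theorem exists_isLeast_isSuper {F : V → ℕ} (hF : IsSuper I.G Set.univ I.σ F) :
    ∃ c, IsLeast {u | IsSuper I.G Set.univ I.σ u} c :=
  exists_isLeast_of_inf_mem ⟨F, hF⟩ fun _ hu _ hu' => IsSuper.inf hu hu'

/-- The cap excludes nothing that is sought: the least stabilizing function is below `n ^ 3`. -/
theorem mem_levelSet_one {b : ℕ} (hX : I.n ^ 3 < 2 ^ (b + 1)) (x : ℕ → ℕ) {c : V → ℕ}
    (hc : IsLeast {u | IsSuper I.G Set.univ I.σ u} c) :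
    c ∈ levelSet I.G I.σ I.pv I.K (2 ^ (b + 1)) 1 x := by
  refine ⟨fun i hi hi' => by omega, ?_, fun i _ _ => ?_⟩
  · exact hc.1.mono fun _ _ => Set.mem_univ _
  · have := odometer_lt hc (I.pv i)
    rw [card_eq I] at this
    omega

theorem levelSet_one_subset {X : ℕ} {x : ℕ → ℕ} {c : V → ℕ}
    (hc : c ∈ levelSet I.G I.σ I.pv I.K X 1 x) : IsSuper I.G Set.univ I.σ c :=
  hc.2.1.mono fun v _ i hi hi' => by omega

/-- When every level is finished, stability at all removed vertices decides whether level `1` has a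
solution. If so, `u` is its optimum and thus the odometer; if not, no stabilizing function exists,
since the least one would lie in that level. -/
theorem result_of_climb {b : ℕ} {r : ℕ → ℕ} {h h' : Store} {u : V → ℕ}
    (hX : I.n ^ 3 < 2 ^ (b + 1)) (hs : I.Search b r h)
    (hu : I.Leaf (h.arr .x) h u) (hr : ∀ i, 0 < i → i ≤ I.K → r i = 0)
    (hf : (h'.reg .feas = 1 ∧ (∀ i, 0 < i → i ≤ I.K → IsSat I.G I.σ u (I.pv i)) ∨
        h'.reg .feas = 0 ∧ ¬ (∀ i, 0 < i → i ≤ I.K → IsSat I.G I.σ u (I.pv i))))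
    (hx : h'.arr .x = h.arr .x) (hh : h'.arr .h = h.arr .h) (hfin : h'.arr .fin = h.arr .fin) :
    I.Result h' := by
  obtain ⟨h1, h2⟩ := hs.climb (hu.least _) (Nat.zero_le _) hr
  rw [zero_add] at h1 h2
  rw [← h2] at hf
  rcases hf with ⟨hf, hmem⟩ | ⟨hf, hmem⟩
  · refine Or.inl ⟨hf, u, ?_, ?_⟩
    · obtain ⟨a1, a2, a3⟩ := hu
      rw [hx]
      refine ⟨a1, ?_, ?_⟩
      · rwa [hh]
      · rwa [hfin]
    · obtain ⟨c, hc⟩ := exists_isLeast_isSuper (levelSet_one_subset hmem)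
      refine ⟨levelSet_one_subset hmem, fun F hF => ?_⟩
      exact ((h1 ⟨u, hmem⟩).2 (mem_levelSet_one hX _ hc)).trans (hc.2 hF)
  · refine Or.inr ⟨hf, ?_⟩
    rintro ⟨F, hF⟩
    obtain ⟨c, hc⟩ := exists_isLeast_isSuper hF
    exact hmem (h1 ⟨c, mem_levelSet_one hX _ hc⟩).1

theorem Leaf.isSat_iff {x : ℕ → ℕ} {h : Store} {u : V → ℕ} (hu : I.Leaf x h u) {i : ℕ}
    (hi : 1 ≤ i) (hiK : i ≤ I.K) :
    IsSat I.G I.σ u (I.pv i) ↔ h.arr .h i < deg I.G (I.pv i) * (x i + 1) := by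
  unfold IsSat
  rw [hu.h_eq i hi hiK, (hu.least 0).1.1 i hi (by omega)]

/-- `L` bounds the cost of one round, and `digits b r I.K + 1` rounds remain. The invariant adds
their cost to the time spent, and each round pays for itself by lowering the digits. -/
theorem vc_mainLoop {M : Mach} (hM : M.Valid) (hN : M.N = 2 + 2 * I.n + I.D) {b B : ℕ}
    {A : Prog} {tf : (I.G.induce (I.Pᶜ : Set V)).ConnectedComponent → ℕ}
    (hA : I.SolvesPieces A M.w B tf M.b)
    {gs : ℕ → (I.G.induce (I.Pᶜ : Set V)).ConnectedComponent}
    {h : Store} {c : ℕ} {Q : Store → ℕ → Prop} (hb : I.Bounds M b B) (hr : I.Ready b h)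
    (hf : I.Fresh b 1 h) (hg : I.Comps gs h) (hrun : h.reg .run = 1) (hX : I.n ^ 3 < 2 ^ (b + 1))
    (hQ : ∀ h' c', I.Ready b h' → I.Result h' →
      (∀ j, 1 ≤ j → j ≤ I.K → h'.arr .h j < 2 ^ M.w) →
      c' ≤ c + (b + 2) ^ I.K * (1000 * ∑ t ∈ Finset.range (h.reg .nc), tf (gs t) +
        1000 * (I.n + I.D + 1) + 200 * (I.n + 2)) + 2 → Q h' c') :
    vc M (mainLoop A) Q h c := by
  have hKn := I.K_le
  have hlit := hM.lit
  set L := 1000 * ∑ t ∈ Finset.range (h.reg .nc), tf (gs t) + 1000 * (I.n + I.D + 1) +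
    200 * (I.n + 2) with hL
  unfold mainLoop
  have hfull := digits_full (b := b) (k := I.K) (r := fun _ => b + 1) fun _ _ _ => rfl
  -- The digits are not stored, but `2 ^ r / 2` has binary length `r`, so the measure can be read
  -- off the array `pwr`.
  have hsz : ∀ {r h'}, I.Search b r h' →
      digits b (fun j => Nat.size (h'.arr .pwr j)) I.K = digits b r I.K := by
    intro r h' hs
    refine digits_congr fun j hj hjK => ?_
    rw [hs.pwr j hj hjK]
    by_cases h0 : r j = 0
    · simp [h0]
    · rw [two_pow_div_two h0, Nat.size_pow]
      omega
  refine vc_whl hM (fun h' c' => I.Ready b h' ∧ I.Comps gs h' ∧ h'.reg .nc = h.reg .nc ∧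
      ((h'.reg .run = 1 ∧ ∃ r, I.Search b r h' ∧
        c' + (digits b r I.K + 1) * L ≤ c + (b + 2) ^ I.K * L) ∨
      (h'.reg .run = 0 ∧ I.Result h' ∧ (∀ j, 1 ≤ j → j ≤ I.K → h'.arr .h j < 2 ^ M.w) ∧
        c' ≤ c + (b + 2) ^ I.K * L)))
    (fun h' => if h'.reg .run = 0 then 0
      else digits b (fun j => Nat.size (h'.arr .pwr j)) I.K + 1) ?_ ?_
  · rintro h' c' ⟨hr', hg', hnc, hrun⟩
    refine ⟨trivial, fun hz => ?_, fun hz => ?_⟩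
    · rcases hrun with ⟨hrun, _⟩ | ⟨hrun, hres, hh, hc⟩
      · simp only [Exp.val, hrun] at hz
        omega
      · refine hQ _ _ hr' hres hh ?_
        simp only [Exp.cost]
        omega
    rcases hrun with ⟨hrun, r, hs, hc⟩ | ⟨hrun, _⟩
    swap
    · exact absurd hrun hz
    rw [if_neg (by omega), hsz hs]
    rw [add_mul, one_mul] at hc
    refine I.vc_leaf hM hN hA hr' hg' hb.mul (hb.chips _ fun j hj hjK => hs.x_lt hj hjK) ?_
    intro h1 c1 F1 hh1 hres1 hc1
    rw [hnc] at hc1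
    simp only [Exp.cost] at hc1
    have hr1 := hr'.frame F1 (by decide) (by decide)
    have hg1 := hg'.frame F1 (by decide) (by decide) (by decide)
    have hs1 := hs.frame F1 (by decide)
    have hnc1 : h1.reg .nc = h.reg .nc := (F1.reg _ (by decide)).trans hnc
    have hx1 : h1.arr .x = h'.arr .x := F1.arr _ (by decide)
    rw [← hx1] at hres1
    refine ⟨trivial, fun hok => ?_, fun hok => ?_⟩
    · obtain ⟨u, hu⟩ : ∃ u, I.Leaf (h1.arr .x) h1 u := by
        rcases hres1 with ⟨_, hu⟩ | ⟨h0, _⟩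
        · exact hu
        · exact absurd h0 hok
      refine vc_climb hM hN hb hr1 hs1 ?_
      intro h2 c2 j F2 hj hjK hrj hrz hfeas hc2
      simp only [Exp.cost] at hc2
      have hr2 := hr1.frame F2 (by decide) (by decide)
      have hg2 := hg1.frame F2 (by decide) (by decide) (by decide)
      have hs2 := hs1.frame F2 (by decide)
      have hnc2 : h2.reg .nc = h.reg .nc := (F2.reg _ (by decide)).trans hnc1
      have hx2 : h2.arr .x = h1.arr .x := F2.arr _ (by decide)
      have hh2 : h2.arr .h = h1.arr .h := F2.arr _ (by decide)
      have hf2 : h2.arr .fin = h1.arr .fin := F2.arr _ (by decide)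
      have hsat : (∀ i, j < i → i ≤ I.K → h1.arr .h i < deg I.G (I.pv i) * (h1.arr .x i + 1)) ↔
          ∀ i, j < i → i ≤ I.K → IsSat I.G I.σ u (I.pv i) :=
        forall_congr' fun i => forall_congr' fun hi => forall_congr' fun hi' =>
          (hu.isSat_iff (by omega) hi').symm
      rw [hsat] at hfeas
      refine ⟨trivial, fun hj0 => ?_, fun hj0 => ?_⟩
      · have hj1 : 1 ≤ j := by
          simp only [Exp.val, hj] at hj0
          omega
        have hpv : ∀ i j, 1 ≤ i → i < j → j ≤ I.K → I.pv i ≠ I.pv j := fun i j hi hij hj =>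
          I.pv_ne hi hij hj
        obtain ⟨k1, k2⟩ := hs1.climb (hu.least _) hjK hrz
        refine vc_advance hM hN hb hr2 hs2 hj1 hjK hj (hrj hj1) ?_ ?_
        · intro m hm
          rw [hx2] at hm ⊢
          rw [hh2, levelSet_lt_iff hj1 hjK hpv k1 (hs1.x_lt hj1 hjK) hm, k2,
            hu.isSat_iff hj1 hjK]
          refine and_congr_left fun _ => ?_
          rcases hfeas with ⟨e1, e2⟩ | ⟨e1, e2⟩
          · exact iff_of_true e2 (by simp [e1])
          · exact iff_of_false e2 (by simp [e1])
        · intro h3 c3 F3 hs3 hc3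
          simp only [Exp.cost] at hc3
          have hrun3 : h3.reg .run = 1 := by
            rw [F3.reg _ (by decide), F2.reg _ (by decide), F1.reg _ (by decide), hrun]
          have hdig : digits b (nextLen b r j) I.K + 1 = digits b r I.K := by
            refine digits_pred hj1 hjK (fun i hi hij => ?_) ?_ fun i hi hiK => ⟨hrz i hi hiK, ?_⟩
            · simp [nextLen, hij]
            · have := hrj hj1
              simp [nextLen]
              omega
            · simp [nextLen, show ¬ i < j by omega, show i ≠ j by omega]
          refine ⟨⟨hr2.frame F3 (by decide) (by decide),
            hg2.frame F3 (by decide) (by decide) (by decide),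
            (F3.reg _ (by decide)).trans hnc2, Or.inl ⟨hrun3, _, hs3, ?_⟩⟩, ?_⟩
          · rw [hdig]
            omega
          · rw [if_neg (by omega), hsz hs3]
            omega
      · have hj1 : j = 0 := by
          simpa only [Exp.val, hj] using hj0
        subst hj1
        have hr3 := hr2.frame (.setReg (R := [.run]) (A := []) (v := 0) (List.mem_singleton_self Reg.run)
          (.refl _ _ h2)) (by decide) (by decide)
        refine ⟨?_, ⟨hr3, hg2, hnc2, Or.inr ⟨by simp, ?_, ?_, ?_⟩⟩, by simp⟩
        · simp only [Exp.ok]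
          omega
        · refine result_of_climb (h := h1) (u := u) hX hs1 hu hrz ?_ hx2 hh2 hf2
          simpa using hfeas
        · intro j hj hjK
          simpa [hh2] using hh1 j hj hjK
        · simp only [Exp.cost]
          omega
    · have hno : ¬ ∃ F, IsSuper I.G I.Pᶜ (I.chips (h1.arr .x)) F := by
        rcases hres1 with ⟨h0, _⟩ | ⟨_, h0⟩
        · simp only [Exp.val, h0] at hok
          omega
        · exact h0
      have hr3 := hr1.frame (.setReg (R := [.run, .feas]) (A := []) (v := 0) (x := .run) (by decide)
        (.setReg (x := .feas) (v := 0) (by decide) (.refl _ _ h1))) (by decide) (by decide)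
      refine ⟨?_, ?_, ⟨hr3, hg1, hnc1, Or.inr ⟨by simp, ?_, ?_, ?_⟩⟩, by simp⟩
      · simp only [Exp.ok]
        omega
      · simp only [Exp.ok]
        omega
      · refine Or.inr ⟨by simp, ?_⟩
        rintro ⟨F, hF⟩
        -- A single failing piece proves nontermination for whatever guess, so the loop may stop at
        -- once.
        exact hno (hF.exists_shift (x := I.ext (h1.arr .x)) fun v hv => I.ext_of_notMem _ hv)
      · intro j hj hjK
        simpa using hh1 j hj hjK
      · simp only [Exp.cost]
        omega
  · exact ⟨hr, hg, rfl, Or.inl ⟨hrun, _, Search.of_fresh hf, by rw [hfull]⟩⟩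

end Inst

end Sandpile

/-! ### Output, and the program as a whole -/

namespace Sandpile

open WordRAM Cmd

set_option linter.constructorNameAsVariable false

attribute [local simp] Cmd.vc Exp.ok Exp.val Exp.cost

attribute [local irreducible] Cmd.setup Cmd.mainLoop Cmd.forr

namespace Inst

variable {V : Type u} {I : Inst V} [Fintype V]

theorem vc_finish {M : Mach} (hM : M.Valid) (hN : M.N = 2 + 2 * I.n + I.D) {b : ℕ}
    {h : Store} {c : ℕ} {Q : Store → ℕ → Prop} (hr : I.Ready b h) (hres : I.Result h)
    (hlt : ∀ j, 1 ≤ j → j ≤ I.K → h.arr .h j < 2 ^ M.w)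
    (hQ : ∀ h' c', IsAnswer I.G ∅ I.σ I.e ((List.range (h'.reg .len)).map (h'.arr .inp)) →
      h'.reg .len ≤ M.N → c' ≤ c + 100 * (I.n + 3) → Q h' c') :
    vc M finish Q h c := by
  have hKn := I.K_le
  have hlit := hM.lit
  have hal := hM.arr
  unfold finish
  rcases hres with ⟨hf, u, hu, hleast⟩ | ⟨hf, hno⟩
  · obtain ⟨ρ, hρ⟩ := exists_terminal_of_isSuper (S := ∅) (by simpa using hleast.1)
    obtain ⟨c0, _, hbal, hl⟩ := hρ.exists_odometer
    rw [Set.compl_empty] at hl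
    -- The odometer of the stabilization and the function found by the search are both least, so the
    -- balance of chips determines the terminal configuration. At a removed vertex this is `h - deg
    -- * x`.
    obtain rfl : c0 = u := hl.unique hleast
    refine ⟨trivial, fun _ => ?_, fun hz => absurd (hf ▸ hz : 1 = 0) (by omega)⟩
    have hx0 : ∀ j, 1 ≤ j → j ≤ I.K → h.arr .x j = c0 (I.pv j) := fun j hj hjK =>
      ((hu.least 0).1.1 j hj (by omega)).symm
    refine vc_forr hM (fun j h' c' => Frame [.j] [.fin] h h' ∧
      (∀ v < I.n, I.vt v ∉ I.P ∨ I.cntP v + 1 < j → h'.arr .fin v = ρ (I.vt v)) ∧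
      c' ≤ c + 10 + 50 * j) 1 (I.K + 1) (by simp [hM.w_ne]) rfl (by omega) (hM.lt (by omega))
      ?_ ?_ ?_ ?_
    · refine ⟨.setReg (by decide) (.refl _ _ _), fun v hv hP => ?_, by simp⟩
      have hP : I.vt v ∉ I.P := by
        rcases hP with h | h
        · exact h
        · omega
      have h1 := hu.fin v hv hP
      have h2 := hbal (I.vt v)
      simp
      omega
    · rintro j h' c' _ ⟨hF, _⟩
      simp [hF.reg .k (by decide), hr.k, hM.w_ne]
      omega
    · rintro j h' c' hj hjK ⟨hF, h1, h2⟩ hx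
      have hr' := hr.frame hF (by decide) (by decide)
      obtain ⟨p1, p2, p3⟩ := I.pnum_spec hj (show j ≤ I.K by omega)
      have hd := hr'.darts.2.1 _ p1
      rw [← I.deg_eq p1] at hd
      change h'.arr .deg (I.pnum j) = deg I.G (I.pv j) at hd
      have hxj : h'.arr .x j = c0 (I.pv j) := by rw [hF.arr _ (by decide), hx0 j hj (by omega)]
      have hhj : h'.arr .h j = h.arr .h j := by rw [hF.arr _ (by decide)]
      have e1 := hu.h_eq j hj (by omega)
      have e2 := hbal (I.pv j)
      have e3 := hlt j hj (by omega)
      have hpl := hr'.pl j hj (by omega)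
      simp only [vc, Exp.ok, Exp.val, Exp.cost, hx, hpl, hd, hxj, hhj]
      refine ⟨⟨trivial, by omega⟩, ⟨⟨trivial, by omega⟩, ⟨⟨⟨trivial, by omega⟩, by omega⟩,
        ⟨trivial, by omega⟩, by omega⟩, by omega⟩, by omega, ?_, ?_, ?_, ?_⟩
      · simpa using hx
      · exact .setReg (by decide) (.setArr (by decide) hF)
      · intro v hv hP
        by_cases hvj : v = I.pnum j
        · subst hvj
          simp
          change _ = ρ (I.pv j)
          omega
        · simp [hvj]
          refine h1 v hv ?_
          by_cases hvP : I.vt v ∈ I.P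
          · right
            have hne : I.cntP v + 1 ≠ j := by
              rintro rfl
              exact hvj (I.pnum_cntP hvP).symm
            rcases hP with h | h
            · exact absurd hvP h
            · omega
          · exact Or.inl hvP
      · omega
    rintro h1 c1 ⟨F1, hfin, hc1⟩ -
    have hr1 := hr.frame F1 (by decide) (by decide)
    have hfin : ∀ v < I.n, h1.arr .fin v = ρ (I.vt v) := by
      intro v hv
      refine hfin v hv ?_
      by_cases hvP : I.vt v ∈ I.P
      · have := I.cntP_lt_K hv hvP
        exact Or.inr (by omega)
      · exact Or.inl hvP
    simp only [vc, Exp.ok, Exp.val, Exp.cost] at hc1 ⊢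
    refine ⟨by omega, by omega, by omega, ?_⟩
    refine vc_forr hM (fun i h' c' => h'.reg .n = I.n ∧ h'.arr .fin = h1.arr .fin ∧
      h'.arr .inp 0 = 1 ∧ (∀ v < i, h'.arr .inp (v + 1) = ρ (I.vt v)) ∧
      c' ≤ c + 50 + 50 * I.K + 50 * i + 60) 0 I.n (by simp) rfl (by omega) (hM.lt (by omega))
      ?_ ?_ ?_ ?_
    · refine ⟨by simpa using hr1.n, by simp, by simp, fun v hv => by omega, ?_⟩
      simp
      omega
    · rintro i h' c' _ ⟨hn, _⟩
      simp [hn]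
    · rintro i h' c' _ hi ⟨hn, h2, h3, h4, h5⟩ hx
      simp only [vc, Exp.ok, Exp.val, Exp.cost, hx, h2, hfin i hi]
      refine ⟨⟨trivial, by omega, by omega⟩, ⟨trivial, by omega⟩, by omega, ?_, ?_, ?_, ?_, ?_, ?_⟩
      · simpa using hx
      · simpa using hn
      · simpa using h2
      · simpa using h3
      · intro v hv
        by_cases hvi : v = i
        · simp [hvi]
        · simpa [hvi] using h4 v (by omega)
      · omega
    rintro h2 c2 ⟨hn, _, h3, h4, h5⟩ -
    simp only [hn]
    refine ⟨⟨trivial, by omega, by omega⟩, hQ _ _ (Or.inl ⟨ρ, hρ, ?_⟩) ?_ ?_⟩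
    · apply List.ext_getElem
      · simp
      · intro i hi hi'
        cases i with
        | zero => simp [h3]
        | succ i =>
          have hi : i < I.n := by simpa using hi
          simp [h4 i hi, ← I.vt_fin]
    · simp
      omega
    · simp only [Exp.cost]
      omega
  · refine ⟨trivial, fun hz => absurd hf hz, fun _ => ?_⟩
    simp only [vc, Exp.ok, Exp.val, Exp.cost]
    refine ⟨by omega, by omega, by omega, by omega, hQ _ _ (Or.inr ⟨?_, ?_⟩) ?_ ?_⟩
    · rintro ⟨ρ, hρ⟩
      obtain ⟨c0, _, _, hl⟩ := hρ.exists_odometer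
      rw [Set.compl_empty] at hl
      exact hno ⟨c0, hl.1⟩
    · simp
    · simp
      omega
    · omega

theorem vc_all {M : Mach} (hM : M.Valid) (hN : M.N = 2 + 2 * I.n + I.D) {B : ℕ}
    {A : Prog} [Nonempty (I.G.induce (I.Pᶜ : Set V)).ConnectedComponent]
    {tf : (I.G.induce (I.Pᶜ : Set V)).ConnectedComponent → ℕ}
    (hA : I.SolvesPieces A M.w B tf M.b) {S S' : ℕ} (hw : I.n * (2 * I.n ^ 3) < 2 ^ M.w)
    (hB : (I.n + 2) * B < 2 ^ M.w)
    (hch : ∀ x : ℕ → ℕ, (∀ j, 1 ≤ j → j ≤ I.K → x j < 2 * I.n ^ 3) → ∑ v, I.chips x v ≤ B)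
    (hS : ∀ h b gs, I.Ready b h → I.Comps gs h →
      I.n + I.D ≤ ∑ t ∈ Finset.range (h.reg .nc), tf (gs t) ∧
      ∑ t ∈ Finset.range (h.reg .nc), tf (gs t) ≤ S ∧ I.n + I.D ≤ S') :
    vc M (all A) (fun h' c' =>
      IsAnswer I.G ∅ I.σ I.e ((List.range (h'.reg .len)).map (h'.arr .inp)) ∧
      h'.reg .len ≤ M.N ∧ I.n + I.D ≤ S' ∧ I.n + I.D ≤ S ∧ ∃ b, 2 ^ (b + 1) ≤ 2 * I.n ^ 3 ∧ c' ≤ 5000 * (b + 2) ^ I.K * S + 20 * b) I.store 0 := by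
  have hnpos := I.npos
  have hpow : 2 * I.n ^ 3 < 2 ^ M.w := lt_of_le_of_lt (Nat.le_mul_of_pos_left _ hnpos) hw
  unfold all
  refine I.vc_setup hM hN hpow ?_
  intro h1 c1 b hr1 hf1 hrun1 hb1 hb2 hc1
  have hcomp := hr1.segs.comp
  choose! gs hgs using hcomp
  have hg1 : I.Comps gs h1 := hgs
  obtain ⟨hS1, hS2, hS3⟩ := hS h1 b gs hr1 hg1
  refine vc_mainLoop hM hN hA (b := b) (B := B)
    ⟨lt_of_le_of_lt (Nat.mul_le_mul_left _ hb1) hw, hB,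
    fun x hx => hch x fun j hj hjK => lt_of_lt_of_le (hx j hj hjK) hb1⟩ hr1 hf1 hg1 hrun1 hb2 ?_
  intro h2 c2 hr2 hres hlt hc2
  refine vc_finish hM hN hr2 hres hlt ?_
  intro h3 c3 hans hlen hc3
  refine ⟨hans, hlen, hS3, hS1.trans hS2, b, hb1, ?_⟩
  set SS := ∑ t ∈ Finset.range (h1.reg .nc), tf (gs t) with hSS
  have h4 : 1 ≤ (b + 2) ^ I.K := Nat.one_le_pow _ _ (by omega)
  -- Since `n + D ≤ S` and `n ≥ 1`, the three summands are at most `1000 * S`, `2000 * S` and `600 *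
  -- S`.
  have h5 : (b + 2) ^ I.K * (1000 * SS + 1000 * (I.n + I.D + 1) + 200 * (I.n + 2)) ≤
      (b + 2) ^ I.K * (3600 * S) := Nat.mul_le_mul_left _ (by omega)
  have h6 : 1 * S ≤ (b + 2) ^ I.K * S := Nat.mul_le_mul_right _ h4
  have h7 : (b + 2) ^ I.K * (3600 * S) = 3600 * ((b + 2) ^ I.K * S) := by ring
  have h8 : 5000 * (b + 2) ^ I.K * S = 5000 * ((b + 2) ^ I.K * S) := by ring
  rw [h8]
  omega

end Inst

end Sandpile

/-! ### The lengths of the pieces against the size of the graph -/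

namespace Sandpile

open WordRAM Cmd

set_option linter.constructorNameAsVariable false

namespace Inst

variable {V : Type u} {I : Inst V}

theorem Segs.n_le {q loc s : ℕ → ℕ} {L nc : ℕ} (hs : I.Segs q loc s L nc)
    (hl : ∀ v < I.n, loc v ≠ 0) : I.n ≤ I.K + L := by
  have hsub : Finset.range I.n ⊆
      (Finset.Icc 1 I.K).image I.pnum ∪ (Finset.range L).image q := by
    intro v hv
    have hv : v < I.n := by simpa using hv
    rw [Finset.mem_union, Finset.mem_image, Finset.mem_image]
    by_cases hP : I.vt v ∈ I.P
    · left
      have := I.cntP_lt_K hv hP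
      exact ⟨I.cntP v + 1, by simp; omega, I.pnum_cntP hP⟩
    · right
      obtain ⟨i, hi, he⟩ := hs.vis v hv hP (hl v hv)
      exact ⟨i, by simpa using hi, he⟩
  have h1 := Finset.card_le_card hsub
  have h2 := Finset.card_union_le ((Finset.Icc 1 I.K).image I.pnum) ((Finset.range L).image q)
  have h3 : ((Finset.Icc 1 I.K).image I.pnum).card ≤ (Finset.Icc 1 I.K).card :=
    Finset.card_image_le
  have h4 : ((Finset.range L).image q).card ≤ (Finset.range L).card := Finset.card_image_le
  simp only [Finset.card_range, Nat.card_Icc, Nat.add_sub_cancel] at h1 h3 h4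
  omega

theorem Segs.sum_length {q loc s : ℕ → ℕ} {L nc : ℕ} (hs : I.Segs q loc s L nc) :
    ∑ c ∈ Finset.range nc, (s (c + 1) - s c) = L := by
  have : ∀ m, m ≤ nc → ∑ c ∈ Finset.range m, (s (c + 1) - s c) = s m := by
    intro m
    induction m with
    | zero => simp [hs.zero]
    | succ m ih =>
      intro hm
      have := hs.lt m (by omega)
      rw [Finset.sum_range_succ, ih (by omega)]
      omega
  rw [this nc le_rfl, hs.last]

/-- Every edge occurs in the list of the edges of some piece. -/
theorem Segs.length_le {q loc s : ℕ → ℕ} {L nc : ℕ} (hs : I.Segs q loc s L nc) (hnc : 0 < nc)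
    (hl : ∀ v < I.n, loc v ≠ 0)
    {W : ℕ → Set V} (hp : ∀ c < nc, I.IsPiece (W c) q loc (s c) (s (c + 1))) :
    I.es.length ≤ ∑ c ∈ Finset.range nc, (IsPiece.pieceDarts I q loc (s c) (s (c + 1))).length := by
  have hW : ∀ v w, I.G.Adj v w → ∃ c < nc, v ∈ W c ∧ w ∈ W c := by
    have main : ∀ v w, I.G.Adj v w → v ∉ I.P → ∃ c < nc, v ∈ W c ∧ w ∈ W c := by
      intro v w hvw hv
      obtain ⟨i, hi, he⟩ := hs.vis _ (I.ix_lt v) (by rwa [I.vt_ix]) (hl _ (I.ix_lt v))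
      obtain ⟨c, hc, h1, h2⟩ := hs.exists_seg hi
      have h3 := (hp c hc).q_memW h1 h2
      rw [he, I.vt_ix] at h3
      exact ⟨c, hc, h3, (hp c hc).closed v h3 hv w hvw⟩
    intro v w hvw
    by_cases hv : v ∈ I.P
    · by_cases hw : w ∈ I.P
      · exact ⟨0, hnc, (hp 0 hnc).P_subset hv, (hp 0 hnc).P_subset hw⟩
      · obtain ⟨c, hc, h1, h2⟩ := main w v hvw.symm hw
        exact ⟨c, hc, h2, h1⟩
    · exact main v w hvw hv
  have hsub : Finset.range I.es.length ⊆ (Finset.range nc).biUnion fun c =>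
      ((IsPiece.pieceDarts I q loc (s c) (s (c + 1))).map fun d => d / 2).toFinset := by
    intro i hi
    have hi : i < I.es.length := by simpa using hi
    have hD0 : 2 * i < I.D := by unfold D; omega
    have hD1 : 2 * i + 1 < I.D := by unfold D; omega
    obtain ⟨c, hc, h1, h2⟩ := hW _ _ (I.dart_adj hD0)
    have hne : loc (I.src (2 * i)) ≠ loc (I.dst (2 * i)) := by
      intro h
      have h3 := (hp c hc).loc_inj h1 h2
      rw [I.ix_vt (I.src_lt hD0), I.ix_vt (I.dst_lt hD0)] at h3
      exact (I.dart_adj hD0).ne (h3 h)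
    have hrev : I.src (2 * i + 1) = I.dst (2 * i) ∧ I.dst (2 * i + 1) = I.src (2 * i) := by
      obtain ⟨j, hj, ⟨a1, a2, a3⟩ | ⟨a1, _⟩⟩ := I.dart_cases hD0
      · obtain ⟨k, hk, ⟨b1, _⟩ | ⟨b1, b2, b3⟩⟩ := I.dart_cases hD1
        · omega
        · obtain rfl : j = k := by omega
          rw [a2, a3, b2, b3]
          exact ⟨rfl, rfl⟩
      · omega
    rw [Finset.mem_biUnion]
    refine ⟨c, by simpa using hc, ?_⟩
    rw [List.mem_toFinset, List.mem_map]
    rcases Nat.lt_or_gt_of_ne hne with h | h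
    · refine ⟨2 * i + 1, (hp c hc).mem_pieceDarts.2 ⟨hD1, ?_, ?_, ?_⟩, by omega⟩
      · rwa [hrev.1]
      · rwa [hrev.2]
      · rwa [hrev.1, hrev.2]
    · exact ⟨2 * i, (hp c hc).mem_pieceDarts.2 ⟨hD0, h1, h2, h⟩, by omega⟩
  have h1 := Finset.card_le_card hsub
  rw [Finset.card_range] at h1
  refine h1.trans (Finset.card_biUnion_le.trans (Finset.sum_le_sum fun c _ => ?_))
  exact (List.toFinset_card_le _).trans (by simp)

theorem Segs.comp_injOn {q loc s : ℕ → ℕ} {L nc : ℕ} (hs : I.Segs q loc s L nc)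
    {gs : ℕ → (I.G.induce (I.Pᶜ : Set V)).ConnectedComponent}
    (hg : ∀ c < nc, ∀ v < I.n, (∃ i, s c ≤ i ∧ i < s (c + 1) ∧ q i = v) ↔
      ∃ hv : I.vt v ∈ I.Pᶜ, (I.G.induce I.Pᶜ).connectedComponentMk ⟨I.vt v, hv⟩ = gs c) :
    Set.InjOn gs (Finset.range nc) := by
  have main : ∀ c d, c < d → d < nc → gs c ≠ gs d := by
    intro c d hcd hd he
    have h1 := hs.lt d hd
    have h2 := hs.le_last (show d + 1 ≤ nc from hd)
    have hq := (hs.mem (s d) (by omega)).1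
    have h3 := (hg d hd _ hq).1 ⟨s d, le_rfl, h1, rfl⟩
    rw [← he] at h3
    obtain ⟨i, _, hi, hqi⟩ := (hg c (by omega) _ hq).2 h3
    have h4 := hs.mono (show c + 1 ≤ d from hcd) hd.le
    have := hs.inj i (by omega) (s d) (by omega) hqi
    omega
  intro c hc d hd he
  have hc : c < nc := by simpa using hc
  have hd : d < nc := by simpa using hd
  rcases Nat.lt_trichotomy c d with h | h | h
  · exact absurd he (main c d h hd)
  · exact h
  · exact absurd he.symm (main d c h hc)

/-- The total of the lengths of the inputs of the pieces is at least linear, and they belong to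
different components. -/
theorem sum_pieces_bounds {b : ℕ} {h : Store}
    {gs : ℕ → (I.G.induce (I.Pᶜ : Set V)).ConnectedComponent} (hr : I.Ready b h)
    (hg : I.Comps gs h) (hP : I.P ≠ Set.univ)
    [Fintype (I.G.induce (I.Pᶜ : Set V)).ConnectedComponent]
    (f : (I.G.induce (I.Pᶜ : Set V)).ConnectedComponent → ℕ)
    (hf : ∀ g (τ : piece I.G I.P g → ℕ), τ = 0 →
      ∀ (n : ℕ) (e : Fin n ≃ piece I.G I.P g) (es : List (piece I.G I.P g × piece I.G I.P g)),
      IsEdgeListing (I.G.induce (piece I.G I.P g)) es →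
      (encode e es τ {v | (v : V) ∈ I.P}).length ≤ f g) :
    I.n + I.D ≤ ∑ t ∈ Finset.range (h.reg .nc), f (gs t) ∧
      ∑ t ∈ Finset.range (h.reg .nc), f (gs t) ≤ ∑ g, f g := by
  classical
  have hs := hr.segs
  have hp := fun c hc => hs.isPiece hc (hg c hc)
  have hle : ∀ c ∈ Finset.range (h.reg .nc), 2 + 2 * (I.K + (h.arr .start (c + 1) - h.arr .start c)) +
      2 * (IsPiece.pieceDarts I (h.arr .q) (h.arr .loc) (h.arr .start c)
        (h.arr .start (c + 1))).length ≤ f (gs c) := by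
    intro c hc
    have hc := hp c (by simpa using hc)
    rw [← hc.encode_length 0]
    exact hf _ 0 rfl _ _ _ hc.edges_isListing
  have hn := hs.n_le hr.loc
  -- Some vertex is not removed, so there is a piece; without one, the removed vertices and the
  -- edges among them would be read by no call.
  have hnc : 0 < h.reg .nc := by
    obtain ⟨v, hv⟩ := (Set.ne_univ_iff_exists_notMem _).1 hP
    obtain ⟨i, hi, _⟩ := hs.vis _ (I.ix_lt v) (by rwa [I.vt_ix]) (hr.loc _ (I.ix_lt v))
    by_contra hcon
    have h1 := hs.last
    rw [show h.reg .nc = 0 by omega, hs.zero] at h1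
    omega
  constructor
  · refine le_trans ?_ (Finset.sum_le_sum hle)
    have h1 := hs.length_le hnc hr.loc hp
    have h2 := hs.sum_length
    rw [Finset.sum_add_distrib, Finset.sum_add_distrib, ← Finset.mul_sum, ← Finset.mul_sum,
      Finset.sum_add_distrib, h2]
    simp only [Finset.sum_const, Finset.card_range, smul_eq_mul]
    have h3 : 1 * I.K ≤ h.reg .nc * I.K := Nat.mul_le_mul_right _ hnc
    have h4 : I.D = 2 * I.es.length := rfl
    omega
  · rw [← Finset.sum_image (s := Finset.range (h.reg .nc)) (g := gs) (f := f)]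
    · exact Finset.sum_le_sum_of_subset (Finset.subset_univ _)
    · exact hs.comp_injOn hg

end Inst

end Sandpile

/-! ### Execution on the machine, number of chips and word length -/

namespace Sandpile

open WordRAM Cmd

set_option linter.constructorNameAsVariable false

namespace Inst

variable {V : Type u} {I : Inst V}

/-- The program of the theorem: the length of the output is moved to register `0`. -/
def mainProg (A : Prog) : Prog := .seq (all A).code (.op .or 0 Reg.len.idx Reg.len.idx)

/-- The `17` arrays account for the own memory, and procedures called one after the other contribute
only their maximum. The summand `2 * M.N` pays for reading the input and writing the output. -/
theorem returns_of_vc {M : Mach} (hM : M.Valid) (hN : M.N = 2 + 2 * I.n + I.D)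
    (hv : ∀ v ∈ I.enc, v < 2 ^ M.w) {A : Prog} {Q : List ℕ → ℕ → Prop}
    (h : vc M (all A) (fun h' c' => Q ((List.range (h'.reg .len)).map (h'.arr .inp)) c' ∧
      h'.reg .len ≤ M.N) I.store 0) :
    ∃ out t m c, Returns M.w (mainProg A) I.enc out t m ∧ Q out c ∧ t ≤ c + 2 * M.N + 1 ∧
      m ≤ 17 * M.N + M.b := by
  obtain ⟨s, k, h', hrun, hrel, hown, hsub, hQ, hlen⟩ := h.halts hM _ _ (I.rel_store hN hv)
  have hle : I.enc.length = M.N := by rw [enc_length, hN]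
  have hout : (s.setReg 0 (BinOp.or.eval M.w (s.reg Reg.len.idx) (s.reg Reg.len.idx))).output =
      (List.range (h'.reg .len)).map (h'.arr .inp) := by
    have h0 : (s.setReg 0 (BinOp.or.eval M.w (s.reg Reg.len.idx) (s.reg Reg.len.idx))).reg 0 =
        h'.reg .len := by
      simp only [State.setReg, Function.update_self, BinOp.eval, Nat.or_self, hrel.reg]
      exact Nat.mod_eq_of_lt (hrel.reg_lt _)
    unfold State.output State.block
    rw [h0]
    apply List.map_congr_left
    intro i hi
    have hi : i < h'.reg .len := by simpa using hi
    have := hrel.arr .inp i (by omega)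
    simpa [Arr.idx, State.setReg] using this
  refine ⟨_, _, _, _, ⟨_, _, Run.seq hrun (Run.op _ _ _ _ _), hout.symm, rfl, rfl⟩, hQ, ?_, ?_⟩
  · simp [procTime, Cost.andThen]
    omega
  · simp [procMem, Cost.andThen]
    omega

variable [Fintype V]

/-- The origin of `n ^ 6`: at most `n` vertices send at most `(n - 1) * 2 * n ^ 3` chips each, and
`2 ≤ n` turns the product into `n ^ 6`. For `n = 1` the factor `n - 1` vanishes. -/
theorem sum_chips_le (I : Inst V) {x : ℕ → ℕ}
    (hx : ∀ j, 1 ≤ j → j ≤ I.K → x j < 2 * I.n ^ 3) :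
    ∑ v, I.chips x v ≤ I.n ^ 6 + totalChips I.σ := by
  have hext : ∀ v, I.ext x v ≤ 2 * I.n ^ 3 := by
    intro v
    by_cases hv : v ∈ I.P
    · obtain ⟨j, h1, h2, rfl⟩ := I.exists_pv hv
      rw [I.ext_pv x h1 h2]
      exact (hx j h1 h2).le
    · rw [I.ext_of_notMem x hv]
      exact Nat.zero_le _
  unfold chips
  rw [Finset.sum_add_distrib, totalChips_eq_sum, sum_nbrSum, add_comm]
  refine Nat.add_le_add_right ?_ _
  have h1 : ∑ v, deg I.G v * I.ext x v ≤ I.n * ((I.n - 1) * (2 * I.n ^ 3)) := by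
    rw [← smul_eq_mul (a := I.n), ← I.card_eq, ← Finset.card_univ]
    refine Finset.sum_le_card_nsmul _ _ _ fun v _ => ?_
    rw [Finset.card_univ, I.card_eq]
    have := deg_lt_card I.G v
    rw [I.card_eq] at this
    exact Nat.mul_le_mul (by omega) (hext v)
  refine h1.trans ?_
  have hn := I.npos
  rcases Nat.eq_or_lt_of_le (Nat.succ_le_of_lt hn) with h | h
  · rw [← h]
    simp
  · calc I.n * ((I.n - 1) * (2 * I.n ^ 3)) ≤ I.n * (I.n * (I.n * I.n ^ 3)) := by
          gcongr
          · omega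
          · exact h
      _ = I.n ^ 6 := by ring

/-- Long words suffice for all numbers that occur. -/
theorem word_bounds (I : Inst V) {w : ℕ} (hw : (I.n + totalChips I.σ + 1) ^ 16 ≤ 2 ^ w) :
    17 * (2 + 2 * I.n + I.D) ≤ 2 ^ w ∧ 64 ≤ 2 ^ w ∧ I.n * (2 * I.n ^ 3) < 2 ^ w ∧
      (I.n + 2) * (I.n ^ 6 + totalChips I.σ) < 2 ^ w ∧ ∀ v ∈ I.enc, v < 2 ^ w := by
  set q := I.n + totalChips I.σ + 1 with hq
  have hn := I.npos
  have hq2 : 2 ≤ q := by omega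
  have hnq : I.n + 1 ≤ q := by omega
  have hD := I.D_le
  -- As `q ≥ 2`, factors `q` can be traded for factors `2`, which absorb the numerical constants
  -- below.
  have h2 : ∀ i ≤ 16, 2 ^ i * q ^ (16 - i) ≤ 2 ^ w := by
    intro i hi
    refine le_trans ?_ hw
    calc 2 ^ i * q ^ (16 - i) ≤ q ^ i * q ^ (16 - i) := by gcongr
      _ = q ^ 16 := by rw [← pow_add]; congr 1; omega
  have hDq : I.D ≤ q * q := hD.trans (Nat.mul_le_mul (by omega) (by omega))
  have hqq : 2 * q ≤ q * q := Nat.mul_le_mul_right _ hq2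
  have hchips : ∀ v, I.σ v ≤ totalChips I.σ := by
    intro v
    rw [totalChips_eq_sum]
    exact Finset.single_le_sum (f := I.σ) (fun _ _ => Nat.zero_le _) (Finset.mem_univ v)
  have hqw : q * q < 2 ^ w := by
    have h14 := h2 14 (by omega)
    norm_num at h14
    nlinarith
  refine ⟨?_, ?_, ?_, ?_, ?_⟩
  · have h14 := h2 14 (by omega)
    norm_num at h14
    nlinarith
  · have h14 := h2 14 (by omega)
    norm_num at h14
    nlinarith
  · have h12 := h2 12 (by omega)
    norm_num at h12
    have : I.n * (2 * I.n ^ 3) ≤ 2 * q ^ 4 := by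
      calc I.n * (2 * I.n ^ 3) ≤ q * (2 * q ^ 3) := by gcongr <;> omega
        _ = 2 * q ^ 4 := by ring
    have hpos : 0 < q ^ 4 := by positivity
    omega
  · have h8 := h2 8 (by omega)
    norm_num at h8
    have : (I.n + 2) * (I.n ^ 6 + totalChips I.σ) ≤ (2 * q) * (2 * q ^ 7) := by
      gcongr
      · omega
      · have e1 : I.n ^ 6 ≤ q ^ 7 := (Nat.pow_le_pow_left (by omega) 6).trans
          (Nat.pow_le_pow_right (by omega) (by omega))
        have e2 : totalChips I.σ ≤ q ^ 7 := (show totalChips I.σ ≤ q by omega).trans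
          (Nat.le_self_pow (by omega) q)
        omega
    have e3 : (2 * q) * (2 * q ^ 7) = 4 * q ^ 8 := by ring
    have hpos : 0 < q ^ 8 := by positivity
    omega
  · intro v hv
    have hle : q ≤ q * q := by omega
    suffices v ≤ q * q by omega
    rw [enc_eq] at hv
    simp only [List.mem_append, List.mem_cons, List.not_mem_nil, or_false] at hv
    rcases hv with (((rfl | rfl) | hv) | hv) | hv
    · omega
    · have : I.D = 2 * I.es.length := rfl
      omega
    · obtain ⟨i, rfl⟩ := (List.mem_ofFn' _ _).1 hv
      have := hchips (I.e i)
      simp only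
      omega
    · obtain ⟨i, rfl⟩ := (List.mem_ofFn' _ _).1 hv
      simp only [I.inp_ind i.2]
      split_ifs <;> omega
    · unfold ends at hv
      rw [List.mem_flatMap] at hv
      obtain ⟨d, _, hv⟩ := hv
      simp only [List.mem_cons, List.not_mem_nil, or_false] at hv
      have h1 := I.ix_lt d.1
      have h2 := I.ix_lt d.2
      omega

end Inst

end Sandpile

/-! ### Real bounds and the theorem -/

namespace Sandpile

open WordRAM Cmd

theorem exists_isEdgeListing {V : Type u} [Finite V] (G : SimpleGraph V) :
    ∃ es : List (V × V), IsEdgeListing G es := by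
  classical
  have : Fintype V := Fintype.ofFinite V
  have : Fintype G.edgeSet := Fintype.ofFinite _
  have h : (G.edgeFinset.toList.map Quot.out).map (fun d => s(d.1, d.2)) =
      G.edgeFinset.toList := by
    rw [List.map_map]
    conv_rhs => rw [← List.map_id G.edgeFinset.toList]
    exact List.map_congr_left fun d _ => Quot.out_eq d
  refine ⟨G.edgeFinset.toList.map Quot.out, ?_, fun d => ?_⟩
  · rw [h]
    exact Finset.nodup_toList _
  · rw [h, Finset.mem_toList, SimpleGraph.mem_edgeFinset]

/-- From `2 ^ b ≤ n ^ 3` follows `b * log 2 ≤ 3 * log n`; the additive `2` is dominated because `log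
n ≥ log 2`. -/
theorem le_mul_log {n b : ℕ} (hn : 2 ≤ n) (hb : 2 ^ (b + 1) ≤ 2 * n ^ 3) :
    (b : ℝ) + 2 ≤ 8 * Real.log n := by
  have h1 : (2 : ℝ) ^ b ≤ (n : ℝ) ^ 3 := by
    have : 2 ^ b ≤ n ^ 3 := by
      rw [pow_succ] at hb
      omega
    exact_mod_cast this
  have h2 := Real.log_le_log (by positivity) h1
  rw [Real.log_pow, Real.log_pow] at h2
  have h3 := Real.log_two_gt_d9
  have h4 : Real.log 2 ≤ Real.log n := Real.log_le_log (by norm_num) (by exact_mod_cast hn)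
  have h5 : (b : ℝ) * 0.69 ≤ b * Real.log 2 :=
    mul_le_mul_of_nonneg_left (by linarith) (Nat.cast_nonneg _)
  push_cast at h2
  linarith

/-- A crude bound that absorbs the additive cost of computing the power of two into the linear term;
unlike `le_mul_log`, it also covers `n = 1`. -/
theorem le_three_mul {n b : ℕ} (hb : 2 ^ (b + 1) ≤ 2 * n ^ 3) : b ≤ 3 * n := by
  have h1 : 2 ^ b ≤ n ^ 3 := by
    rw [pow_succ] at hb
    omega
  have h2 : n ^ 3 ≤ 2 ^ (3 * n) := by
    rw [mul_comm, pow_mul]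
    exact Nat.pow_le_pow_left Nat.lt_two_pow_self.le 3
  exact (Nat.pow_le_pow_iff_right (by norm_num)).1 (h1.trans h2)

theorem time_le {n b k D S N c t : ℕ} {x : ℝ} (hn : 0 < n) (hk : k < n)
    (hb : 2 ^ (b + 1) ≤ 2 * n ^ 3) (hS : n + D ≤ S) (hN : N = 2 + 2 * n + D)
    (hc : c ≤ 5000 * (b + 2) ^ k * S + 20 * b) (ht : t ≤ c + 2 * N + 1) (hx : (S : ℝ) ≤ x) :
    (t : ℝ) ≤ 5100 * (5100 * Real.log n) ^ k * x := by
  have h1 := le_three_mul hb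
  have h2 : 1 * S ≤ (b + 2) ^ k * S := Nat.mul_le_mul_right _ (Nat.one_le_pow _ _ (by omega))
  -- Here `20 * b ≤ 60 * S`, and `2 * N + 1 ≤ 9 * S` since `S ≥ n + D` and `n ≥ 1`.
  have h3 : t ≤ 5100 * ((b + 2) ^ k * S) := by
    rw [mul_assoc] at hc
    omega
  have h4 : ((b : ℝ) + 2) ^ k ≤ (5100 * Real.log n) ^ k := by
    -- For `k = 0` both powers are `1`, even when `log n = 0`. For `k > 0` the hypothesis `k < n`
    -- gives `n ≥ 2`.
    rcases Nat.eq_zero_or_pos k with rfl | hk0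
    · simp
    · have h5 := le_mul_log (show 2 ≤ n by omega) hb
      have h6 : 0 ≤ Real.log n := Real.log_natCast_nonneg n
      exact pow_le_pow_left₀ (by positivity) (by linarith) k
  calc (t : ℝ) ≤ 5100 * (((b : ℝ) + 2) ^ k * S) := by exact_mod_cast h3
    _ ≤ 5100 * ((5100 * Real.log n) ^ k * x) := by
      have h7 : (0 : ℝ) ≤ S := Nat.cast_nonneg _
      have h8 : (0 : ℝ) ≤ ((b : ℝ) + 2) ^ k := by positivity
      have := mul_le_mul h4 hx h7 (h8.trans h4)
      linarith
    _ = _ := by ring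

end Sandpile

open WordRAM Sandpile Sandpile.Inst in
theorem solves_of_pieces (A : Prog) {V : Type u} [Finite V] (G : SimpleGraph V) (σ : V → ℕ) (P : Set V)
    (hP : P ≠ Set.univ) (w : ℕ) (hw : (Nat.card V + totalChips σ + 1) ^ 16 ≤ 2 ^ w)
    (T M : (G.induce (Pᶜ : Set V)).ConnectedComponent → ℝ)
    (hTM : ∀ (g : (G.induce (Pᶜ : Set V)).ConnectedComponent) (τ : piece G P g → ℕ),
        totalChips τ ≤ Nat.card V ^ 6 + totalChips σ →
        SolvesWithin w A (G.induce (piece G P g)) τ {v | (v : V) ∈ P} {v | (v : V) ∈ P}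
          (T g) (M g)) :
    SolvesWithin w (mainProg A) G σ P ∅
      (5100 * (5100 * Real.log (Nat.card V)) ^ P.ncard * ∑ᶠ g, T g) (5100 * ∑ᶠ g, M g) := by
  classical
  intro n e es hes
  have hcard : Nat.card V = n := by rw [← Nat.card_congr e, Nat.card_fin]
  rw [hcard] at hw hTM ⊢
  have : Fintype V := Fintype.ofFinite V
  have : Fintype (G.induce (Pᶜ : Set V)).ConnectedComponent := Fintype.ofFinite _
  obtain ⟨v₀, hv₀⟩ := (Set.ne_univ_iff_exists_notMem P).1 hP
  have hn : 0 < n := (Nat.zero_le _).trans_lt (e.symm v₀).2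
  have : Nonempty (G.induce (Pᶜ : Set V)).ConnectedComponent :=
    ⟨(G.induce (Pᶜ : Set V)).connectedComponentMk ⟨v₀, hv₀⟩⟩
  set I : Inst V := ⟨n, hn, e, es, G, σ, P, hes⟩ with hI
  -- Running times and memories are natural numbers, so the real bounds may be replaced by their
  -- floors.
  set tf : (G.induce (Pᶜ : Set V)).ConnectedComponent → ℕ := fun g => ⌊T g⌋₊ with htf
  set mf : (G.induce (Pᶜ : Set V)).ConnectedComponent → ℕ := fun g => ⌊M g⌋₊ with hmf
  -- Each bound dominates an actual run, for instance on the empty configuration with some numbering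
  -- and some list of the edges.
  have hnonneg : ∀ g, 0 ≤ T g ∧ 0 ≤ M g := by
    intro g
    obtain ⟨es', hes'⟩ := exists_isEdgeListing (G.induce (piece G P g))
    have : Fintype (piece G P g) := Fintype.ofFinite _
    obtain ⟨out, t, m, _, _, h1, h2⟩ := hTM g 0 (by simp [totalChips]) _
      (Fintype.equivFin (piece G P g)).symm es' hes'
    exact ⟨(Nat.cast_nonneg t).trans h1, (Nat.cast_nonneg m).trans h2⟩
  have hA : I.SolvesPieces A w (n ^ 6 + totalChips σ) tf (∑ g, mf g) := by
    intro g τ hτ n' e' es' hes'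
    obtain ⟨out, t, m, hret, hans, h1, h2⟩ := hTM g τ hτ n' e' es' hes'
    refine ⟨out, t, m, hret, hans, Nat.le_floor h1, (Nat.le_floor h2).trans ?_⟩
    exact Finset.single_le_sum (f := mf) (fun _ _ => Nat.zero_le _) (Finset.mem_univ g)
  have hlen : ∀ g (τ : piece I.G I.P g → ℕ), τ = 0 →
      ∀ (n' : ℕ) (e' : Fin n' ≃ piece I.G I.P g) (es' : List (piece I.G I.P g × piece I.G I.P g)),
      IsEdgeListing (I.G.induce (piece I.G I.P g)) es' →
      (encode e' es' τ {v | (v : V) ∈ I.P}).length ≤ tf g ∧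
      (encode e' es' τ {v | (v : V) ∈ I.P}).length ≤ mf g := by
    rintro g τ rfl n' e' es' hes'
    obtain ⟨out, t, m, hret, _, h1, h2⟩ := hTM g 0 (by simp [totalChips]) n' e' es' hes'
    obtain ⟨h3, h4⟩ := length_le_of_returns hret
    exact ⟨h3.trans (Nat.le_floor h1), h4.trans (Nat.le_floor h2)⟩
  obtain ⟨hw1, hw2, hw3, hw4, hw5⟩ := I.word_bounds hw
  have hvc := vc_all (I := I) (M := ⟨w, 2 + 2 * I.n + I.D, ∑ g, mf g⟩) ⟨hw1, hw2⟩ rfl hA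
    (S := ∑ g, tf g) (S' := ∑ g, mf g) hw3 hw4 (fun x hx => I.sum_chips_le hx)
    fun h b gs hr hg => ⟨(sum_pieces_bounds hr hg hP tf fun g τ hτ n' e' es' hes' =>
        (hlen g τ hτ n' e' es' hes').1).1, (sum_pieces_bounds hr hg hP tf
        fun g τ hτ n' e' es' hes' => (hlen g τ hτ n' e' es' hes').1).2,
      (sum_pieces_bounds hr hg hP mf fun g τ hτ n' e' es' hes' =>
        (hlen g τ hτ n' e' es' hes').2).1.trans (sum_pieces_bounds hr hg hP mf
        fun g τ hτ n' e' es' hes' => (hlen g τ hτ n' e' es' hes').2).2⟩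
  obtain ⟨out, t, m, c, hret, ⟨hans, hS', hS, b, hb, hc⟩, ht, hm⟩ :=
    returns_of_vc (I := I) (M := ⟨w, 2 + 2 * I.n + I.D, ∑ g, mf g⟩) (A := A)
    (Q := fun out c => IsAnswer I.G ∅ I.σ I.e out ∧ I.n + I.D ≤ ∑ g, mf g ∧
      I.n + I.D ≤ ∑ g, tf g ∧ ∃ b, 2 ^ (b + 1) ≤ 2 * I.n ^ 3 ∧
      c ≤ 5000 * (b + 2) ^ I.K * (∑ g, tf g) + 20 * b) ⟨hw1, hw2⟩ rfl hw5
    (hvc.imp _ fun h c ⟨h1, h2, h3, h4, h5⟩ => ⟨⟨h1, h3, h4, h5⟩, h2⟩)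
  refine ⟨out, t, m, hret, hans, ?_, ?_⟩
  · have hk : I.K < I.n := by
      rw [I.K_eq]
      change P.ncard < n
      rw [← hcard]
      exact Set.ncard_lt_card hP
    have := time_le (x := ∑ᶠ g, T g) hn hk hb hS rfl hc ht ?_
    · rw [I.K_eq] at this
      exact this
    · rw [finsum_eq_sum_of_fintype]
      push_cast
      exact Finset.sum_le_sum fun g _ => Nat.floor_le (hnonneg g).1
  -- The arrays have `2 + 2 * n + D` words each, which is at most `4 * (n + D)` and hence at most
  -- four times the total of the `mf g`; the same total also bounds the memory of each call.
  · have h1 : m ≤ 5100 * ∑ g, mf g := by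
      have := I.npos
      simp only at hm
      omega
    have h2 : ((∑ g, mf g : ℕ) : ℝ) ≤ ∑ᶠ g, M g := by
      rw [finsum_eq_sum_of_fintype]
      push_cast
      exact Finset.sum_le_sum fun g _ => Nat.floor_le (hnonneg g).2
    calc (m : ℝ) ≤ 5100 * ((∑ g, mf g : ℕ) : ℝ) := by exact_mod_cast h1
      _ ≤ _ := by linarith

theorem mainTheorem4 :
    ∃ C κ : ℕ, ∀ A : WordRAM.Prog, ∃ B : WordRAM.Prog,
      ∀ (V : Type u) [Finite V] (G : SimpleGraph V) (σ : V → ℕ) (P : Set V),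
      P ≠ Set.univ →
      ∀ (w : ℕ), (Nat.card V + Sandpile.totalChips σ + 1) ^ κ ≤ 2 ^ w →
      ∀ (T M : (G.induce (Pᶜ : Set V)).ConnectedComponent → ℝ),
      (∀ (g : (G.induce (Pᶜ : Set V)).ConnectedComponent) (τ : Sandpile.piece G P g → ℕ),
        Sandpile.totalChips τ ≤ Nat.card V ^ 6 + Sandpile.totalChips σ →
        Sandpile.SolvesWithin w A (G.induce (Sandpile.piece G P g)) τ
          {v | (v : V) ∈ P} {v | (v : V) ∈ P} (T g) (M g)) →
      Sandpile.SolvesWithin w B G σ P ∅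
        (C * (C * Real.log (Nat.card V)) ^ P.ncard * ∑ᶠ g, T g)
        (C * ∑ᶠ g, M g) := by
  refine ⟨5100, 16, fun A => ⟨Sandpile.Inst.mainProg A, fun V _ G σ P hP w hw T M hTM => ?_⟩⟩
  exact_mod_cast solves_of_pieces A G σ P hP w hw T M hTM
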